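/- **Setting.** Let $X$ be a Polish space with a $\sigma$-finite Borel measure $m_\diamond$ of full support, $\mathcal H=L^2(X,m_\diamond)$, and let $\mathcal E_\diamond$ be a strongly local Dirichlet form on $\mathcal H$ with domain $\mathcal F$ and square field operator $\Gamma_\diamond:\mathcal F\times\mathcal F\to L^1(X,m_\diamond)$, $\mathcal E_\diamond(u,v)=\int\Gamma_\diamond(u,v)\,dm_\diamond$. Here $\mathcal F$ is a Hilbert space with $\|u\|_{\mathcal F}^2=\mathcal E_\diamond(u,u)+\|u\|_{\mathcal H}^2$, and $\mathcal F\subset\mathcal H\subset\mathcal F^*$. Let $T>0$ and write $\Gamma(u)=\Gamma(u,u)$. Let $f:(0,T)\times X\to\mathbb R$ be bounded and measurable with $f_t\in\mathcal F$ for all $t$ and $\Gamma_\diamond(f_t)\le C$ $m_\diamond$-a.e. with $C$ independent of $t$; put $m_t=e^{-f_t}m_\diamond$. Let $(\Gamma_t)_{t\in(0,T)}$ be symmetric positive semidefinite bilinear maps $\mathcal F\times\mathcal F\to L^1(X,m_\diamond)$ such that * each $\Gamma_t$ has the diffusion property: $\Gamma_t(\Psi(u_1,\dots,u_k),v)=\sum_i\partial_i\Psi(u_1,\dots,u_k)\,\Gamma_t(u_i,v)$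 for all $k$, all $u_1,\dots,u_k,v\in\mathcal F\cap L^\infty$ and all $\Psi\in C^1(\mathbb R^k)$ with $\Psi(0)=0$; * (uniform ellipticity) there is $C>0$ with $\frac1C\Gamma_\diamond(u)\le\Gamma_t(u)\le C\,\Gamma_\diamond(u)$ a.e. for all $t\in(0,T)$, $u\in\mathcal F$; * $t\mapsto\mathcal E_t(u,v):=\int_X\Gamma_t(u,v)\,dm_t$ is Lebesgue measurable on $(0,T)$ for all $u,v\in\mathcal F$. For $0\le s<\tau\le T$ let $\mathcal F_{(s,\tau)}=L^2((s,\tau)\to\mathcal F)\cap H^1((s,\tau)\to\mathcal F^*)$, which embeds in $C([s,\tau]\to\mathcal H)$; the values $u_r$, $r\in[s,\tau]$, are those of the continuous representative. A function $u\in\mathcal F_{(s,\tau)}$ *solves the heat equation* on $(s,\tau)\times X$ if for all $w\in\mathcal F_{(s,\tau)}$ $$-\int_s^\tau\mathcal E_t(u_t,w_t)\,dt=\int_s^\tau\langle\partial_tu_t,w_te^{-f_t}\rangle_{\mathcal F^*,\mathcal F}\,dt ,$$ and $v\in\mathcal F_{(s,\tau)}$ *solves the adjoint heat equation* on $(s,\tau)\times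 X$ if for all $w\in\mathcal F_{(s,\tau)}$ $$\int_s^\tau\mathcal E_r(v_r,w_r)\,dr+\int_s^\tau\!\int_X v_rw_r\,\partial_rf_r\,dm_r\,dr=\int_s^\tau\langle\partial_rv_r,w_re^{-f_r}\rangle_{\mathcal F^*,\mathcal F}\,dr .$$ **Theorem.** (1) For all $0\le s<\tau\le T$ and $h\in\mathcal H$ there is a unique solution $u\in\mathcal F_{(s,\tau)}$ of the heat equation on $(s,\tau)\times X$ with $u_s=h$; moreover, for $u\in\mathcal F_{(s,\tau)}$ the condition $u_s=h$ is equivalent to $\lim_{t\searrow s}u_t=h$ in $\mathcal H$. There are bounded linear operators $P_{t,s}$ ($0\le s\le t\le T$) on $\mathcal H$ with $P_{t,t}=\mathrm{Id}$ such that this solution is $u_t=P_{t,s}h$ for $t\in[s,\tau]$, and $P_{t,r}=P_{t,s}\circ P_{s,r}$ for all $0\le r\le s\le t\le T$. (2) Assume in addition that $|f_t(x)-f_s(x)|\le L|t-s|$ for some $L$ and all $s,t\in(0,T)$, $x\in X$. Then: (i) For all $0\le\sigma<t\le T$ and $g\in\mathcal H$ there is a unique solution $v\in\mathcal F_{(\sigma,t)}$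 of the adjoint heat equation on $(\sigma,t)\times X$ with $v_t=g$. (ii) There are bounded linear operators $P^*_{t,s}$ ($0\le s\le t\le T$) on $\mathcal H$ with $P^*_{t,t}=\mathrm{Id}$ such that this solution is $v_s=P^*_{t,s}g$ for $s\in[\sigma,t]$, and $P^*_{t,r}=P^*_{s,r}\circ P^*_{t,s}$ for all $0\le r\le s\le t\le T$. (iii) For all $0<s\le t<T$ and $g,h\in\mathcal H$: $\int_X P_{t,s}h\cdot g\,dm_t=\int_X h\cdot P^*_{t,s}g\,dm_s$. -/

import Mathlib

open MeasureTheory Set Filter Topology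
open scoped ENNReal ContDiff

noncomputable section

/-- A (symmetric) Dirichlet form on the real space `L²(X, m)`: a densely defined, nonnegative,
symmetric, closed bilinear form with the Markov property for all normal contractions. -/
structure DirichletForm {X : Type*} [MeasurableSpace X] (m : Measure X) where
  domain : Submodule ℝ (Lp ℝ 2 m)
  form : domain →ₗ[ℝ] domain →ₗ[ℝ] ℝ
  dense_domain : Dense (domain : Set (Lp ℝ 2 m))
  symm : ∀ u v, form u v = form v u
  nonneg : ∀ u, 0 ≤ form u u
  closed : ∀ (u : ℕ → domain) (a : Lp ℝ 2 m),
    Tendsto (fun n => (u n : Lp ℝ 2 m)) atTop (𝓝 a) →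
    (∀ ε > 0, ∃ N, ∀ n ≥ N, ∀ k ≥ N, form (u n - u k) (u n - u k) < ε) →
    ∃ w : domain, (w : Lp ℝ 2 m) = a ∧
      Tendsto (fun n => form (u n - w) (u n - w)) atTop (𝓝 0)
  markov : ∀ (ξ : ℝ → ℝ) (hξ : LipschitzWith 1 ξ) (h0 : ξ 0 = 0) (u : domain),
    ∃ h : hξ.compLp h0 (u : Lp ℝ 2 m) ∈ domain, form ⟨_, h⟩ ⟨_, h⟩ ≤ form u u

namespace DirichletForm

variable {X : Type*} [MeasurableSpace X] {m : Measure X} (E : DirichletForm m)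

/-- The form domain `𝓕`, a type of its own because it carries the norm
`‖u‖² = E(u, u) + ‖u‖²_{L²}` and not the norm of `L²`. -/
def Dom : Type _ := E.domain

instance : AddCommGroup E.Dom := inferInstanceAs (AddCommGroup E.domain)

instance : Module ℝ E.Dom := inferInstanceAs (Module ℝ E.domain)

/-- The inclusion of the form domain in `L²(X, m)`, as a linear map. -/
def incl : E.Dom →ₗ[ℝ] Lp ℝ 2 m := E.domain.subtype

/-- The Dirichlet form `E(u, v)` on its domain. -/
def energy : E.Dom →ₗ[ℝ] E.Dom →ₗ[ℝ] ℝ := E.form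

/-- The scalar product `E(u, v) + ∫ u v dm` on the form domain. -/
@[reducible] def innerCore : InnerProductSpace.Core ℝ E.Dom where
  inner u v := E.energy u v + inner ℝ (E.incl u) (E.incl v)
  conj_inner_symm u v := by
    have h : E.energy v u = E.energy u v := E.symm v u
    simp [h, real_inner_comm]
  re_inner_nonneg u := by
    have h : 0 ≤ E.energy u u := E.nonneg u
    have h2 : 0 ≤ inner ℝ (E.incl u) (E.incl u) := real_inner_self_nonneg
    simpa using add_nonneg h h2
  add_left u v w := by
    simp [inner_add_left]; ring
  smul_left u v r := by
    simp [inner_smul_left]; ring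
  definite u hu := by
    have h : 0 ≤ E.energy u u := E.nonneg u
    have h2 : 0 ≤ inner ℝ (E.incl u) (E.incl u) := real_inner_self_nonneg
    have hu' : E.energy u u + inner ℝ (E.incl u) (E.incl u) = 0 := hu
    have h3 : inner ℝ (E.incl u) (E.incl u) = 0 := by linarith
    have h4 : E.incl u = 0 := inner_self_eq_zero.mp h3
    exact Subtype.ext h4

instance : NormedAddCommGroup E.Dom := E.innerCore.toNormedAddCommGroup

instance : InnerProductSpace ℝ E.Dom := InnerProductSpace.ofCore E.innerCore.toCore

theorem inner_def (u v : E.Dom) :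
    inner ℝ u v = E.energy u v + inner ℝ (E.incl u) (E.incl v) := rfl

theorem norm_sq_def (u : E.Dom) : ‖u‖ ^ 2 = E.energy u u + ‖E.incl u‖ ^ 2 := by
  rw [← real_inner_self_eq_norm_sq, ← real_inner_self_eq_norm_sq, inner_def]

/-- The continuous embedding `𝓕 ⊂ L²(X, m)`. -/
def toL2 : E.Dom →L[ℝ] Lp ℝ 2 m :=
  E.incl.mkContinuous 1 (fun u => by
    have h : 0 ≤ E.energy u u := E.nonneg u
    have h2 := E.norm_sq_def u
    rw [one_mul]
    exact abs_le_of_sq_le_sq' (by linarith) (norm_nonneg _) |>.2)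

/-- The form domain is a Hilbert space. -/
instance : CompleteSpace E.Dom := by
  refine Metric.complete_of_cauchySeq_tendsto fun u hu => ?_
  have h1 : CauchySeq fun n => E.toL2 (u n) := E.toL2.uniformContinuous.comp_cauchySeq hu
  obtain ⟨a, ha⟩ := cauchySeq_tendsto_of_complete h1
  obtain ⟨w, hw, hlim⟩ := E.closed u a ha (by
    intro ε hε
    obtain ⟨N, hN⟩ := Metric.cauchySeq_iff.mp hu (Real.sqrt ε) (Real.sqrt_pos.mpr hε)
    refine ⟨N, fun n hn k hk => ?_⟩
    have h2 := hN n hn k hk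
    rw [dist_eq_norm] at h2
    have h3 : ‖u n - u k‖ ^ 2 < ε := by
      rw [← Real.sq_sqrt hε.le]
      exact pow_lt_pow_left₀ h2 (norm_nonneg _) two_ne_zero
    rw [norm_sq_def] at h3
    have h4 : E.energy (u n - u k) (u n - u k) < ε := by
      have := sq_nonneg ‖E.incl (u n - u k)‖
      linarith
    exact h4)
  have ha' : Tendsto (fun n => E.incl (u n)) atTop (𝓝 a) := ha
  let w' : E.Dom := w
  have hlim' : Tendsto (fun n => E.energy (u n - w') (u n - w')) atTop (𝓝 0) := hlim
  refine ⟨w', tendsto_iff_norm_sub_tendsto_zero.mpr ?_⟩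
  have h5 : Tendsto (fun n => ‖u n - w'‖ ^ 2) atTop (𝓝 0) := by
    have h6 : Tendsto (fun n => ‖E.incl (u n) - a‖ ^ 2) atTop (𝓝 0) := by
      simpa using (tendsto_iff_norm_sub_tendsto_zero.mp ha').pow 2
    have h7 := hlim'.add h6
    rw [add_zero] at h7
    refine h7.congr fun n => ?_
    have h8 : E.incl w' = a := hw
    rw [norm_sq_def, map_sub E.incl, h8]
  have h9 := h5.sqrt
  simpa [Real.sqrt_sq (norm_nonneg _)] using h9

/-- Strong locality: `E(u, v) = 0` whenever `(u + c) v = 0` a.e. for some constant `c`. -/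
def IsStronglyLocal : Prop :=
  ∀ (u v : E.Dom) (c : ℝ), (∀ᵐ x ∂m, (E.toL2 u x + c) * E.toL2 v x = 0) → E.energy u v = 0

/-- `u ∈ L^∞(X, m)`. -/
def IsBdd (u : E.Dom) : Prop := ∃ C : ℝ, ∀ᵐ x ∂m, |E.toL2 u x| ≤ C

/-- The element of the form domain that is a.e. equal to the function `g`
(and `0` if there is none). -/
def ofFun (g : X → ℝ) : E.Dom :=
  open Classical in
  if h : ∃ w : E.Dom, E.toL2 w =ᵐ[m] g then h.choose else 0

/-- Bilinear maps from the form domain to `L¹(X, m)`. -/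
abbrev FieldForm : Type _ := E.Dom →ₗ[ℝ] E.Dom →ₗ[ℝ] Lp ℝ 1 m

/-- `Γ` is the square field operator (carré du champ) of `E`, and `E(u, v) = ∫ Γ(u, v) dm`.
The field `leibniz` is the defining identity `∫ h Γ(u) dm = E(u h, u) - E(u², h) / 2` for bounded
`u, h` in the domain; there `p` is the product `u h` and `q` is `u²`. -/
structure IsSquareField (Γ : E.FieldForm) : Prop where
  symm : ∀ u v, Γ u v = Γ v u
  nonneg : ∀ u, ∀ᵐ x ∂m, 0 ≤ Γ u u x
  leibniz : ∀ u h p q : E.Dom, E.IsBdd u → E.IsBdd h →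
    (∀ᵐ x ∂m, E.toL2 p x = E.toL2 u x * E.toL2 h x) →
    (∀ᵐ x ∂m, E.toL2 q x = E.toL2 u x ^ 2) →
    ∫ x, E.toL2 h x * Γ u u x ∂m = E.energy p u - E.energy q h / 2
  energy_eq : ∀ u v, E.energy u v = ∫ x, Γ u v x ∂m

/-- The diffusion property (chain rule)
`Γ(Ψ(u₁, …, u_k), v) = ∑ i, ∂_i Ψ(u₁, …, u_k) Γ(u_i, v)`
for bounded `u_i, v` in the domain and `Ψ` of class `C¹` with `Ψ(0) = 0`. -/
def HasDiffusionProperty (Γ : E.FieldForm) : Prop :=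
  ∀ (k : ℕ) (u : Fin k → E.Dom) (v : E.Dom) (Ψ : (Fin k → ℝ) → ℝ) (w : E.Dom),
    (∀ i, E.IsBdd (u i)) → E.IsBdd v → ContDiff ℝ 1 Ψ → Ψ 0 = 0 →
    (∀ᵐ x ∂m, E.toL2 w x = Ψ (fun i => E.toL2 (u i) x)) →
    ∀ᵐ x ∂m, Γ w v x =
      ∑ i, fderiv ℝ Ψ (fun j => E.toL2 (u j) x) (Pi.single i 1) * Γ (u i) v x

/-- The embedding `𝓕 ⊂ L²(X, m) ⊂ 𝓕*`, where `u` acts as `w ↦ ∫ u w dm`. -/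
def toDual (u : E.Dom) : StrongDual ℝ E.Dom := (innerSL ℝ (E.toL2 u)).comp E.toL2

/-- The space `𝓕_{(s,τ)} = L²((s,τ) → 𝓕) ∩ H¹((s,τ) → 𝓕*)`: a class of curves `u` together with
its distributional time derivative `∂ₜu`, which is determined by `u`. -/
@[ext] structure CurveSpace (s τ : ℝ) where
  curve : Lp E.Dom 2 (volume.restrict (Ioo s τ))
  dt : Lp (StrongDual ℝ E.Dom) 2 (volume.restrict (Ioo s τ))
  weak_deriv : ∀ φ : ℝ → ℝ, ContDiff ℝ ∞ φ → HasCompactSupport φ → tsupport φ ⊆ Ioo s τ →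
    ∫ t in Ioo s τ, deriv φ t • E.toDual (curve t) = - ∫ t in Ioo s τ, φ t • dt t

variable {E} {s τ : ℝ}

/-- `c` is the representative of `u ∈ 𝓕_{(s,τ)}` in `C([s,τ] → L²(X, m))`. -/
def CurveSpace.IsContRep (u : E.CurveSpace s τ) (c : ℝ → Lp ℝ 2 m) : Prop :=
  ContinuousOn c (Icc s τ) ∧ ∀ᵐ t ∂(volume.restrict (Ioo s τ)), c t = E.toL2 (u.curve t)

/-- `u_r = h` for `r ∈ [s, τ]`, read off from the continuous representative. -/
def CurveSpace.HasValueAt (u : E.CurveSpace s τ) (r : ℝ) (h : Lp ℝ 2 m) : Prop :=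
  ∃ c : ℝ → Lp ℝ 2 m, u.IsContRep c ∧ c r = h

/-- `lim_{t ↘ s} u_t = h` in `L²(X, m)`, for the representative that is continuous on `(s, τ)`. -/
def CurveSpace.HasInitialLimit (u : E.CurveSpace s τ) (h : Lp ℝ 2 m) : Prop :=
  ∃ c : ℝ → Lp ℝ 2 m, ContinuousOn c (Ioo s τ) ∧
    (∀ᵐ t ∂(volume.restrict (Ioo s τ)), c t = E.toL2 (u.curve t)) ∧
    Tendsto c (𝓝[>] s) (𝓝 h)

/-- The measure `m_t = e^{-f_t} m`. -/
def weighted (m : Measure X) (f : ℝ → X → ℝ) (t : ℝ) : Measure X :=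
  m.withDensity (fun x => ENNReal.ofReal (Real.exp (-f t x)))

/-- The form `E_t(u, v) = ∫ Γ_t(u, v) dm_t`. -/
def energyAt (Γ : ℝ → E.FieldForm) (f : ℝ → X → ℝ) (t : ℝ) (u v : E.Dom) : ℝ :=
  ∫ x, Γ t u v x ∂(weighted m f t)

/-- The dual pairing `⟨∂ₜu_t, w_t e^{-f_t}⟩` of `𝓕*` and `𝓕`. -/
def CurveSpace.pairing (f : ℝ → X → ℝ) (u w : E.CurveSpace s τ) (t : ℝ) : ℝ :=
  u.dt t (E.ofFun (fun x => E.toL2 (w.curve t) x * Real.exp (-f t x)))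

/-- `u` is a solution to the heat equation `A_t u = ∂ₜu` on `(s, τ) × X`. -/
def CurveSpace.IsHeatSolution (Γ : ℝ → E.FieldForm) (f : ℝ → X → ℝ)
    (u : E.CurveSpace s τ) : Prop :=
  ∀ w : E.CurveSpace s τ,
    - ∫ t in Ioo s τ, energyAt Γ f t (u.curve t) (w.curve t) =
      ∫ t in Ioo s τ, u.pairing f w t

/-- `v` is a solution to the adjoint heat equation `-A_r v + ∂ᵣf · v = ∂ᵣv` on `(s, τ) × X`. -/
def CurveSpace.IsAdjointHeatSolution (Γ : ℝ → E.FieldForm) (f : ℝ → X → ℝ)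
    (v : E.CurveSpace s τ) : Prop :=
  ∀ w : E.CurveSpace s τ,
    (∫ r in Ioo s τ, energyAt Γ f r (v.curve r) (w.curve r)) +
      (∫ r in Ioo s τ, ∫ x, E.toL2 (v.curve r) x * E.toL2 (w.curve r) x *
        deriv (fun q => f q x) r ∂(weighted m f r)) =
      ∫ r in Ioo s τ, v.pairing f w r

end DirichletForm

end

/-! Both equations are linear nonautonomous evolution equations in the triple `V ⊂ H ⊂ V*`, with `V`
the form domain and `H = L²(X, m)`, and Lions' theory applies once the weights are removed. Identify
`V*` with `V` by Riesz; the embedding `V ⊂ V*` becomes `gramOp ι`, that is `ι†ι`. Multiplication by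
`e^{±f_t}` is bounded on `V`, by the chain rule and the bound on the gradient of `f_t`. Replacing
`w` by `w e^{f_t}` in the heat equation therefore turns it into `∂ₜu = -A_t u` with `⟪A_t u, w⟫ =
E_t(u, w e^{f_t})`. The weights cancel in `e^{-f} Γ(u, u e^f) = Γ(u) + u Γ(u, f)`, which is at least
`Γ(u)/2 - u² Γ(f)/2`. So `A_t` is bounded and coercive up to a multiple of `‖u‖²` in `H`
(`IsEllipticField.coercive`).

The abstract part rests on three facts. Curves in `L²(V)` with derivative in `L²(V*)` are continuous
in `H` and satisfy the product rule (`IsWeakCurve.exists_contRep_aux`,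
`IsWeakCurve.inner_sub_inner_eq_integral`); this is shown by regularising with the resolvent of
`ι†ι`. The resulting energy identity and Gronwall's inequality give uniqueness and bounds. Existence
is a Riesz representation on test curves vanishing at the final time
(`IsQuasiCoerciveFamily.exists_solution`). Uniqueness turns the solution maps into a propagator.

If `f` is Lipschitz in time, then `∂ₜf` exists for almost every time and is bounded by the Lipschitz
constant wherever it is defined. The adjoint equation becomes a backward equation of the same type
with a bounded potential, solved by time reversal. For the duality, `v e^{-f}` is again a weak
curve, and its derivative contains `-∂ₜf v e^{-f}`, which cancels the potential. Since `E_t` is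
symmetric, `∫ u v dm_t` is constant in time (`IsPotentialFamily.integral_mul_weighted_eq`). -/

/-! ### Absolutely continuous functions with values in a normed space -/

section AbsolutelyContinuous

variable {F G : Type*} [NormedAddCommGroup F] [NormedSpace ℝ F]
  [NormedAddCommGroup G]

/-- The sums that define absolute continuity of `q` are at most `C` times those of `f`. Primitives,
quadratic expressions and exponentials are all treated in this way. -/
theorem AbsolutelyContinuousOnInterval.of_dist_le {X Y : Type*} [PseudoMetricSpace X]
    [PseudoMetricSpace Y] {f : ℝ → X} {q : ℝ → Y} {a b : ℝ} (C : ℝ)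
    (hf : AbsolutelyContinuousOnInterval f a b)
    (h : ∀ x ∈ uIcc a b, ∀ y ∈ uIcc a b, dist (q x) (q y) ≤ C * dist (f x) (f y)) :
    AbsolutelyContinuousOnInterval q a b := by
  have h0 := Tendsto.const_mul C hf
  rw [mul_zero] at h0
  refine squeeze_zero' ?_ ?_ h0
  · exact Filter.Eventually.of_forall fun _ => Finset.sum_nonneg fun i _ => dist_nonneg
  · rw [eventually_inf_principal]
    refine Filter.Eventually.of_forall fun E hE => ?_
    rw [Finset.mul_sum]
    exact Finset.sum_le_sum fun i hi => h _ (hE.1 i hi).1 _ (hE.1 i hi).2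

theorem IntervalIntegrable.absolutelyContinuousOnInterval_primitive {f : ℝ → F}
    {a b c : ℝ} (h : IntervalIntegrable f volume a b) (hc : c ∈ uIcc a b) :
    AbsolutelyContinuousOnInterval (fun x => ∫ v in c..x, f v) a b := by
  have h1 := h.norm.absolutelyContinuousOnInterval_intervalIntegral hc
  refine h1.of_dist_le 1 fun x hx y hy => ?_
  have hcx : IntervalIntegrable f volume c x := h.mono_set (uIcc_subset_uIcc hc hx)
  have hcy : IntervalIntegrable f volume c y := h.mono_set (uIcc_subset_uIcc hc hy)
  rw [one_mul, dist_eq_norm, dist_eq_norm, intervalIntegral.integral_interval_sub_left hcx hcy,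
    intervalIntegral.integral_interval_sub_left hcx.norm hcy.norm, Real.norm_eq_abs]
  exact intervalIntegral.norm_integral_le_abs_integral_norm

/-- Subtracting the primitive of `f'` from `f` leaves an absolutely continuous function with
derivative zero almost everywhere, hence a constant. -/
theorem AbsolutelyContinuousOnInterval.integral_eq_sub_of_ae_hasDerivAt [CompleteSpace F]
    {f f' : ℝ → F} {a b : ℝ}
    (hf : AbsolutelyContinuousOnInterval f a b) (hint : IntervalIntegrable f' volume a b)
    (hd : ∀ᵐ x, x ∈ uIcc a b → HasDerivAt f (f' x) x) :
    ∫ x in a..b, f' x = f b - f a := by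
  have hg : AbsolutelyContinuousOnInterval (fun x => f x - ∫ t in a..x, f' t) a b :=
    hf.sub (hint.absolutelyContinuousOnInterval_primitive left_mem_uIcc)
  have hd0 : ∀ᵐ x, x ∈ uIcc a b → HasDerivAt (fun x => f x - ∫ t in a..x, f' t) 0 x := by
    filter_upwards [hd, hint.ae_hasDerivAt_integral] with x h1 h2 hx
    have h3 := (h1 hx).sub (h2 hx a left_mem_uIcc)
    rw [sub_self] at h3
    exact h3
  obtain ⟨C, hC⟩ := hg.const_of_ae_hasDerivAt_zero hd0
  have h1 := hC a left_mem_uIcc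
  have h2 := hC b right_mem_uIcc
  simp only [intervalIntegral.integral_same, sub_zero] at h1
  rw [h1, ← h2]
  abel

theorem AbsolutelyContinuousOnInterval.of_contDiff [NormedSpace ℝ G] {f : ℝ → G}
    (hf : ContDiff ℝ 1 f) (a b : ℝ) : AbsolutelyContinuousOnInterval f a b :=
  hf.contDiffOn.absolutelyContinuousOnInterval

end AbsolutelyContinuous

/-! ### The operator `ι†ι` of the embedding `V ⊂ H ⊂ V*` and its resolvent -/

section Resolvent

variable {V H : Type*} [NormedAddCommGroup V] [InnerProductSpace ℝ V] [CompleteSpace V]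
  [NormedAddCommGroup H] [InnerProductSpace ℝ H] [CompleteSpace H]

local notation "⟪" x ", " y "⟫" => inner ℝ x y

/-- The positive operator `ι† ι` on `V` of an embedding `ι : V → H`: the embedding
`V ⊂ H ⊂ V*` after the Riesz identification of `V*` with `V`. -/
noncomputable def gramOp (ι : V →L[ℝ] H) : V →L[ℝ] V :=
  (ContinuousLinearMap.adjoint ι).comp ι

theorem inner_gramOp_left (ι : V →L[ℝ] H) (u v : V) : ⟪gramOp ι u, v⟫ = ⟪ι u, ι v⟫ := by
  simp [gramOp, ContinuousLinearMap.adjoint_inner_left]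

theorem inner_gramOp_right (ι : V →L[ℝ] H) (u v : V) : ⟪u, gramOp ι v⟫ = ⟪ι u, ι v⟫ := by
  simp [gramOp, ContinuousLinearMap.adjoint_inner_right]

theorem dense_range_of_forall_inner_eq_zero (A : H →L[ℝ] V)
    (h : ∀ v, (∀ x, ⟪A x, v⟫ = 0) → v = 0) : DenseRange A := by
  have : (A.range : Submodule ℝ V).topologicalClosure = ⊤ := by
    rw [Submodule.topologicalClosure_eq_top_iff, Submodule.eq_bot_iff]
    intro v hv
    exact h v fun x => (Submodule.mem_orthogonal _ _).1 hv _ ⟨x, rfl⟩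
  rw [← Submodule.dense_iff_topologicalClosure_eq_top] at this
  exact this

theorem denseRange_gramOp (ι : V →L[ℝ] H) (hι : Function.Injective ι) :
    DenseRange (gramOp ι) := by
  refine dense_range_of_forall_inner_eq_zero _ fun v hv => hι ?_
  have := hv v
  rw [inner_gramOp_left] at this
  rw [inner_self_eq_zero.1 this, map_zero]

/-- Injectivity of `ι` means that `ι† : H → V` has dense range, so `V` inherits a countable dense
set from `H`. -/
theorem separableSpace_of_injective (ι : V →L[ℝ] H) (hι : Function.Injective ι)
    [TopologicalSpace.SeparableSpace H] : TopologicalSpace.SeparableSpace V := by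
  have : DenseRange (ContinuousLinearMap.adjoint ι) := by
    refine dense_range_of_forall_inner_eq_zero _ fun v hv => hι ?_
    have := hv (ι v)
    rw [ContinuousLinearMap.adjoint_inner_left] at this
    rw [inner_self_eq_zero.1 this, map_zero]
  exact this.separableSpace (ContinuousLinearMap.continuous _)

/-- Since `⟪ι†ι u + ε u, u⟫ ≥ ε ‖u‖²`, the theorem of Lax and Milgram inverts `ι†ι + ε`; the inverse
is symmetric because `ι†ι` is. It is a bounded substitute for the unbounded inverse of `ι†ι`. -/
theorem exists_resolvent_gramOp (ι : V →L[ℝ] H) {ε : ℝ} (hε : 0 < ε) :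
    ∃ J : V →L[ℝ] V, (∀ v, gramOp ι (J v) + ε • J v = v) ∧
      (∀ v, J (gramOp ι v + ε • v) = v) ∧ ∀ v w, ⟪J v, w⟫ = ⟪v, J w⟫ := by
  let B : V →L[ℝ] V →L[ℝ] ℝ := (innerSL ℝ).comp (gramOp ι + ε • ContinuousLinearMap.id ℝ V)
  have hB : ∀ u v, B u v = ⟪gramOp ι u + ε • u, v⟫ := fun u v => rfl
  have hc : IsCoercive B := by
    refine ⟨ε, hε, fun u => ?_⟩
    rw [hB, inner_add_left, inner_gramOp_left, real_inner_smul_left, real_inner_self_eq_norm_mul_norm,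
      real_inner_self_eq_norm_mul_norm]
    nlinarith [mul_self_nonneg ‖ι u‖]
  let e := hc.continuousLinearEquivOfBilin
  have he : ∀ v, e v = gramOp ι v + ε • v := fun v =>
    (hc.unique_continuousLinearEquivOfBilin (f := gramOp ι v + ε • v)
      (fun w => (hB v w).symm)).symm
  have h1 : ∀ v, gramOp ι (e.symm v) + ε • e.symm v = v := fun v => by rw [← he]; simp
  refine ⟨e.symm, h1, fun v => by rw [← he]; simp, fun v w => ?_⟩
  have h2 : ⟪(e.symm : V →L[ℝ] V) v, w⟫ = ⟪e.symm v, gramOp ι (e.symm w) + ε • e.symm w⟫ := by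
    rw [h1]; rfl
  have h3 : ⟪v, (e.symm : V →L[ℝ] V) w⟫ = ⟪gramOp ι (e.symm v) + ε • e.symm v, e.symm w⟫ := by
    rw [h1]; rfl
  rw [h2, h3, inner_add_left, inner_add_right, inner_gramOp_left, inner_gramOp_right,
    real_inner_smul_left, real_inner_smul_right]

/-- The resolvent `(ι† ι + 1 / (n + 1))⁻¹`. -/
noncomputable def gramResolvent (ι : V →L[ℝ] H) (n : ℕ) : V →L[ℝ] V :=
  (exists_resolvent_gramOp ι (ε := 1 / ((n : ℝ) + 1)) (by positivity)).choose

theorem gramResolvent_spec (ι : V →L[ℝ] H) (n : ℕ) (v : V) :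
    gramOp ι (gramResolvent ι n v) + (1 / ((n : ℝ) + 1)) • gramResolvent ι n v = v :=
  (exists_resolvent_gramOp ι (ε := 1 / ((n : ℝ) + 1)) (by positivity)).choose_spec.1 v

theorem gramResolvent_gramOp (ι : V →L[ℝ] H) (n : ℕ) (v : V) :
    gramResolvent ι n (gramOp ι v) = v - (1 / ((n : ℝ) + 1)) • gramResolvent ι n v := by
  have := (exists_resolvent_gramOp ι (ε := 1 / ((n : ℝ) + 1)) (by positivity)).choose_spec.2.1 v
  rw [map_add, map_smul] at this
  exact eq_sub_of_add_eq this

theorem inner_gramResolvent (ι : V →L[ℝ] H) (n : ℕ) (v w : V) :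
    ⟪gramResolvent ι n v, w⟫ = ⟪v, gramResolvent ι n w⟫ :=
  (exists_resolvent_gramOp ι (ε := 1 / ((n : ℝ) + 1)) (by positivity)).choose_spec.2.2 v w

/-- If `x` is the regularised vector, then `ε x = ι†ι (v - x)`. Pairing with `v - x` gives `ε ⟪x, v
- x⟫ = ‖ι (v - x)‖² ≥ 0`, hence `‖x‖² ≤ ⟪x, v⟫`. -/
theorem norm_gramResolvent_gramOp_le (ι : V →L[ℝ] H) (n : ℕ) (v : V) :
    ‖gramResolvent ι n (gramOp ι v)‖ ≤ ‖v‖ := by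
  set ε : ℝ := 1 / ((n : ℝ) + 1)
  have hε : 0 < ε := by positivity
  set x := gramResolvent ι n (gramOp ι v) with hx
  have h1 : gramOp ι x + ε • x = gramOp ι v := gramResolvent_spec ι n _
  have h2 : ε • x = gramOp ι (v - x) := by rw [map_sub, ← h1]; abel
  have h3 : 0 ≤ ⟪ε • x, v - x⟫ := by
    rw [h2, inner_gramOp_left]; exact real_inner_self_nonneg
  rw [real_inner_smul_left, inner_sub_right, real_inner_self_eq_norm_mul_norm] at h3
  have h4 := real_inner_le_norm x v
  have h5 : 0 ≤ ⟪x, v⟫ - ‖x‖ * ‖x‖ := nonneg_of_mul_nonneg_right h3 hε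
  by_contra! hlt
  nlinarith [norm_nonneg v, norm_nonneg x]

/-- On vectors `ι†ι w` the error is at most `ε ‖w‖`. These vectors are dense and the regularisations
are contractions, so the convergence extends to all `v`. -/
theorem tendsto_gramResolvent_gramOp (ι : V →L[ℝ] H) (hι : Function.Injective ι) (v : V) :
    Tendsto (fun n => gramResolvent ι n (gramOp ι v)) atTop (𝓝 v) := by
  rw [Metric.tendsto_atTop]
  intro δ hδ
  obtain ⟨w, hw⟩ := (denseRange_gramOp ι hι).exists_dist_lt v (show 0 < δ / 4 by positivity)
  have h0 : Tendsto (fun n : ℕ => 1 / ((n : ℝ) + 1) * ‖w‖) atTop (𝓝 (0 * ‖w‖)) :=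
    tendsto_one_div_add_atTop_nhds_zero_nat.mul_const _
  rw [zero_mul] at h0
  obtain ⟨N, hN⟩ := eventually_atTop.1 (h0.eventually (gt_mem_nhds (show 0 < δ / 4 by positivity)))
  refine ⟨N, fun n hn => ?_⟩
  have h1 : gramResolvent ι n (gramOp ι v) - v =
      gramResolvent ι n (gramOp ι (v - gramOp ι w)) -
        (1 / ((n : ℝ) + 1)) • gramResolvent ι n (gramOp ι w) - (v - gramOp ι w) := by
    rw [map_sub, map_sub, gramResolvent_gramOp ι n (gramOp ι w)]
    abel
  rw [dist_eq_norm] at hw ⊢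
  rw [h1]
  have h2 := norm_gramResolvent_gramOp_le ι n (v - gramOp ι w)
  have h3 : ‖(1 / ((n : ℝ) + 1)) • gramResolvent ι n (gramOp ι w)‖ ≤ 1 / ((n : ℝ) + 1) * ‖w‖ := by
    rw [norm_smul, Real.norm_of_nonneg (by positivity)]
    exact mul_le_mul_of_nonneg_left (norm_gramResolvent_gramOp_le ι n w) (by positivity)
  have h4 := hN n hn
  calc _ ≤ _ := norm_sub_le _ _
    _ ≤ _ := add_le_add_left (norm_sub_le _ _) _
    _ < δ := by linarith

end Resolvent

/-! ### Test functions on an interval and the lemma of du Bois-Reymond -/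

section TestFunctions

/-- Smooth functions with compact support in `(s, τ)`. -/
structure IsTestFun (s τ : ℝ) (φ : ℝ → ℝ) : Prop where
  contDiff : ContDiff ℝ ∞ φ
  hasCompactSupport : HasCompactSupport φ
  tsupport_subset : tsupport φ ⊆ Ioo s τ

namespace IsTestFun

variable {s τ : ℝ} {φ : ℝ → ℝ} {F : Type*} [NormedAddCommGroup F] [NormedSpace ℝ F]

theorem continuous (hφ : IsTestFun s τ φ) : Continuous φ := hφ.contDiff.continuous

theorem contDiff_deriv (hφ : IsTestFun s τ φ) : ContDiff ℝ ∞ (deriv φ) :=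
  (contDiff_infty_iff_deriv.1 hφ.contDiff).2

theorem hasDerivAt (hφ : IsTestFun s τ φ) (t : ℝ) : HasDerivAt φ (deriv φ t) t :=
  ((contDiff_infty_iff_deriv.1 hφ.contDiff).1 t).hasDerivAt

theorem eq_zero (hφ : IsTestFun s τ φ) {t : ℝ} (ht : t ∉ Ioo s τ) : φ t = 0 :=
  image_eq_zero_of_notMem_tsupport fun h => ht (hφ.tsupport_subset h)

theorem deriv (hφ : IsTestFun s τ φ) : IsTestFun s τ (deriv φ) :=
  ⟨hφ.contDiff_deriv, hφ.hasCompactSupport.deriv,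
    (closure_mono (support_deriv_subset (f := φ))).trans (by
      rw [(isClosed_tsupport φ).closure_eq]; exact hφ.tsupport_subset)⟩

theorem mono (hφ : IsTestFun s τ φ) {s' τ' : ℝ} (h : Ioo s τ ⊆ Ioo s' τ') : IsTestFun s' τ' φ :=
  ⟨hφ.contDiff, hφ.hasCompactSupport, hφ.tsupport_subset.trans h⟩

theorem setIntegral_smul (hφ : IsTestFun s τ φ) (f : ℝ → F) :
    ∫ t in Ioo s τ, φ t • f t = ∫ t, φ t • f t :=
  setIntegral_eq_integral_of_forall_compl_eq_zero fun t ht => by rw [hφ.eq_zero ht, zero_smul]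

theorem exists_bound (hφ : IsTestFun s τ φ) : ∃ C, ∀ t, ‖φ t‖ ≤ C :=
  hφ.continuous.bounded_above_of_compact_support hφ.hasCompactSupport

theorem integrableOn_smul (hφ : IsTestFun s τ φ) {f : ℝ → F} {S : Set ℝ}
    (hf : IntegrableOn f S) : IntegrableOn (fun t => φ t • f t) S := by
  obtain ⟨C, hC⟩ := hφ.exists_bound
  exact hf.bdd_smul C hφ.continuous.aestronglyMeasurable (Filter.Eventually.of_forall hC)

end IsTestFun

variable {F : Type*} [NormedAddCommGroup F] [NormedSpace ℝ F] {s τ : ℝ}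

theorem ae_eq_zero_of_forall_integral_testFun [CompleteSpace F] {f : ℝ → F}
    (hf : IntegrableOn f (Ioo s τ))
    (h : ∀ φ, IsTestFun s τ φ → ∫ t in Ioo s τ, φ t • f t = 0) :
    ∀ᵐ t ∂(volume.restrict (Ioo s τ)), f t = 0 := by
  rw [ae_restrict_iff' measurableSet_Ioo]
  refine isOpen_Ioo.ae_eq_zero_of_integral_contDiff_smul_eq_zero hf.locallyIntegrableOn
    fun g h1 h2 h3 => ?_
  have hg : IsTestFun s τ g := ⟨h1, h2, h3⟩
  rw [← hg.setIntegral_smul]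
  exact h g hg

theorem exists_testFun_integral_eq_one (hst : s < τ) :
    ∃ φ, IsTestFun s τ φ ∧ ∫ t, φ t = 1 := by
  let b : ContDiffBump ((s + τ) / 2) := ⟨(τ - s) / 8, (τ - s) / 4, by linarith, by linarith⟩
  refine ⟨b.normed volume, ⟨b.contDiff_normed, b.hasCompactSupport_normed, ?_⟩, b.integral_normed⟩
  rw [b.tsupport_normed_eq, Real.closedBall_eq_Icc]
  have h : b.rOut = (τ - s) / 4 := rfl
  intro x hx
  rw [h] at hx
  exact ⟨by linarith [hx.1], by linarith [hx.2]⟩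

/-- The primitive from `s` vanishes to the left of the support of `η`, and to its right it equals
the total integral, which is zero. -/
theorem IsTestFun.exists_primitive {η : ℝ → ℝ} (hη : IsTestFun s τ η) (h0 : ∫ t, η t = 0) :
    ∃ φ, IsTestFun s τ φ ∧ _root_.deriv φ = η := by
  have hd : ∀ t, HasDerivAt (fun t => ∫ x in s..t, η x) (η t) t := fun t =>
    intervalIntegral.integral_hasDerivAt_right (hη.continuous.intervalIntegrable _ _)
      (hη.continuous.stronglyMeasurableAtFilter _ _) hη.continuous.continuousAt
  have hdd : _root_.deriv (fun t => ∫ x in s..t, η x) = η := funext fun t => (hd t).deriv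
  rcases (tsupport η).eq_empty_or_nonempty with he | hne
  · refine ⟨0, ⟨contDiff_const, HasCompactSupport.zero, by simp [tsupport]⟩, ?_⟩
    rw [tsupport_eq_empty_iff] at he
    rw [he]
    exact deriv_const' _
  have hK : IsCompact (tsupport η) := hη.hasCompactSupport
  set a := sInf (tsupport η)
  set b := sSup (tsupport η)
  have ha : a ∈ Ioo s τ := hη.tsupport_subset (hK.sInf_mem hne)
  have hb : b ∈ Ioo s τ := hη.tsupport_subset (hK.sSup_mem hne)
  have hz : ∀ t, η t ≠ 0 → t ∈ Icc a b := fun t ht =>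
    ⟨csInf_le hK.bddBelow (subset_tsupport _ ht), le_csSup hK.bddAbove (subset_tsupport _ ht)⟩
  have hsupp : tsupport (fun t => ∫ x in s..t, η x) ⊆ Icc a b := by
    refine closure_minimal (fun t ht => ?_) isClosed_Icc
    by_contra hn
    apply ht
    rcases lt_or_ge t a with h1 | h1
    · refine intervalIntegral.integral_zero_ae (Filter.Eventually.of_forall fun x hx => ?_)
      by_contra hne
      have h2 := (hz x hne).1
      rcases le_total s t with h3 | h3
      · rw [uIoc_of_le h3] at hx; linarith [hx.2]
      · rw [uIoc_of_ge h3] at hx; linarith [hx.2, ha.1]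
    · have h2 : b < t := by
        by_contra! h3
        exact hn ⟨h1, h3⟩
      change ∫ x in s..t, η x = 0
      rw [intervalIntegral.integral_eq_integral_of_support_subset, h0]
      intro x hx
      have := hz x hx
      exact ⟨by linarith [this.1, ha.1], by linarith [this.2]⟩
  refine ⟨fun t => ∫ x in s..t, η x, ⟨?_, ?_, ?_⟩, hdd⟩
  · rw [contDiff_infty_iff_deriv, hdd]
    exact ⟨fun t => (hd t).differentiableAt, hη.contDiff⟩
  · exact HasCompactSupport.of_support_subset_isCompact isCompact_Icc
      ((subset_tsupport _).trans hsupp)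
  · exact hsupp.trans fun x hx => ⟨by linarith [hx.1, ha.1], by linarith [hx.2, hb.2]⟩

/-- The lemma of du Bois-Reymond. -/
theorem exists_ae_eq_const_of_forall_integral_deriv_testFun [CompleteSpace F] (hst : s < τ)
    {y : ℝ → F} (hy : IntegrableOn y (Ioo s τ))
    (h : ∀ φ, IsTestFun s τ φ → ∫ t in Ioo s τ, deriv φ t • y t = 0) :
    ∃ c, ∀ᵐ t ∂(volume.restrict (Ioo s τ)), y t = c := by
  obtain ⟨ψ₀, hψ₀, h1⟩ := exists_testFun_integral_eq_one hst
  set c := ∫ t in Ioo s τ, ψ₀ t • y t with hc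
  refine ⟨c, ?_⟩
  have hcint : IntegrableOn (fun _ : ℝ => c) (Ioo s τ) := by simp
  have key := ae_eq_zero_of_forall_integral_testFun (f := fun t => y t - c) (s := s) (τ := τ)
    (hy.sub hcint) (fun ψ hψ => ?_)
  · filter_upwards [key] with t ht using sub_eq_zero.1 ht
  set k := ∫ t, ψ t with hk
  have hint : ∀ {φ}, IsTestFun s τ φ → Integrable φ := fun hφ =>
    hφ.continuous.integrable_of_hasCompactSupport hφ.hasCompactSupport
  -- Subtracting the right multiple of `ψ₀` makes the integral of `ψ` vanish. The difference is then
  -- the derivative of a test function, on which the hypothesis acts.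
  have hη : IsTestFun s τ (fun t => ψ t - k * ψ₀ t) := by
    refine ⟨hψ.contDiff.sub (contDiff_const.mul hψ₀.contDiff),
      hψ.hasCompactSupport.sub hψ₀.hasCompactSupport.mul_left, ?_⟩
    refine (closure_minimal (fun t ht => ?_)
      ((isClosed_tsupport ψ).union (isClosed_tsupport ψ₀))).trans
      (union_subset hψ.tsupport_subset hψ₀.tsupport_subset)
    by_contra hn
    rw [mem_union, not_or] at hn
    exact ht (by simp [image_eq_zero_of_notMem_tsupport hn.1, image_eq_zero_of_notMem_tsupport hn.2])
  obtain ⟨φ, hφ, hd⟩ := hη.exists_primitive (by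
    rw [integral_sub (hint hψ) ((hint hψ₀).const_mul k), integral_const_mul, h1, hk]; ring)
  have h2 := h φ hφ
  rw [hd] at h2
  have h3 : ∫ t in Ioo s τ, (ψ t - k * ψ₀ t) • y t =
      (∫ t in Ioo s τ, ψ t • y t) - k • c := by
    have h4 : ∫ t in Ioo s τ, (ψ t • y t - (k • fun t => ψ₀ t • y t) t) = _ :=
      integral_sub (hψ.integrableOn_smul hy) ((hψ₀.integrableOn_smul hy).smul k)
    rw [hc, ← integral_smul]
    refine Eq.trans ?_ h4
    exact integral_congr_ae (Filter.Eventually.of_forall fun t => by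
      simp only [Pi.smul_apply, smul_smul, sub_smul])
  have h4 : ∫ t in Ioo s τ, ψ t • (y t - c) = (∫ t in Ioo s τ, ψ t • y t) - k • c := by
    have h5 : ∫ t in Ioo s τ, ψ t • c = k • c := by
      rw [hψ.setIntegral_smul, integral_smul_const]
    rw [← h5, ← integral_sub (hψ.integrableOn_smul hy) (hψ.integrableOn_smul hcint)]
    exact integral_congr_ae (Filter.Eventually.of_forall fun t => smul_sub _ _ _)
  rw [h4, ← h3, h2]

end TestFunctions

/-! ### Weakly differentiable curves and representation of functionals -/

section WeakCurves

variable {V H : Type*} [NormedAddCommGroup V] [InnerProductSpace ℝ V] [CompleteSpace V]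
  [NormedAddCommGroup H] [InnerProductSpace ℝ H] [CompleteSpace H]

local notation "⟪" x ", " y "⟫" => inner ℝ x y

/-- The bound forces `L` to vanish on the kernel of `K`, so `L` factors through the range of `K`,
and any linear section `g` computes the factor. Hahn–Banach extends it to `H` with the same norm and
Riesz represents it. Neither `W` nor the range of `K` has to be complete. -/
theorem exists_inner_eq_of_le {W : Type*} [AddCommGroup W] [Module ℝ W] (K : W →ₗ[ℝ] H)
    (L : W →ₗ[ℝ] ℝ) {M : ℝ} (hM : 0 ≤ M) (h : ∀ w, |L w| ≤ M * ‖K w‖) :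
    ∃ c : H, ‖c‖ ≤ M ∧ ∀ w, ⟪c, K w⟫ = L w := by
  obtain ⟨g, hg⟩ := K.rangeRestrict.exists_rightInverse_of_surjective (LinearMap.range_rangeRestrict K)
  have hg' : ∀ y, K (g y) = y := fun y => congrArg Subtype.val (LinearMap.congr_fun hg y)
  let f := (L.comp g).mkContinuous M (fun y => by
    have := h (g y)
    rw [hg'] at this
    exact this)
  have hf : ‖f‖ ≤ M := LinearMap.mkContinuous_norm_le _ hM _
  obtain ⟨G, hG, hn⟩ := exists_extension_norm_eq _ f
  refine ⟨(InnerProductSpace.toDual ℝ H).symm G, ?_, fun w => ?_⟩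
  · rw [LinearIsometryEquiv.norm_map, hn]; exact hf
  · rw [InnerProductSpace.toDual_symm_apply]
    have h1 : G (K w) = L (g (K.rangeRestrict w)) := hG (K.rangeRestrict w)
    have h2 := h (w - g (K.rangeRestrict w))
    rw [map_sub K, hg'] at h2
    have h4 : ((K.rangeRestrict w : K.range) : H) = K w := rfl
    rw [h4, sub_self, norm_zero, mul_zero] at h2
    have h3 := abs_eq_zero.1 (le_antisymm h2 (abs_nonneg _))
    rw [map_sub, sub_eq_zero] at h3
    rw [h1, h3]

theorem DenseRange.eq_of_forall_inner_eq {α : Type*} {ι : α → H} (hd : DenseRange ι) {x y : H}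
    (h : ∀ v, ⟪x, ι v⟫ = ⟪y, ι v⟫) : x = y := by
  have : (fun w : H => ⟪x, w⟫) = fun w => ⟪y, w⟫ :=
    hd.equalizer (by fun_prop) (by fun_prop) (funext h)
  exact ext_inner_right ℝ fun w => congrFun this w

/-- This recognises the elements of `V*` that come from `H`. For `x n`, the resolvent applied to
`ℓ`, one has `⟪ℓ, v⟫ = ⟪ι (x n), ι v⟫ + ε n ⟪x n, v⟫` and `⟪ℓ, x n⟫ = ‖ι (x n)‖² + ε n ‖x n‖²`. As
the second quantity converges to `q`, the last term of the first tends to zero and `|⟪ℓ, v⟫| ≤ √q ‖ι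
v‖`. This yields `c` with `‖c‖² ≤ q`; conversely `⟪ℓ, x n⟫ = ⟪c, ι (x n)⟫ ≤ ‖c‖ √⟪ℓ, x n⟫` gives `q
≤ ‖c‖²`. -/
theorem exists_eq_of_tendsto_inner_gramResolvent (ι : V →L[ℝ] H) {ℓ : V} {q : ℝ}
    (hq : Tendsto (fun n => ⟪ℓ, gramResolvent ι n ℓ⟫) atTop (𝓝 q)) :
    ∃ c : H, (∀ v, ⟪c, ι v⟫ = ⟪ℓ, v⟫) ∧ ‖c‖ ^ 2 = q := by
  set x := fun n => gramResolvent ι n ℓ with hx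
  set ε := fun n : ℕ => 1 / ((n : ℝ) + 1) with hεdef
  have hε : ∀ n, 0 < ε n := fun n => by positivity
  have hε0 : Tendsto ε atTop (𝓝 0) := tendsto_one_div_add_atTop_nhds_zero_nat
  have hpair : ∀ n v, ⟪ℓ, v⟫ = ⟪ι (x n), ι v⟫ + ε n * ⟪x n, v⟫ := fun n v => by
    rw [← inner_gramOp_left, ← real_inner_smul_left, ← inner_add_left]
    rw [gramResolvent_spec]
  have hqn : ∀ n, ⟪ℓ, x n⟫ = ‖ι (x n)‖ ^ 2 + ε n * ‖x n‖ ^ 2 := fun n => by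
    rw [hpair n, real_inner_self_eq_norm_sq, real_inner_self_eq_norm_sq]
  have hqnn : ∀ n, 0 ≤ ⟪ℓ, x n⟫ := fun n => by
    rw [hqn]; have := hε n; positivity
  have hq0 : 0 ≤ q := ge_of_tendsto' hq hqnn
  have hb1 : ∀ n, ‖ι (x n)‖ ≤ √⟪ℓ, x n⟫ := fun n => by
    refine Real.le_sqrt_of_sq_le ?_
    rw [hqn n]
    have := hε n
    have : 0 ≤ ε n * ‖x n‖ ^ 2 := by positivity
    linarith
  have hb2 : ∀ n, ε n * ‖x n‖ ≤ √(ε n * ⟪ℓ, x n⟫) := fun n => by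
    refine Real.le_sqrt_of_sq_le ?_
    rw [hqn n]
    have := hε n
    have : 0 ≤ ε n * ‖ι (x n)‖ ^ 2 := by positivity
    nlinarith
  obtain ⟨c, hcn, hc⟩ := exists_inner_eq_of_le (W := V) ι.toLinearMap
    (innerSL ℝ ℓ).toLinearMap (Real.sqrt_nonneg q) (fun v => by
      have hlim : Tendsto (fun n => √⟪ℓ, x n⟫ * ‖ι v‖ + √(ε n * ⟪ℓ, x n⟫) * ‖v‖) atTop
          (𝓝 (√q * ‖ι v‖ + √(0 * q) * ‖v‖)) :=
        (hq.sqrt.mul_const _).add ((hε0.mul hq).sqrt.mul_const _)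
      rw [zero_mul, Real.sqrt_zero, zero_mul, add_zero] at hlim
      refine ge_of_tendsto' hlim fun n => ?_
      change |⟪ℓ, v⟫| ≤ _
      rw [hpair n v]
      refine (abs_add_le _ _).trans (add_le_add ?_ ?_)
      · exact (abs_real_inner_le_norm _ _).trans
          (mul_le_mul_of_nonneg_right (hb1 n) (norm_nonneg _))
      · rw [abs_mul, abs_of_pos (hε n)]
        calc _ ≤ ε n * (‖x n‖ * ‖v‖) :=
              mul_le_mul_of_nonneg_left (abs_real_inner_le_norm _ _) (hε n).le
          _ = ε n * ‖x n‖ * ‖v‖ := by ring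
          _ ≤ _ := mul_le_mul_of_nonneg_right (hb2 n) (norm_nonneg _))
  have hc' : ∀ v, ⟪c, ι v⟫ = ⟪ℓ, v⟫ := hc
  refine ⟨c, hc', le_antisymm ?_ ?_⟩
  · calc ‖c‖ ^ 2 ≤ (√q) ^ 2 := pow_le_pow_left₀ (norm_nonneg _) hcn 2
      _ = q := Real.sq_sqrt hq0
  · refine le_of_tendsto' hq fun n => ?_
    change ⟪ℓ, x n⟫ ≤ _
    have h1 : ⟪ℓ, x n⟫ ≤ ‖c‖ * √⟪ℓ, x n⟫ := by
      conv_lhs => rw [← hc']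
      exact (real_inner_le_norm _ _).trans (mul_le_mul_of_nonneg_left (hb1 n) (norm_nonneg _))
    have h2 := Real.mul_self_sqrt (hqnn n)
    set z := √⟪ℓ, x n⟫
    have hz : 0 ≤ z := Real.sqrt_nonneg _
    rw [← h2] at h1 ⊢
    have : z ≤ ‖c‖ := by
      by_contra! hlt
      nlinarith [norm_nonneg c]
    nlinarith

/-- Continuity of the norm gives local boundedness, so weak continuity passes from the dense range
of `ι` to all vectors, in particular to `c r`. Expanding `‖c t - c r‖²` finishes. -/
theorem continuousOn_of_weak_of_norm {ι : V →L[ℝ] H} (hd : DenseRange ι) {c : ℝ → H} {S : Set ℝ}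
    (hn : ContinuousOn (fun t => ‖c t‖ ^ 2) S)
    (hw : ∀ v, ContinuousOn (fun t => ⟪c t, ι v⟫) S) : ContinuousOn c S := by
  intro r hr
  have hinner : Tendsto (fun t => ⟪c t, c r⟫) (𝓝[S] r) (𝓝 ⟪c r, c r⟫) := by
    rw [Metric.tendsto_nhds]
    intro ε hε
    obtain ⟨M, hM0, hM⟩ : ∃ M, 0 < M ∧ ∀ᶠ t in 𝓝[S] r, ‖c t‖ ≤ M ∧ ‖c r‖ ≤ M := by
      refine ⟨‖c r‖ + 1, by positivity, ?_⟩
      have h1 : ∀ᶠ t in 𝓝[S] r, ‖c t‖ ^ 2 < (‖c r‖ + 1) ^ 2 :=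
        (hn r hr).eventually (gt_mem_nhds (by nlinarith [norm_nonneg (c r)]))
      filter_upwards [h1] with t ht
      exact ⟨(lt_of_pow_lt_pow_left₀ 2 (by positivity) ht).le, by linarith⟩
    obtain ⟨v, hv⟩ := hd.exists_dist_lt (c r) (show 0 < ε / (4 * M) by positivity)
    rw [dist_eq_norm] at hv
    have h2 := (Metric.tendsto_nhds.1 (hw v r hr)) (ε / 2) (by positivity)
    filter_upwards [hM, h2] with t ht h3
    rw [Real.dist_eq] at h3 ⊢
    have h4 : ⟪c t, c r⟫ - ⟪c r, c r⟫ =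
        (⟪c t, ι v⟫ - ⟪c r, ι v⟫) + (⟪c t, c r - ι v⟫ - ⟪c r, c r - ι v⟫) := by
      simp only [inner_sub_right]; ring
    have hMε : M * (ε / (4 * M)) = ε / 4 := by field_simp
    have h5 : ∀ y : H, ‖y‖ ≤ M → |⟪y, c r - ι v⟫| ≤ ε / 4 := fun y hy => by
      rw [← hMε]
      exact (abs_real_inner_le_norm _ _).trans
        (mul_le_mul hy hv.le (norm_nonneg _) hM0.le)
    rw [h4]
    calc _ ≤ _ := abs_add_le _ _
      _ ≤ |⟪c t, ι v⟫ - ⟪c r, ι v⟫| + (ε / 4 + ε / 4) :=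
        add_le_add_right ((abs_sub _ _).trans (add_le_add (h5 _ ht.1) (h5 _ ht.2))) _
      _ < ε := by linarith
  have hsq : Tendsto (fun t => ‖c t - c r‖ ^ 2) (𝓝[S] r) (𝓝 0) := by
    have h1 : Tendsto (fun t => ‖c t‖ ^ 2 - 2 * ⟪c t, c r⟫ + ‖c r‖ ^ 2) (𝓝[S] r)
        (𝓝 (‖c r‖ ^ 2 - 2 * ⟪c r, c r⟫ + ‖c r‖ ^ 2)) :=
      ((hn r hr).sub (hinner.const_mul 2)).add_const _
    rw [real_inner_self_eq_norm_sq] at h1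
    have h2 : ‖c r‖ ^ 2 - 2 * ‖c r‖ ^ 2 + ‖c r‖ ^ 2 = 0 := by ring
    rw [h2] at h1
    exact h1.congr fun t => (norm_sub_sq_real _ _).symm
  have h3 := hsq.sqrt
  simp only [Real.sqrt_sq (norm_nonneg _), Real.sqrt_zero] at h3
  exact tendsto_iff_norm_sub_tendsto_zero.2 h3

/-- `u ∈ L²((s,τ) → V)` has the weak time derivative `g` in `L²((s,τ) → V*)`, where `V*` is
identified with `V` by the theorem of Riesz. -/
structure IsWeakCurve (ι : V →L[ℝ] H) (s τ : ℝ) (u g : ℝ → V) : Prop where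
  memLp : MemLp u 2 (volume.restrict (Ioo s τ))
  memLp_deriv : MemLp g 2 (volume.restrict (Ioo s τ))
  weak_deriv : ∀ φ, IsTestFun s τ φ →
    ∫ t in Ioo s τ, deriv φ t • gramOp ι (u t) = - ∫ t in Ioo s τ, φ t • g t

/-- `c` is a representative of `u` that is continuous on `[s, τ]` with values in `H`. -/
structure IsContRepOn (ι : V →L[ℝ] H) (s τ : ℝ) (u : ℝ → V) (c : ℝ → H) : Prop where
  continuousOn : ContinuousOn c (Icc s τ)
  ae_eq : ∀ᵐ t ∂(volume.restrict (Ioo s τ)), c t = ι (u t)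

theorem ContinuousOn.eqOn_Ioo_of_ae_eq {X : Type*} [TopologicalSpace X] [T2Space X] {s τ : ℝ}
    {c d : ℝ → X} (hc : ContinuousOn c (Ioo s τ)) (hd : ContinuousOn d (Ioo s τ))
    (h : ∀ᵐ t ∂(volume.restrict (Ioo s τ)), c t = d t) : EqOn c d (Ioo s τ) :=
  Measure.eqOn_open_of_ae_eq h isOpen_Ioo hc hd

theorem ContinuousOn.eqOn_Icc_of_ae_eq {X : Type*} [TopologicalSpace X] [T2Space X] {s τ : ℝ}
    (hst : s < τ) {c d : ℝ → X} (hc : ContinuousOn c (Icc s τ)) (hd : ContinuousOn d (Icc s τ))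
    (h : ∀ᵐ t ∂(volume.restrict (Ioo s τ)), c t = d t) : EqOn c d (Icc s τ) := by
  refine ((hc.mono Ioo_subset_Icc_self).eqOn_Ioo_of_ae_eq (hd.mono Ioo_subset_Icc_self)
    h).of_subset_closure hc hd Ioo_subset_Icc_self ?_
  rw [closure_Ioo hst.ne]

variable {ι : V →L[ℝ] H} {s τ : ℝ} {u v g h : ℝ → V} {c d : ℝ → H}

theorem MeasureTheory.MemLp.integrableOn_Ioo {F : Type*} [NormedAddCommGroup F] {f : ℝ → F}
    (hf : MemLp f 2 (volume.restrict (Ioo s τ))) : IntegrableOn f (Ioo s τ) :=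
  hf.integrable one_le_two

theorem IntegrableOn.intervalIntegrable_of_mem_Icc {F : Type*} [NormedAddCommGroup F] {f : ℝ → F}
    (hf : IntegrableOn f (Ioo s τ)) {r t : ℝ} (hr : r ∈ Icc s τ) (ht : t ∈ Icc s τ) :
    IntervalIntegrable f volume r t := by
  have h1 : IntervalIntegrable f volume s τ :=
    (intervalIntegrable_iff_integrableOn_Ioo_of_le (hr.1.trans hr.2)).2 hf
  refine h1.mono_set (uIcc_subset_uIcc ?_ ?_) <;> rwa [uIcc_of_le (hr.1.trans hr.2)]

theorem IntegrableOn.integral_Ioo_eq {F : Type*} [NormedAddCommGroup F] [NormedSpace ℝ F]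
    (hst : s ≤ τ) (f : ℝ → F) : ∫ t in Ioo s τ, f t = ∫ t in s..τ, f t := by
  rw [intervalIntegral.integral_of_le hst, integral_Ioc_eq_integral_Ioo]

theorem ae_of_mem_uIoc_of_ae_restrict_Ioo {p : ℝ → Prop}
    (hp : ∀ᵐ t ∂(volume.restrict (Ioo s τ)), p t) {r t : ℝ} (hr : r ∈ Icc s τ) (ht : t ∈ Icc s τ) :
    ∀ᵐ x, x ∈ uIoc r t → p x := by
  rw [ae_restrict_iff' measurableSet_Ioo] at hp
  filter_upwards [hp, Measure.ae_ne volume τ] with x h1 h2 hx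
  refine h1 ⟨?_, lt_of_le_of_ne ?_ h2⟩
  · exact (le_min hr.1 ht.1).trans_lt hx.1
  · exact hx.2.trans (max_le hr.2 ht.2)

theorem IsTestFun.integral_deriv_smul_primitive {F : Type*} [NormedAddCommGroup F]
    [NormedSpace ℝ F] [CompleteSpace F] {φ : ℝ → ℝ} (hφ : IsTestFun s τ φ) (hst : s ≤ τ)
    {g : ℝ → F} (hg : IntegrableOn g (Ioo s τ)) :
    ∫ t in Ioo s τ, _root_.deriv φ t • ∫ x in s..t, g x = - ∫ t in Ioo s τ, φ t • g t := by
  have hgi := IntegrableOn.intervalIntegrable_of_mem_Icc hg (left_mem_Icc.2 hst)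
    (right_mem_Icc.2 hst)
  have hG := hgi.absolutelyContinuousOnInterval_primitive left_mem_uIcc
  have hG' : IntervalIntegrable (fun t => _root_.deriv φ t • ∫ x in s..t, g x) volume s τ :=
    (hφ.deriv.continuous.continuousOn.smul hG.continuousOn).intervalIntegrable
  have hφg : IntervalIntegrable (fun t => φ t • g t) volume s τ :=
    hgi.continuousOn_smul hφ.continuous.continuousOn
  have hac := (AbsolutelyContinuousOnInterval.of_contDiff (hφ.contDiff.of_le (by simp)) s τ).smul hG
  have := hac.integral_eq_sub_of_ae_hasDerivAt
    (f' := fun t => φ t • g t + _root_.deriv φ t • ∫ x in s..t, g x) (hφg.add hG') (by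
      filter_upwards [hgi.ae_hasDerivAt_integral] with x hx hxm
      exact (hφ.hasDerivAt x).smul (hx hxm s left_mem_uIcc))
  rw [intervalIntegral.integral_add hφg hG'] at this
  rw [IntegrableOn.integral_Ioo_eq hst, IntegrableOn.integral_Ioo_eq hst]
  have h1 : φ s = 0 := hφ.eq_zero (by simp)
  have h2 : φ τ = 0 := hφ.eq_zero (by simp)
  simp only [Pi.smul_apply', h1, h2, zero_smul, sub_zero] at this
  exact eq_neg_of_add_eq_zero_right this

namespace IsWeakCurve

theorem integrableOn (hu : IsWeakCurve ι s τ u g) : IntegrableOn u (Ioo s τ) :=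
  hu.memLp.integrableOn_Ioo

theorem integrableOn_deriv (hu : IsWeakCurve ι s τ u g) : IntegrableOn g (Ioo s τ) :=
  hu.memLp_deriv.integrableOn_Ioo

theorem integrableOn_inner (hu : IsWeakCurve ι s τ u g) (hv : IsWeakCurve ι s τ v h) :
    IntegrableOn (fun t => ⟪g t, v t⟫) (Ioo s τ) :=
  memLp_one_iff_integrable.1 ((innerSL ℝ).memLp_of_bilin 1 hu.memLp_deriv hv.memLp)

/-- The difference of `ι†ι u` and the primitive of `g` has weak derivative zero. -/
theorem exists_primitive (hst : s < τ) (hu : IsWeakCurve ι s τ u g) :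
    ∃ c₀ : V, ∀ᵐ t ∂(volume.restrict (Ioo s τ)), gramOp ι (u t) = c₀ + ∫ x in s..t, g x := by
  have h1 : IntegrableOn (fun t => gramOp ι (u t)) (Ioo s τ) :=
    (gramOp ι).integrable_comp hu.integrableOn
  have hac := (IntegrableOn.intervalIntegrable_of_mem_Icc hu.integrableOn_deriv
    (left_mem_Icc.2 hst.le) (right_mem_Icc.2 hst.le)).absolutelyContinuousOnInterval_primitive
    left_mem_uIcc
  have h2 : IntegrableOn (fun t => ∫ x in s..t, g x) (Ioo s τ) :=
    (intervalIntegrable_iff_integrableOn_Ioo_of_le hst.le).1 hac.continuousOn.intervalIntegrable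
  obtain ⟨c₀, hc⟩ := exists_ae_eq_const_of_forall_integral_deriv_testFun hst
    (y := fun t => gramOp ι (u t) - ∫ x in s..t, g x) (h1.sub h2) (fun φ hφ => by
      have h3 := integral_sub (hφ.deriv.integrableOn_smul h1) (hφ.deriv.integrableOn_smul h2)
      rw [hu.weak_deriv φ hφ, hφ.integral_deriv_smul_primitive hst.le hu.integrableOn_deriv,
        sub_self] at h3
      rw [← h3]
      exact integral_congr_ae (Filter.Eventually.of_forall fun t => smul_sub _ _ _))
  exact ⟨c₀, hc.mono fun t ht => by rw [← ht]; abel⟩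

end IsWeakCurve

/-- For bounded symmetric `J` the function `⟪U, J U⟫` is absolutely continuous along with `U`, with
derivative `2 ⟪g, J U⟫`. It is applied with the resolvents as `J` and `U = ι†ι u`, where `⟪U, J U⟫`
approximates `‖ι u‖²`. -/
theorem integral_inner_primitive {J : V →L[ℝ] V} (hJ : ∀ v w, ⟪J v, w⟫ = ⟪v, J w⟫)
    {g : ℝ → V} {r t : ℝ} (hg : IntegrableOn g (Ioo s τ)) (hr : r ∈ Icc s τ) (ht : t ∈ Icc s τ)
    (c₀ : V) {U : ℝ → V} (hU : ∀ t, U t = c₀ + ∫ x in s..t, g x) :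
    ⟪U t, J (U t)⟫ - ⟪U r, J (U r)⟫ = 2 * ∫ x in r..t, ⟪g x, J (U x)⟫ := by
  have hst : s ≤ τ := hr.1.trans hr.2
  have hs : s ∈ Icc s τ := left_mem_Icc.2 hst
  have hsub : uIcc r t ⊆ uIcc s τ := by rw [uIcc_of_le hst]; exact uIcc_subset_Icc hr ht
  have hgi := IntegrableOn.intervalIntegrable_of_mem_Icc hg hs (right_mem_Icc.2 hst)
  have hG := hgi.absolutelyContinuousOnInterval_primitive left_mem_uIcc
  have hUac : AbsolutelyContinuousOnInterval U r t := by
    refine (hG.mono hsub).of_dist_le 1 fun x _ y _ => ?_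
    rw [hU, hU, dist_add_left, one_mul]
  obtain ⟨C, hC⟩ := hUac.exists_bound
  have hqac : AbsolutelyContinuousOnInterval (fun x => ⟪U x, J (U x)⟫) r t := by
    refine hUac.of_dist_le (2 * C * ‖J‖) fun x hx y hy => ?_
    have h1 : ⟪U x, J (U x)⟫ - ⟪U y, J (U y)⟫ = ⟪U x - U y, J (U x)⟫ + ⟪J (U y), U x - U y⟫ := by
      rw [inner_sub_left, inner_sub_right, hJ (U y), hJ (U y)]; ring
    rw [Real.dist_eq, h1, dist_eq_norm]
    have hb : ∀ z ∈ uIcc r t, ‖J (U z)‖ ≤ ‖J‖ * C := fun z hz =>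
      (J.le_opNorm _).trans (mul_le_mul_of_nonneg_left (hC z hz) (norm_nonneg _))
    calc _ ≤ _ := abs_add_le _ _
      _ ≤ ‖U x - U y‖ * (‖J‖ * C) + (‖J‖ * C) * ‖U x - U y‖ :=
        add_le_add
          ((abs_real_inner_le_norm _ _).trans (mul_le_mul_of_nonneg_left (hb x hx) (norm_nonneg _)))
          ((abs_real_inner_le_norm _ _).trans (mul_le_mul_of_nonneg_right (hb y hy) (norm_nonneg _)))
      _ = _ := by ring
  have hint : IntervalIntegrable (fun x => ⟪g x, J (U x)⟫) volume r t := by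
    have hg' : IntervalIntegrable g volume r t := hgi.mono_set hsub
    rw [intervalIntegrable_iff] at hg' ⊢
    have hJU : ContinuousOn (fun x => J (U x)) (uIcc r t) := J.continuous.comp_continuousOn hUac.continuousOn
    refine (innerSL ℝ).integrable_of_bilin_of_bdd_right (‖J‖ * C) hg' ?_ ?_
    · exact (hJU.mono uIoc_subset_uIcc).aestronglyMeasurable measurableSet_uIoc
    · refine (ae_restrict_iff' measurableSet_uIoc).2 (Filter.Eventually.of_forall fun x hx => ?_)
      exact (J.le_opNorm _).trans
        (mul_le_mul_of_nonneg_left (hC x (uIoc_subset_uIcc hx)) (norm_nonneg _))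
  rw [← hqac.integral_eq_sub_of_ae_hasDerivAt (f' := fun x => 2 * ⟪g x, J (U x)⟫)
    (hint.const_mul 2), intervalIntegral.integral_const_mul]
  filter_upwards [hgi.ae_hasDerivAt_integral] with x hx hxm
  have h1 : HasDerivAt U (g x) x := by
    have h2 := (hx (hsub hxm) s left_mem_uIcc).const_add c₀
    exact h2.congr_of_eventuallyEq (Filter.Eventually.of_forall hU)
  have h3 := h1.inner ℝ (J.hasFDerivAt.comp_hasDerivAt x h1)
  have h4 : ⟪U x, J (g x)⟫ + ⟪g x, (⇑J ∘ U) x⟫ = 2 * ⟪g x, J (U x)⟫ := by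
    rw [← hJ, real_inner_comm (g x) (J (U x)), Function.comp_apply]
    ring
  rw [h4] at h3
  exact h3

end WeakCurves

/-! ### Continuity in `H` and the product rule for weak curves -/

section LionsMagenes

variable {V H : Type*} [NormedAddCommGroup V] [InnerProductSpace ℝ V] [CompleteSpace V]
  [NormedAddCommGroup H] [InnerProductSpace ℝ H] [CompleteSpace H]

local notation "⟪" x ", " y "⟫" => inner ℝ x y

variable {ι : V →L[ℝ] H} {s τ : ℝ} {u v g h : ℝ → V} {c d : ℝ → H}

theorem exists_mem_Ioo_of_ae (hst : s < τ) {p : ℝ → Prop}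
    (hp : ∀ᵐ t ∂(volume.restrict (Ioo s τ)), p t) : ∃ t ∈ Ioo s τ, p t := by
  have : (ae (volume.restrict (Ioo s τ))).NeBot := by
    rw [ae_neBot, Ne, Measure.restrict_eq_zero, Real.volume_Ioo]
    simp [hst]
  have h1 := hp.and (ae_restrict_mem (μ := volume) (measurableSet_Ioo (a := s) (b := τ)))
  obtain ⟨t, h2, h3⟩ := h1.exists
  exact ⟨t, h3, h2⟩

namespace IsWeakCurve

/-- Curves in `L²(V)` with derivative in `L²(V*)` are continuous with values in `H`. -/
theorem exists_contRep_aux (hu : IsWeakCurve ι s τ u g) (hst : s < τ) (hι : Function.Injective ι)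
    (hd : DenseRange ι) : ∃ c : ℝ → H, IsContRepOn ι s τ u c ∧
      (∀ r ∈ Icc s τ, ∀ t ∈ Icc s τ, ‖c t‖ ^ 2 - ‖c r‖ ^ 2 = 2 * ∫ x in r..t, ⟪g x, u x⟫) ∧
      (∀ r ∈ Icc s τ, ∀ t ∈ Icc s τ, ∀ v, ⟪c t, ι v⟫ - ⟪c r, ι v⟫ = ∫ x in r..t, ⟪g x, v⟫) := by
  obtain ⟨c₀, hc₀⟩ := hu.exists_primitive hst
  obtain ⟨U, hU⟩ : ∃ U : ℝ → V, ∀ t, U t = c₀ + ∫ x in s..t, g x := ⟨_, fun _ => rfl⟩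
  have hae : ∀ᵐ t ∂(volume.restrict (Ioo s τ)), gramOp ι (u t) = U t :=
    hc₀.mono fun t ht => by rw [ht, hU]
  have hgu : IntegrableOn (fun x => ⟪g x, u x⟫) (Ioo s τ) := hu.integrableOn_inner hu
  -- Almost everywhere `U = ι†ι u`, so the resolvents applied to `U` converge to `u` and are
  -- dominated by `‖u‖`; the chain rule for `⟪U, J U⟫` passes to the limit.
  have hlim : ∀ r ∈ Icc s τ, ∀ t ∈ Icc s τ,
      Tendsto (fun n => ⟪U t, gramResolvent ι n (U t)⟫ - ⟪U r, gramResolvent ι n (U r)⟫) atTop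
        (𝓝 (2 * ∫ x in r..t, ⟪g x, u x⟫)) := fun r hr t ht => by
    have haert := ae_of_mem_uIoc_of_ae_restrict_Ioo hae hr ht
    simp_rw [fun n => integral_inner_primitive (inner_gramResolvent ι n) hu.integrableOn_deriv
      hr ht c₀ hU]
    refine Tendsto.const_mul 2 ?_
    refine intervalIntegral.tendsto_integral_filter_of_dominated_convergence
      (fun x => ‖g x‖ * ‖u x‖) (Filter.Eventually.of_forall fun n => ?_)
      (Filter.Eventually.of_forall fun n => ?_) ?_ ?_
    · have hg := (intervalIntegrable_iff.1 (IntegrableOn.intervalIntegrable_of_mem_Icc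
        hu.integrableOn_deriv hr ht)).aestronglyMeasurable
      have hu' := (intervalIntegrable_iff.1 (IntegrableOn.intervalIntegrable_of_mem_Icc
        hu.integrableOn hr ht)).aestronglyMeasurable
      have h1 : AEStronglyMeasurable (fun x => gramResolvent ι n (gramOp ι (u x)))
          (volume.restrict (uIoc r t)) :=
        ((gramResolvent ι n).comp (gramOp ι)).continuous.comp_aestronglyMeasurable hu'
      refine (hg.inner h1 (𝕜 := ℝ)).congr ?_
      refine (ae_restrict_iff' measurableSet_uIoc).2 (haert.mono fun x hx hxm => ?_)
      simp only [hx hxm]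
    · refine haert.mono fun x hx hxm => ?_
      rw [← hx hxm]
      exact (norm_inner_le_norm _ _).trans
        (mul_le_mul_of_nonneg_left (norm_gramResolvent_gramOp_le ι n _) (norm_nonneg _))
    · refine IntegrableOn.intervalIntegrable_of_mem_Icc (s := s) (τ := τ) ?_ hr ht
      exact hu.memLp_deriv.norm.integrable_mul hu.memLp.norm
    · refine haert.mono fun x hx hxm => ?_
      rw [← hx hxm]
      exact tendsto_const_nhds.inner (tendsto_gramResolvent_gramOp ι hι (u x))
  -- At one time `t₀` with `U t₀ = ι†ι (u t₀)` the quadratic expressions themselves converge, to `‖ι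
  -- (u t₀)‖²`. The limit of the increments carries this to every time in `[s, τ]`, endpoints
  -- included, and each `U t` then comes from an element of `H` with known norm.
  obtain ⟨t₀, ht₀, ht₀'⟩ := exists_mem_Ioo_of_ae hst hae
  have ht₀m := Ioo_subset_Icc_self ht₀
  have hq₀ : Tendsto (fun n => ⟪U t₀, gramResolvent ι n (U t₀)⟫) atTop (𝓝 (‖ι (u t₀)‖ ^ 2)) := by
    rw [← ht₀']
    have := (tendsto_const_nhds (x := gramOp ι (u t₀))).inner (𝕜 := ℝ)
      (tendsto_gramResolvent_gramOp ι hι (u t₀))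
    rwa [inner_gramOp_left, real_inner_self_eq_norm_sq] at this
  have hex : ∀ t, ∃ y : H, t ∈ Icc s τ → (∀ v, ⟪y, ι v⟫ = ⟪U t, v⟫) ∧
      ‖y‖ ^ 2 = ‖ι (u t₀)‖ ^ 2 + 2 * ∫ x in t₀..t, ⟪g x, u x⟫ := fun t => by
    by_cases ht : t ∈ Icc s τ
    · have h1 := hq₀.add (hlim t₀ ht₀m t ht)
      simp only [add_sub_cancel] at h1
      obtain ⟨y, hy⟩ := exists_eq_of_tendsto_inner_gramResolvent ι h1
      exact ⟨y, fun _ => hy⟩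
    · exact ⟨0, fun h => absurd h ht⟩
  choose c hc using hex
  have hii : ∀ r ∈ Icc s τ, ∀ t ∈ Icc s τ, IntervalIntegrable (fun x => ⟪g x, u x⟫) volume r t :=
    fun r hr t ht => IntegrableOn.intervalIntegrable_of_mem_Icc hgu hr ht
  have hgii : ∀ r ∈ Icc s τ, ∀ t ∈ Icc s τ, IntervalIntegrable g volume r t :=
    fun r hr t ht => IntegrableOn.intervalIntegrable_of_mem_Icc hu.integrableOn_deriv hr ht
  have hsm := left_mem_Icc.2 hst.le
  have hτm := right_mem_Icc.2 hst.le
  refine ⟨c, ⟨?_, ?_⟩, fun r hr t ht => ?_, fun r hr t ht v => ?_⟩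
  · refine continuousOn_of_weak_of_norm hd ?_ fun v => ?_
    · refine ContinuousOn.congr ?_ fun t ht => (hc t ht).2
      have := ((hii s hsm τ hτm).absolutelyContinuousOnInterval_primitive
        (c := t₀) (by rwa [uIcc_of_le hst.le])).continuousOn
      rw [uIcc_of_le hst.le] at this
      exact continuousOn_const.add (this.const_smul (2 : ℝ))
    · refine ContinuousOn.congr ?_ fun t ht => (hc t ht).1 v
      have := ((hgii s hsm τ hτm).absolutelyContinuousOnInterval_primitive
        left_mem_uIcc).continuousOn
      rw [uIcc_of_le hst.le] at this
      have h2 : ContinuousOn U (Icc s τ) := (continuousOn_const.add this).congr fun t _ => hU t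
      exact h2.inner continuousOn_const
  · filter_upwards [hae, ae_restrict_mem measurableSet_Ioo] with t ht htm
    refine hd.eq_of_forall_inner_eq fun v => ?_
    rw [(hc t (Ioo_subset_Icc_self htm)).1 v, ← ht, inner_gramOp_left]
  · rw [(hc t ht).2, (hc r hr).2,
      ← intervalIntegral.integral_interval_sub_left (hii t₀ ht₀m t ht) (hii t₀ ht₀m r hr)]
    ring
  · rw [(hc t ht).1, (hc r hr).1, ← inner_sub_left, hU, hU, add_sub_add_left_eq_sub,
      intervalIntegral.integral_interval_sub_left (hgii s hsm t ht) (hgii s hsm r hr)]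
    have h3 := (innerSL ℝ v).intervalIntegral_comp_comm (hgii r hr t ht)
    simp only [innerSL_apply_apply] at h3
    rw [real_inner_comm, ← h3]
    exact intervalIntegral.integral_congr fun x _ => real_inner_comm _ _

theorem exists_contRep (hu : IsWeakCurve ι s τ u g) (hst : s < τ) (hι : Function.Injective ι)
    (hd : DenseRange ι) : ∃ c : ℝ → H, IsContRepOn ι s τ u c :=
  let ⟨c, hc, _⟩ := hu.exists_contRep_aux hst hι hd
  ⟨c, hc⟩

end IsWeakCurve

theorem IsContRepOn.eqOn (hst : s < τ) (hc : IsContRepOn ι s τ u c) (hd : IsContRepOn ι s τ u d) :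
    EqOn c d (Icc s τ) :=
  hc.continuousOn.eqOn_Icc_of_ae_eq hst hd.continuousOn (by
    filter_upwards [hc.ae_eq, hd.ae_eq] with t h1 h2
    rw [h1, h2])

theorem IsContRepOn.add (hc : IsContRepOn ι s τ u c) (hd : IsContRepOn ι s τ v d) :
    IsContRepOn ι s τ (fun t => u t + v t) (fun t => c t + d t) :=
  ⟨hc.continuousOn.add hd.continuousOn, by
    filter_upwards [hc.ae_eq, hd.ae_eq] with t h1 h2
    rw [h1, h2, map_add]⟩

theorem IsContRepOn.const_smul (hc : IsContRepOn ι s τ u c) (a : ℝ) :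
    IsContRepOn ι s τ (fun t => a • u t) (fun t => a • c t) :=
  ⟨hc.continuousOn.const_smul a, by
    filter_upwards [hc.ae_eq] with t h1
    rw [h1, map_smul]⟩

namespace IsWeakCurve

theorem add (hu : IsWeakCurve ι s τ u g) (hv : IsWeakCurve ι s τ v h) :
    IsWeakCurve ι s τ (fun t => u t + v t) (fun t => g t + h t) where
  memLp := hu.memLp.add hv.memLp
  memLp_deriv := hu.memLp_deriv.add hv.memLp_deriv
  weak_deriv φ hφ := by
    have h1 := (gramOp ι).integrable_comp hu.integrableOn
    have h2 := (gramOp ι).integrable_comp hv.integrableOn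
    simp only [map_add, smul_add]
    rw [integral_add (hφ.deriv.integrableOn_smul h1) (hφ.deriv.integrableOn_smul h2),
      integral_add (hφ.integrableOn_smul hu.integrableOn_deriv)
        (hφ.integrableOn_smul hv.integrableOn_deriv), hu.weak_deriv φ hφ, hv.weak_deriv φ hφ]
    abel

theorem const_smul (hu : IsWeakCurve ι s τ u g) (a : ℝ) :
    IsWeakCurve ι s τ (fun t => a • u t) (fun t => a • g t) where
  memLp := hu.memLp.const_smul a
  memLp_deriv := hu.memLp_deriv.const_smul a
  weak_deriv φ hφ := by
    simp only [map_smul, smul_comm _ a]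
    rw [integral_smul, integral_smul, hu.weak_deriv φ hφ, smul_neg]

theorem congr (hu : IsWeakCurve ι s τ u g) (h1 : u =ᵐ[volume.restrict (Ioo s τ)] v)
    (h2 : g =ᵐ[volume.restrict (Ioo s τ)] h) : IsWeakCurve ι s τ v h where
  memLp := hu.memLp.ae_eq h1
  memLp_deriv := hu.memLp_deriv.ae_eq h2
  weak_deriv φ hφ := by
    have e1 : ∫ t in Ioo s τ, deriv φ t • gramOp ι (v t) =
        ∫ t in Ioo s τ, deriv φ t • gramOp ι (u t) :=
      integral_congr_ae (h1.mono fun t ht => by simp only [ht])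
    have e2 : ∫ t in Ioo s τ, φ t • h t = ∫ t in Ioo s τ, φ t • g t :=
      integral_congr_ae (h2.mono fun t ht => by simp only [ht])
    rw [e1, e2, hu.weak_deriv φ hφ]

theorem mono (hu : IsWeakCurve ι s τ u g) {s' τ' : ℝ} (hsub : Ioo s' τ' ⊆ Ioo s τ) :
    IsWeakCurve ι s' τ' u g where
  memLp := hu.memLp.mono_measure (Measure.restrict_mono hsub le_rfl)
  memLp_deriv := hu.memLp_deriv.mono_measure (Measure.restrict_mono hsub le_rfl)
  weak_deriv φ hφ := by
    rw [hφ.deriv.setIntegral_smul, hφ.setIntegral_smul]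
    have hφ' := hφ.mono hsub
    rw [← hφ'.deriv.setIntegral_smul, ← hφ'.setIntegral_smul]
    exact hu.weak_deriv φ hφ'

theorem inner_sub_inner (hu : IsWeakCurve ι s τ u g) (hst : s < τ) (hι : Function.Injective ι)
    (hd : DenseRange ι) (hc : IsContRepOn ι s τ u c) {r t : ℝ} (hr : r ∈ Icc s τ)
    (ht : t ∈ Icc s τ) (v : V) : ⟪c t, ι v⟫ - ⟪c r, ι v⟫ = ∫ x in r..t, ⟪g x, v⟫ := by
  obtain ⟨c', hc', -, h2⟩ := hu.exists_contRep_aux hst hι hd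
  rw [hc.eqOn hst hc' hr, hc.eqOn hst hc' ht, h2 r hr t ht]

theorem norm_sq_sub_norm_sq (hu : IsWeakCurve ι s τ u g) (hst : s < τ)
    (hι : Function.Injective ι) (hd : DenseRange ι) (hc : IsContRepOn ι s τ u c) {r t : ℝ}
    (hr : r ∈ Icc s τ) (ht : t ∈ Icc s τ) :
    ‖c t‖ ^ 2 - ‖c r‖ ^ 2 = 2 * ∫ x in r..t, ⟪g x, u x⟫ := by
  obtain ⟨c', hc', h2, -⟩ := hu.exists_contRep_aux hst hι hd
  rw [hc.eqOn hst hc' hr, hc.eqOn hst hc' ht, h2 r hr t ht]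

/-- The product rule for two curves in `L²(V)` with derivatives in `L²(V*)`. -/
theorem inner_sub_inner_eq_integral (hu : IsWeakCurve ι s τ u g) (hv : IsWeakCurve ι s τ v h)
    (hst : s < τ) (hι : Function.Injective ι) (hd : DenseRange ι) (hc : IsContRepOn ι s τ u c)
    (hd' : IsContRepOn ι s τ v d) {r t : ℝ} (hr : r ∈ Icc s τ) (ht : t ∈ Icc s τ) :
    ⟪c t, d t⟫ - ⟪c r, d r⟫ = ∫ x in r..t, (⟪g x, v x⟫ + ⟪h x, u x⟫) := by
  -- Polarisation: the product rule follows from the identity for squared norms, applied to `u + v`,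
  -- `u` and `v`.
  have h1 := (hu.add hv).norm_sq_sub_norm_sq hst hι hd (hc.add hd') hr ht
  have h2 := hu.norm_sq_sub_norm_sq hst hι hd hc hr ht
  have h3 := hv.norm_sq_sub_norm_sq hst hι hd hd' hr ht
  have hii : ∀ {u g v h}, IsWeakCurve ι s τ u g → IsWeakCurve ι s τ v h →
      IntervalIntegrable (fun x => ⟪g x, v x⟫) volume r t := fun hu hv =>
    IntegrableOn.intervalIntegrable_of_mem_Icc (hu.integrableOn_inner hv) hr ht
  rw [norm_add_sq_real, norm_add_sq_real] at h1
  simp only [inner_add_left, inner_add_right] at h1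
  rw [intervalIntegral.integral_add ((hii hu hu).add (hii hv hu)) ((hii hu hv).add (hii hv hv)),
    intervalIntegral.integral_add (hii hu hu) (hii hv hu),
    intervalIntegral.integral_add (hii hu hv) (hii hv hv)] at h1
  rw [intervalIntegral.integral_add (hii hu hv) (hii hv hu)]
  linarith

end IsWeakCurve

end LionsMagenes

/-! ### Measurability of operator families, Gronwall's inequality and the energy estimate -/

section Evolution

variable {V H : Type*} [NormedAddCommGroup V] [InnerProductSpace ℝ V] [CompleteSpace V]
  [NormedAddCommGroup H] [InnerProductSpace ℝ H] [CompleteSpace H]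

local notation "⟪" x ", " y "⟫" => inner ℝ x y

/-- The coordinates `⟪v, D n⟫` define a continuous injection of the Polish space `V` into `ℕ → ℝ`;
such a map is a measurable embedding. Only a separating sequence is required, which later allows
testing in `L²` instead of in `V`. -/
theorem aestronglyMeasurable_of_separating [TopologicalSpace.SeparableSpace V] {Ω : Type*}
    [MeasurableSpace Ω] {μ : Measure Ω} {f : Ω → V} (D : ℕ → V)
    (hD : ∀ v, (∀ n, ⟪v, D n⟫ = 0) → v = 0) (hf : ∀ n, AEMeasurable (fun x => ⟪f x, D n⟫) μ) :
    AEStronglyMeasurable f μ := by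
  borelize V
  have : SecondCountableTopology V := UniformSpace.secondCountable_of_separable V
  let Φ : V → ℕ → ℝ := fun v n => ⟪v, D n⟫
  have hc : Continuous Φ := continuous_pi fun n => by fun_prop
  have hinj : Function.Injective Φ := fun v w h => by
    refine sub_eq_zero.1 (hD _ fun n => ?_)
    rw [inner_sub_left, sub_eq_zero]
    exact congrFun h n
  exact ((hc.measurableEmbedding hinj).aemeasurable_comp_iff.1
    (aemeasurable_pi_iff.2 hf)).aestronglyMeasurable

/-- The theorem of Pettis in a separable Hilbert space. -/
theorem aestronglyMeasurable_of_inner [TopologicalSpace.SeparableSpace V] {Ω : Type*}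
    [MeasurableSpace Ω] {μ : Measure Ω} {f : Ω → V}
    (hf : ∀ w, AEMeasurable (fun x => ⟪f x, w⟫) μ) : AEStronglyMeasurable f μ := by
  refine aestronglyMeasurable_of_separating (TopologicalSpace.denseSeq V) (fun v hv => ?_)
    fun n => hf _
  refine (TopologicalSpace.denseRange_denseSeq V).eq_of_forall_inner_eq fun n => ?_
  rw [hv n, inner_zero_left]

/-- Move the operator to the fixed vector: `⟪A x (f x), w⟫ = ⟪f x, (A x)† w⟫`, and `(A x)† w` is
measurable by the theorem of Pettis. -/
theorem aestronglyMeasurable_clm_apply [TopologicalSpace.SeparableSpace V] {Ω : Type*}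
    [MeasurableSpace Ω] {μ : Measure Ω} {A : Ω → V →L[ℝ] V} {f : Ω → V}
    (hA : ∀ v w, AEMeasurable (fun x => ⟪A x v, w⟫) μ) (hf : AEStronglyMeasurable f μ) :
    AEStronglyMeasurable (fun x => A x (f x)) μ := by
  refine aestronglyMeasurable_of_inner fun w => ?_
  have h1 : AEStronglyMeasurable (fun x => ContinuousLinearMap.adjoint (A x) w) μ := by
    refine aestronglyMeasurable_of_inner fun v => ?_
    simpa only [ContinuousLinearMap.adjoint_inner_left, real_inner_comm] using hA v w
  refine (hf.inner h1 (𝕜 := ℝ)).aemeasurable.congr (Filter.Eventually.of_forall fun x => ?_)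
  exact ContinuousLinearMap.adjoint_inner_right _ _ _

/-- A measurable, bounded and quasi-coercive family of operators: `⟪A t v, w⟫ = a_t(v, w)` for a
nonautonomous form `a_t` on `V ⊂ H`. -/
structure IsQuasiCoerciveFamily (ι : V →L[ℝ] H) (s τ α κ M : ℝ) (A : ℝ → V →L[ℝ] V) : Prop where
  aemeasurable : ∀ v w, AEMeasurable (fun t => ⟪A t v, w⟫) (volume.restrict (Ioo s τ))
  bound : ∀ t ∈ Ioo s τ, ∀ v, ‖A t v‖ ≤ M * ‖v‖
  pos : 0 < α
  nonneg : 0 ≤ κ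
  coercive : ∀ t ∈ Ioo s τ, ∀ v, α * ‖v‖ ^ 2 ≤ ⟪A t v, v⟫ + κ * ‖ι v‖ ^ 2

variable {ι : V →L[ℝ] H} {s τ α κ M : ℝ} {A : ℝ → V →L[ℝ] V} {u g : ℝ → V} {c : ℝ → H}

theorem IsQuasiCoerciveFamily.mono (hA : IsQuasiCoerciveFamily ι s τ α κ M A) {s' τ' : ℝ}
    (h : Ioo s' τ' ⊆ Ioo s τ) : IsQuasiCoerciveFamily ι s' τ' α κ M A where
  aemeasurable v w := (hA.aemeasurable v w).mono_measure (Measure.restrict_mono h le_rfl)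
  bound t ht := hA.bound t (h ht)
  pos := hA.pos
  nonneg := hA.nonneg
  coercive t ht := hA.coercive t (h ht)

theorem memLp_clm_apply [TopologicalSpace.SeparableSpace V] {A : ℝ → V →L[ℝ] V} {f : ℝ → V}
    (hA : ∀ v w, AEMeasurable (fun t => ⟪A t v, w⟫) (volume.restrict (Ioo s τ)))
    (hb : ∀ t ∈ Ioo s τ, ∀ v, ‖A t v‖ ≤ M * ‖v‖) (hf : MemLp f 2 (volume.restrict (Ioo s τ))) :
    MemLp (fun t => A t (f t)) 2 (volume.restrict (Ioo s τ)) :=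
  hf.of_le_mul (aestronglyMeasurable_clm_apply hA hf.1)
    ((ae_restrict_iff' measurableSet_Ioo).2 (Filter.Eventually.of_forall fun t ht => hb t ht _))

theorem le_mul_exp_of_le_add_integral {y : ℝ → ℝ} {K δ : ℝ} (hst : s ≤ τ)
    (hy : ContinuousOn y (Icc s τ)) (hy0 : ∀ t ∈ Icc s τ, 0 ≤ y t) (hK : 0 ≤ K)
    (h : ∀ t ∈ Icc s τ, y t ≤ δ + K * ∫ x in s..t, y x) :
    ∀ t ∈ Icc s τ, y t ≤ δ * Real.exp (K * (t - s)) := by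
  -- The continuous extension by constants makes the primitive differentiable on all of `ℝ`, so that
  -- the differential form of Gronwall's inequality applies to the right-hand side `f`.
  set z : ℝ → ℝ := IccExtend hst ((Icc s τ).domRestrict y) with hz
  have hzc : Continuous z := (continuousOn_iff_continuous_domRestrict.1 hy).Icc_extend'
  have hzy : ∀ t ∈ Icc s τ, z t = y t := fun t ht => IccExtend_of_mem hst _ ht
  have hzi : ∀ t ∈ Icc s τ, ∫ x in s..t, z x = ∫ x in s..t, y x := fun t ht =>
    intervalIntegral.integral_congr fun x hx => by
      rw [uIcc_of_le ht.1] at hx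
      exact hzy x ⟨hx.1, hx.2.trans ht.2⟩
  have hδ : 0 ≤ δ := by
    have := h s (left_mem_Icc.2 hst)
    rw [intervalIntegral.integral_same, mul_zero, add_zero] at this
    exact (hy0 s (left_mem_Icc.2 hst)).trans this
  set f : ℝ → ℝ := fun t => δ + K * ∫ x in s..t, z x with hf
  have hd : ∀ t, HasDerivAt f (K * z t) t := fun t =>
    ((intervalIntegral.integral_hasDerivAt_right (hzc.intervalIntegrable _ _)
      (hzc.stronglyMeasurableAtFilter _ _) hzc.continuousAt).const_mul K).const_add δ
  have hle : ∀ t ∈ Icc s τ, z t ≤ f t := fun t ht => by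
    rw [hzy t ht, hf]
    simp only
    rw [hzi t ht]
    exact h t ht
  have hf0 : ∀ t ∈ Icc s τ, 0 ≤ f t := fun t ht =>
    ((hy0 t ht).trans_eq (hzy t ht).symm).trans (hle t ht)
  have hg := norm_le_gronwallBound_of_norm_deriv_right_le (f := f) (f' := fun t => K * z t)
    (δ := δ) (K := K) (ε := 0) (a := s) (b := τ)
    (fun t _ => (hd t).continuousAt.continuousWithinAt)
    (fun t _ => (hd t).hasDerivWithinAt)
    (by simp [hf, abs_of_nonneg hδ]) (fun t ht => by
      have ht' := Ico_subset_Icc_self ht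
      rw [Real.norm_eq_abs, Real.norm_eq_abs, add_zero, abs_of_nonneg (hf0 t ht'),
        abs_of_nonneg (mul_nonneg hK ((hy0 t ht').trans_eq (hzy t ht').symm))]
      exact mul_le_mul_of_nonneg_left (hle t ht') hK)
  intro t ht
  have := hg t ht
  rw [gronwallBound_ε0, Real.norm_eq_abs, abs_of_nonneg (hf0 t ht)] at this
  rw [← hzy t ht]
  exact (hle t ht).trans this

/-- The derivative of `‖c‖²` is `-2 ⟪A u, u⟫`, which coercivity bounds by `2 κ ‖c‖²`; Gronwall's
inequality concludes. -/
theorem IsWeakCurve.norm_sq_le_of_quasiCoercive (hA : IsQuasiCoerciveFamily ι s τ α κ M A)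
    (hst : s < τ) (hι : Function.Injective ι) (hd : DenseRange ι)
    (hu : IsWeakCurve ι s τ u g) (hg : ∀ᵐ t ∂(volume.restrict (Ioo s τ)), g t = - A t (u t))
    (hc : IsContRepOn ι s τ u c) {t : ℝ} (ht : t ∈ Icc s τ) :
    ‖c t‖ ^ 2 ≤ ‖c s‖ ^ 2 * Real.exp (2 * κ * (t - s)) := by
  have hs := left_mem_Icc.2 hst.le
  have hκ := hA.nonneg
  have hcc : ContinuousOn (fun t => ‖c t‖ ^ 2) (Icc s τ) := hc.continuousOn.norm.pow 2
  refine le_mul_exp_of_le_add_integral (y := fun t => ‖c t‖ ^ 2) hst.le hcc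
    (fun t _ => by positivity) (by positivity) (fun t ht => ?_) t ht
  have h1 := hu.norm_sq_sub_norm_sq hst hι hd hc hs ht
  have hae : ∀ᵐ x ∂(volume.restrict (Ioo s τ)), ⟪g x, u x⟫ ≤ κ * ‖c x‖ ^ 2 := by
    filter_upwards [hg, hc.ae_eq, ae_restrict_mem measurableSet_Ioo] with x h2 h3 hx
    rw [h2, h3, inner_neg_left]
    have := hA.coercive x hx (u x)
    have h4 := hA.pos
    nlinarith [sq_nonneg ‖u x‖]
  have h2 : ∫ x in s..t, ⟪g x, u x⟫ ≤ ∫ x in s..t, κ * ‖c x‖ ^ 2 := by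
    refine intervalIntegral.integral_mono_ae_restrict ht.1
      (IntegrableOn.intervalIntegrable_of_mem_Icc (hu.integrableOn_inner hu) hs ht) ?_ ?_
    · refine (ContinuousOn.const_mul ?_ κ).intervalIntegrable
      rw [uIcc_of_le ht.1]
      exact hcc.mono (Icc_subset_Icc_right ht.2)
    · have h5 := ae_of_mem_uIoc_of_ae_restrict_Ioo hae hs ht
      refine (ae_restrict_iff' measurableSet_Icc).2 ?_
      filter_upwards [h5, Measure.ae_ne volume s] with x h6 h7 hx
      rw [uIoc_of_le ht.1] at h6
      exact h6 ⟨lt_of_le_of_ne hx.1 h7.symm, hx.2⟩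
  rw [intervalIntegral.integral_const_mul] at h2
  linarith

end Evolution

/-! ### The existence theorem of Lions -/

section LionsExistence

variable {V H : Type*} [NormedAddCommGroup V] [InnerProductSpace ℝ V] [CompleteSpace V]
  [NormedAddCommGroup H] [InnerProductSpace ℝ H] [CompleteSpace H]

local notation "⟪" x ", " y "⟫" => inner ℝ x y

variable {ι : V →L[ℝ] H} {s τ α κ M : ℝ} {A : ℝ → V →L[ℝ] V} {u g : ℝ → V} {c : ℝ → H}

/-- Curves of class `C¹` in `V` that vanish at the final time `τ`. -/
def finalTestCurves (V : Type*) [NormedAddCommGroup V] [InnerProductSpace ℝ V] (τ : ℝ) :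
    Submodule ℝ (ℝ → V) where
  carrier := {φ | ContDiff ℝ 1 φ ∧ φ τ = 0}
  add_mem' h1 h2 := ⟨h1.1.add h2.1, by simp [h1.2, h2.2]⟩
  zero_mem' := ⟨contDiff_const, rfl⟩
  smul_mem' a _ h := ⟨h.1.const_smul a, by simp [h.2]⟩

theorem Continuous.memLp_two_restrict_Ioo {F : Type*} [NormedAddCommGroup F] {f : ℝ → F}
    (hf : Continuous f) : MemLp f 2 (volume.restrict (Ioo s τ)) := by
  obtain ⟨C, hC⟩ := isCompact_Icc.exists_bound_of_continuousOn (s := Icc s τ) hf.continuousOn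
  refine MemLp.of_bound ?_ C ?_
  · exact hf.continuousOn.aestronglyMeasurable measurableSet_Ioo
  · exact (ae_restrict_iff' measurableSet_Ioo).2
      (Filter.Eventually.of_forall fun t ht => hC t (Ioo_subset_Icc_self ht))

variable [TopologicalSpace.SeparableSpace V]

theorem IsQuasiCoerciveFamily.aemeasurable_adjoint (hA : IsQuasiCoerciveFamily ι s τ α κ M A)
    (v w : V) : AEMeasurable (fun t => ⟪ContinuousLinearMap.adjoint (A t) v, w⟫)
      (volume.restrict (Ioo s τ)) := by
  simpa only [ContinuousLinearMap.adjoint_inner_left, real_inner_comm] using hA.aemeasurable w v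

theorem IsQuasiCoerciveFamily.memLp (hA : IsQuasiCoerciveFamily ι s τ α κ M A)
    (hu : MemLp u 2 (volume.restrict (Ioo s τ))) :
    MemLp (fun t => A t (u t)) 2 (volume.restrict (Ioo s τ)) :=
  memLp_clm_apply hA.aemeasurable hA.bound hu

theorem IsQuasiCoerciveFamily.memLp_adjoint (hA : IsQuasiCoerciveFamily ι s τ α κ M A)
    (hu : MemLp u 2 (volume.restrict (Ioo s τ))) :
    MemLp (fun t => ContinuousLinearMap.adjoint (A t) (u t)) 2 (volume.restrict (Ioo s τ)) := by
  refine memLp_clm_apply (M := |M|) hA.aemeasurable_adjoint (fun t ht v => ?_) hu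
  refine (ContinuousLinearMap.le_opNorm _ _).trans
    (mul_le_mul_of_nonneg_right ?_ (norm_nonneg _))
  rw [LinearIsometryEquiv.norm_map]
  exact ContinuousLinearMap.opNorm_le_bound _ (abs_nonneg _) fun v => (hA.bound t ht v).trans
    (mul_le_mul_of_nonneg_right (le_abs_self _) (norm_nonneg _))

theorem IsQuasiCoerciveFamily.memLp_testOp (hA : IsQuasiCoerciveFamily ι s τ α κ M A)
    (φ : finalTestCurves V τ) :
    MemLp (fun t => ContinuousLinearMap.adjoint (A t) (φ.1 t) - gramOp ι (deriv φ.1 t)) 2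
      (volume.restrict (Ioo s τ)) :=
  (hA.memLp_adjoint φ.2.1.continuous.memLp_two_restrict_Ioo).sub
    ((gramOp ι).continuous.comp φ.2.1.continuous_deriv_one).memLp_two_restrict_Ioo

/-- The operator `φ ↦ A† φ - φ'` on test curves. -/
noncomputable def IsQuasiCoerciveFamily.testOp (hA : IsQuasiCoerciveFamily ι s τ α κ M A) :
    finalTestCurves V τ →ₗ[ℝ] Lp V 2 (volume.restrict (Ioo s τ)) where
  toFun φ := (hA.memLp_testOp φ).toLp _
  map_add' φ ψ := by
    rw [← MemLp.toLp_add]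
    congr 1
    ext t
    have : deriv (φ.1 + ψ.1) t = deriv φ.1 t + deriv ψ.1 t :=
      deriv_add (φ.2.1.differentiable_one t) (ψ.2.1.differentiable_one t)
    simp only [Submodule.coe_add, Pi.add_apply, this, map_add]
    abel
  map_smul' a φ := by
    rw [RingHom.id_apply, ← MemLp.toLp_const_smul]
    congr 1
    ext t
    have : deriv (a • φ.1) t = a • deriv φ.1 t :=
      deriv_const_smul _ (φ.2.1.differentiable_one t)
    simp only [Submodule.coe_smul, Pi.smul_apply, this, map_smul, smul_sub]

theorem norm_sq_toLp_eq_integral {μ : Measure ℝ} {f : ℝ → V} (hf : MemLp f 2 μ) :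
    ‖hf.toLp f‖ ^ 2 = ∫ t, ‖f t‖ ^ 2 ∂μ := by
  rw [← real_inner_self_eq_norm_sq, L2.inner_def]
  refine integral_congr_ae ?_
  filter_upwards [hf.coeFn_toLp] with t ht
  rw [ht, real_inner_self_eq_norm_sq]

/-- This is the a priori estimate for the adjoint problem. The factor `e^{2κ(t-s)}` absorbs the term
`κ ‖ι φ‖²` in the coercivity. With `k = A†φ - ι†ι φ'` and `e` that factor, the derivative of `-e ‖ι
φ‖²` is `2e (⟪k, φ⟫ - ⟪A φ, φ⟫ - κ ‖ι φ‖²)`, at most a constant times `‖k‖²`. Integration uses `φ τ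
= 0`. -/
theorem IsQuasiCoerciveFamily.norm_initial_le (hA : IsQuasiCoerciveFamily ι s τ α κ M A)
    (hst : s < τ) (φ : finalTestCurves V τ) :
    ‖ι (φ.1 s)‖ ≤ Real.exp (2 * κ * (τ - s)) / √(2 * α) * ‖hA.testOp φ‖ := by
  set E := Real.exp (2 * κ * (τ - s)) with hE
  have hα := hA.pos
  have hκ := hA.nonneg
  have hφ := φ.2.1
  set p : ℝ → ℝ := fun t => Real.exp (2 * κ * (t - s)) * ‖ι (φ.1 t)‖ ^ 2 with hp
  set p' : ℝ → ℝ := fun t => Real.exp (2 * κ * (t - s)) *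
    (2 * κ * ‖ι (φ.1 t)‖ ^ 2 + 2 * ⟪ι (φ.1 t), ι (deriv φ.1 t)⟫) with hp'
  have hd : ∀ t, HasDerivAt p (p' t) t := fun t => by
    have h1 : HasDerivAt (fun t => ι (φ.1 t)) (ι (deriv φ.1 t)) t :=
      ι.hasFDerivAt.comp_hasDerivAt t (hφ.differentiable_one t).hasDerivAt
    have h2 : HasDerivAt (fun t => Real.exp (2 * κ * (t - s)))
        (Real.exp (2 * κ * (t - s)) * (2 * κ * 1)) t :=
      (((hasDerivAt_id t).sub_const s).const_mul (2 * κ)).exp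
    have h3 := h2.mul h1.norm_sq
    have h4 : Real.exp (2 * κ * (t - s)) * (2 * κ * 1) * ‖ι (φ.1 t)‖ ^ 2 +
        Real.exp (2 * κ * (t - s)) * (2 * ⟪ι (φ.1 t), ι (deriv φ.1 t)⟫) = p' t := by
      rw [hp']; ring
    rw [h4] at h3
    exact h3
  have hdc : Continuous (deriv φ.1) := hφ.continuous_deriv_one
  have hφc : Continuous φ.1 := hφ.continuous
  have hpc : Continuous p' := by fun_prop
  have hint : ∫ t in Ioo s τ, - p' t = ‖ι (φ.1 s)‖ ^ 2 := by
    rw [IntegrableOn.integral_Ioo_eq hst.le, intervalIntegral.integral_neg,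
      intervalIntegral.integral_eq_sub_of_hasDerivAt (fun t _ => hd t)
        (hpc.intervalIntegrable _ _)]
    simp [hp, φ.2.2]
  set k : ℝ → V := fun t => ContinuousLinearMap.adjoint (A t) (φ.1 t) - gramOp ι (deriv φ.1 t)
    with hk
  have hkL : MemLp k 2 (volume.restrict (Ioo s τ)) := hA.memLp_testOp φ
  have hpt : ∀ t ∈ Ioo s τ, - p' t ≤ E ^ 2 / (2 * α) * ‖k t‖ ^ 2 := fun t ht => by
    set e := Real.exp (2 * κ * (t - s)) with he
    have he1 : 1 ≤ e := Real.one_le_exp (by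
      have : 0 ≤ t - s := by linarith [ht.1]
      positivity)
    have heE : e ≤ E := Real.exp_le_exp.2
      (mul_le_mul_of_nonneg_left (by linarith [ht.2]) (by positivity))
    have h1 : ⟪k t, φ.1 t⟫ = ⟪A t (φ.1 t), φ.1 t⟫ - ⟪ι (φ.1 t), ι (deriv φ.1 t)⟫ := by
      rw [hk]
      simp only
      rw [inner_sub_left, ContinuousLinearMap.adjoint_inner_left, inner_gramOp_left,
        real_inner_comm (φ.1 t) (A t (φ.1 t)), real_inner_comm (ι (φ.1 t))]
    have h2 := hA.coercive t ht (φ.1 t)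
    have h3 := real_inner_le_norm (k t) (φ.1 t)
    set x := ‖φ.1 t‖
    set y := ‖k t‖
    have hx : 0 ≤ x := norm_nonneg _
    have hy : 0 ≤ y := norm_nonneg _
    have h4 : - p' t = 2 * (e * (⟪k t, φ.1 t⟫ - (⟪A t (φ.1 t), φ.1 t⟫ + κ * ‖ι (φ.1 t)‖ ^ 2))) := by
      rw [h1, hp']; ring
    have h5 : e * (⟪k t, φ.1 t⟫ - (⟪A t (φ.1 t), φ.1 t⟫ + κ * ‖ι (φ.1 t)‖ ^ 2)) ≤
        e * (y * x - α * x ^ 2) := mul_le_mul_of_nonneg_left (by linarith) (by linarith)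
    -- The positive term is bounded with `e ≤ E`, the negative one with `1 ≤ e`; completing the
    -- square then removes `x`.
    have h6 : e * (y * x - α * x ^ 2) ≤ E * y * x - α * x ^ 2 := by
      have : e * (y * x) ≤ E * (y * x) := mul_le_mul_of_nonneg_right heE (by positivity)
      have : α * x ^ 2 ≤ e * (α * x ^ 2) := le_mul_of_one_le_left (by positivity) he1
      linarith
    have h7 : E * y * x - α * x ^ 2 ≤ E ^ 2 / (4 * α) * y ^ 2 := by
      have h8 : E ^ 2 / (4 * α) * y ^ 2 - (E * y * x - α * x ^ 2) =
          (E * y - 2 * α * x) ^ 2 / (4 * α) := by field_simp; ring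
      have : 0 ≤ (E * y - 2 * α * x) ^ 2 / (4 * α) := by positivity
      linarith
    have h9 : E ^ 2 / (2 * α) * y ^ 2 = 2 * (E ^ 2 / (4 * α) * y ^ 2) := by field_simp; ring
    rw [h4, h9]
    linarith
  have hle : ‖ι (φ.1 s)‖ ^ 2 ≤ E ^ 2 / (2 * α) * ‖hA.testOp φ‖ ^ 2 := by
    have h1 : ‖hA.testOp φ‖ ^ 2 = ∫ t in Ioo s τ, ‖k t‖ ^ 2 := norm_sq_toLp_eq_integral hkL
    rw [h1, ← hint, ← integral_const_mul]
    refine setIntegral_mono_on ?_ ?_ measurableSet_Ioo hpt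
    · exact (hpc.neg.memLp_two_restrict_Ioo).integrableOn_Ioo
    · exact (hkL.norm.integrable_sq).const_mul _
  refine le_of_sq_le_sq ?_ (by positivity)
  rw [mul_pow, div_pow, Real.sq_sqrt (by positivity)]
  exact hle

/-- The existence theorem of Lions for a nonautonomous evolution equation. -/
theorem IsQuasiCoerciveFamily.exists_solution (hA : IsQuasiCoerciveFamily ι s τ α κ M A)
    (hst : s < τ) (hι : Function.Injective ι) (hd : DenseRange ι) (h : H) :
    ∃ u : ℝ → V, ∃ c : ℝ → H, IsWeakCurve ι s τ u (fun t => - A t (u t)) ∧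
      IsContRepOn ι s τ u c ∧ c s = h := by
  let L : finalTestCurves V τ →ₗ[ℝ] ℝ :=
    { toFun := fun φ => ⟪h, ι (φ.1 s)⟫
      map_add' := fun φ ψ => by simp [inner_add_right]
      map_smul' := fun a φ => by simp [real_inner_smul_right] }
  have hα := hA.pos
  -- The a priori estimate makes `φ ↦ ⟪h, ι (φ s)⟫` bounded in terms of `A†φ - ι†ι φ'`. The
  -- representing `w` in `L²(V)` solves the equation integrated by parts, with the initial value
  -- already built in.
  obtain ⟨w, -, hw⟩ := exists_inner_eq_of_le hA.testOp L
    (M := ‖h‖ * (Real.exp (2 * κ * (τ - s)) / √(2 * α))) (by positivity) (fun φ => by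
      refine (abs_real_inner_le_norm _ _).trans ?_
      rw [mul_assoc]
      exact mul_le_mul_of_nonneg_left (hA.norm_initial_le hst φ) (norm_nonneg _))
  have hwL : MemLp w 2 (volume.restrict (Ioo s τ)) := Lp.memLp w
  have hAw := hA.memLp hwL
  have hRw : IntegrableOn (fun t => gramOp ι (w t)) (Ioo s τ) :=
    (gramOp ι).integrable_comp hwL.integrableOn_Ioo
  have hw' : ∀ (η : ℝ → ℝ) (v : V), ContDiff ℝ 1 η → η τ = 0 →
      ∫ t in Ioo s τ, (η t * ⟪A t (w t), v⟫ - deriv η t * ⟪gramOp ι (w t), v⟫) =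
        η s * ⟪h, ι v⟫ := fun η v hη h0 => by
    have hmem : (fun t => η t • v) ∈ finalTestCurves V τ :=
      ⟨hη.smul contDiff_const, by simp [h0]⟩
    have h1 := hw ⟨_, hmem⟩
    have h2 : L ⟨_, hmem⟩ = η s * ⟪h, ι v⟫ := by
      change ⟪h, ι (η s • v)⟫ = _
      rw [map_smul, real_inner_smul_right]
    rw [h2, L2.inner_def] at h1
    rw [← h1]
    refine integral_congr_ae ?_
    filter_upwards [(hA.memLp_testOp ⟨_, hmem⟩).coeFn_toLp] with t ht
    have h3 : (hA.testOp ⟨_, hmem⟩ : ℝ → V) t = _ := ht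
    have h4 : deriv (fun t => η t • v) t = deriv η t • v :=
      deriv_smul_const (hη.differentiable_one t) v
    rw [h3]
    simp only [h4, inner_sub_right, ContinuousLinearMap.adjoint_inner_right, map_smul,
      real_inner_smul_right, inner_gramOp_right, inner_gramOp_left]
  have hu : IsWeakCurve ι s τ w (fun t => - A t (w t)) := by
    refine ⟨hwL, hAw.neg, fun φ hφ => ?_⟩
    refine ext_inner_left ℝ fun v => ?_
    have h1 := hw' φ v (hφ.contDiff.of_le (by simp)) (hφ.eq_zero (by simp))
    rw [hφ.eq_zero (t := s) (by simp), zero_mul] at h1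
    have i1 := hφ.integrableOn_smul hAw.integrableOn_Ioo
    have i2 := hφ.deriv.integrableOn_smul hRw
    have h2 := (innerSL ℝ v).integral_comp_comm (i1.sub i2)
    rw [integral_sub' i1 i2] at h2
    simp only [Pi.sub_apply, innerSL_apply_apply, inner_sub_right, real_inner_smul_right] at h2
    simp only [real_inner_comm _ v] at h2 h1
    rw [h1] at h2
    simp only [smul_neg, integral_neg, neg_neg, real_inner_comm _ v]
    linarith
  obtain ⟨c, hc⟩ := hu.exists_contRep hst hι hd
  refine ⟨w, c, hu, hc, hd.eq_of_forall_inner_eq fun v => ?_⟩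
  -- The factor `τ - t` vanishes at `τ` but not at `s`. Comparing the two integrations by parts
  -- gives `(τ - s) ⟪h, ι v⟫ = (τ - s) ⟪c s, ι v⟫`, which identifies the initial value.
  have h1 := hw' (fun t => τ - t) v (contDiff_const.sub contDiff_id) (sub_self τ)
  have hdη : ∀ t, HasDerivAt (fun t => τ - t) (-1) t := fun t => by
    simpa using (hasDerivAt_id t).const_sub τ
  simp only [(hdη _).deriv] at h1
  have hgi : IntegrableOn (fun t => ⟪- A t (w t), v⟫) (Ioo s τ) :=
    hAw.neg.integrableOn_Ioo.inner_const v
  have hs := left_mem_Icc.2 hst.le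
  have hτ := right_mem_Icc.2 hst.le
  have hgI := IntegrableOn.intervalIntegrable_of_mem_Icc hgi hs hτ
  have hac1 := hgI.absolutelyContinuousOnInterval_primitive left_mem_uIcc
  have hac2 := (AbsolutelyContinuousOnInterval.of_contDiff (f := fun t : ℝ => τ - t)
    (contDiff_const.sub contDiff_id) s τ).smul
    ((AbsolutelyContinuousOnInterval.of_contDiff (f := fun _ : ℝ => ⟪c s, ι v⟫)
      contDiff_const s τ).add hac1)
  have hint1 : IntervalIntegrable (fun t => (τ - t) * ⟪- A t (w t), v⟫) volume s τ :=
    hgI.continuousOn_mul (by fun_prop)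
  have hint2 : IntervalIntegrable (fun t => ⟪c s, ι v⟫ + ∫ x in s..t, ⟪- A x (w x), v⟫)
      volume s τ := (continuousOn_const.add hac1.continuousOn).intervalIntegrable
  have h2 := hac2.integral_eq_sub_of_ae_hasDerivAt
    (f' := fun t => (τ - t) * ⟪- A t (w t), v⟫ - (⟪c s, ι v⟫ + ∫ x in s..t, ⟪- A x (w x), v⟫))
    (hint1.sub hint2) (by
      filter_upwards [hgI.ae_hasDerivAt_integral] with x hx hxm
      have h3 := (hdη x).mul ((hx hxm s left_mem_uIcc).const_add ⟪c s, ι v⟫)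
      refine h3.congr_deriv ?_
      ring)
  simp only [Pi.smul_apply', Pi.add_apply, sub_self, smul_eq_mul, zero_mul,
    intervalIntegral.integral_same, add_zero, zero_sub] at h2
  rw [← IntegrableOn.integral_Ioo_eq hst.le] at h2
  have h4 : ∫ t in Ioo s τ, ((τ - t) * ⟪A t (w t), v⟫ - -1 * ⟪gramOp ι (w t), v⟫) =
      - ∫ t in Ioo s τ, ((τ - t) * ⟪- A t (w t), v⟫ -
        (⟪c s, ι v⟫ + ∫ x in s..t, ⟪- A x (w x), v⟫)) := by
    rw [← integral_neg]
    refine integral_congr_ae ?_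
    filter_upwards [hc.ae_eq, ae_restrict_mem measurableSet_Ioo] with t h5 ht
    have h6 := hu.inner_sub_inner hst hι hd hc hs (Ioo_subset_Icc_self ht) v
    rw [← h6, inner_gramOp_left, ← h5, inner_neg_left]
    ring
  rw [h4, h2, neg_neg] at h1
  exact mul_left_cancel₀ (sub_ne_zero.2 hst.ne') h1

end LionsExistence

/-! ### Forward and backward propagators -/

section Propagators

theorem neg_preimage_Ioo (s τ : ℝ) : Neg.neg ⁻¹' Ioo s τ = Ioo (-τ) (-s) := by
  ext t
  simp only [mem_preimage, mem_Ioo]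
  constructor <;> rintro ⟨h1, h2⟩ <;> constructor <;> linarith

variable {V H : Type*} [NormedAddCommGroup V] [InnerProductSpace ℝ V] [CompleteSpace V]
  [NormedAddCommGroup H] [InnerProductSpace ℝ H] [CompleteSpace H]

local notation "⟪" x ", " y "⟫" => inner ℝ x y

variable {ι : V →L[ℝ] H} {s τ α κ M : ℝ} {A : ℝ → V →L[ℝ] V} {u v g : ℝ → V} {c d : ℝ → H}

theorem IsContRepOn.mono (hc : IsContRepOn ι s τ u c) {s' τ' : ℝ} (hs : s ≤ s') (hτ : τ' ≤ τ) :
    IsContRepOn ι s' τ' u c :=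
  ⟨hc.continuousOn.mono (Icc_subset_Icc hs hτ),
    ae_mono (Measure.restrict_mono (Ioo_subset_Ioo hs hτ) le_rfl) hc.ae_eq⟩

theorem IsContRepOn.congr_right (hc : IsContRepOn ι s τ u c) (h : EqOn d c (Icc s τ)) :
    IsContRepOn ι s τ u d :=
  ⟨hc.continuousOn.congr h, by
    filter_upwards [hc.ae_eq, ae_restrict_mem measurableSet_Ioo] with t h1 h2
    rw [h (Ioo_subset_Icc_self h2), h1]⟩

theorem IsContRepOn.congr_left (hc : IsContRepOn ι s τ u c)
    (h : u =ᵐ[volume.restrict (Ioo s τ)] v) : IsContRepOn ι s τ v c :=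
  ⟨hc.continuousOn, by filter_upwards [hc.ae_eq, h] with t h1 h2; rw [h1, h2]⟩

/-- `u`, with continuous representative `c`, solves `u' + A u = 0` on `(s, τ)`. -/
structure IsEvolution (ι : V →L[ℝ] H) (A : ℝ → V →L[ℝ] V) (s τ : ℝ) (u : ℝ → V) (c : ℝ → H) :
    Prop where
  isWeakCurve : IsWeakCurve ι s τ u (fun t => - A t (u t))
  isContRepOn : IsContRepOn ι s τ u c

namespace IsEvolution

theorem add (hu : IsEvolution ι A s τ u c) (hv : IsEvolution ι A s τ v d) :
    IsEvolution ι A s τ (fun t => u t + v t) (fun t => c t + d t) :=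
  ⟨by simpa only [map_add, neg_add] using hu.1.add hv.1, hu.2.add hv.2⟩

theorem const_smul (hu : IsEvolution ι A s τ u c) (a : ℝ) :
    IsEvolution ι A s τ (fun t => a • u t) (fun t => a • c t) :=
  ⟨by simpa only [map_smul, smul_neg] using hu.1.const_smul a, hu.2.const_smul a⟩

theorem mono (hu : IsEvolution ι A s τ u c) {s' τ' : ℝ} (hs : s ≤ s') (hτ : τ' ≤ τ) :
    IsEvolution ι A s' τ' u c :=
  ⟨hu.1.mono (Ioo_subset_Ioo hs hτ), hu.2.mono hs hτ⟩

theorem norm_le (hA : IsQuasiCoerciveFamily ι s τ α κ M A) (hst : s < τ)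
    (hι : Function.Injective ι) (hd : DenseRange ι) (hu : IsEvolution ι A s τ u c) {t : ℝ}
    (ht : t ∈ Icc s τ) : ‖c t‖ ≤ √(Real.exp (2 * κ * (τ - s))) * ‖c s‖ := by
  have h1 := hu.1.norm_sq_le_of_quasiCoercive hA hst hι hd
    (Filter.Eventually.of_forall fun t => rfl) hu.2 ht
  refine le_of_sq_le_sq ?_ (by positivity)
  rw [mul_pow, Real.sq_sqrt (Real.exp_pos _).le, mul_comm]
  refine h1.trans (mul_le_mul_of_nonneg_left (Real.exp_le_exp.2 ?_) (by positivity))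
  have := hA.nonneg
  exact mul_le_mul_of_nonneg_left (by linarith [ht.2]) (by positivity)

theorem eqOn (hA : IsQuasiCoerciveFamily ι s τ α κ M A) (hst : s < τ)
    (hι : Function.Injective ι) (hd : DenseRange ι) (hu : IsEvolution ι A s τ u c)
    (hv : IsEvolution ι A s τ v d) (h : c s = d s) : EqOn c d (Icc s τ) := fun t ht => by
  have h1 := (hu.add (hv.const_smul (-1))).norm_le hA hst hι hd ht
  simp only [h, neg_smul, one_smul, add_neg_cancel, norm_zero, mul_zero] at h1
  rw [← sub_eq_add_neg] at h1
  exact sub_eq_zero.1 (norm_le_zero_iff.1 h1)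

theorem ae_eq (hA : IsQuasiCoerciveFamily ι s τ α κ M A) (hst : s < τ)
    (hι : Function.Injective ι) (hd : DenseRange ι) (hu : IsEvolution ι A s τ u c)
    (hv : IsEvolution ι A s τ v d) (h : c s = d s) : u =ᵐ[volume.restrict (Ioo s τ)] v := by
  filter_upwards [hu.2.ae_eq, hv.2.ae_eq, ae_restrict_mem measurableSet_Ioo] with t h1 h2 ht
  refine hι ?_
  rw [← h1, ← h2]
  exact hu.eqOn hA hst hι hd hv h (Ioo_subset_Icc_self ht)

end IsEvolution

/-- Uniqueness makes the solution at time `t` linear in the initial value, and the energy estimate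
makes it bounded. -/
theorem IsQuasiCoerciveFamily.exists_evolution_clm
    [TopologicalSpace.SeparableSpace V] (hA : IsQuasiCoerciveFamily ι s τ α κ M A)
    (hst : s < τ) (hι : Function.Injective ι) (hd : DenseRange ι) :
    ∃ S : ℝ → H →L[ℝ] H, S s = ContinuousLinearMap.id ℝ H ∧
      ∀ h, ∃ u, IsEvolution ι A s τ u (fun t => S t h) := by
  have hex := fun h => hA.exists_solution hst hι hd h
  choose u c hu hc hcs using hex
  have hE : ∀ h, IsEvolution ι A s τ (u h) (c h) := fun h => ⟨hu h, hc h⟩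
  have key : ∀ t, ∃ S : H →L[ℝ] H, t ∈ Icc s τ → ∀ h, S h = c h t := fun t => by
    by_cases ht : t ∈ Icc s τ
    · let S : H →ₗ[ℝ] H :=
        { toFun := fun h => c h t
          map_add' := fun h k => (hE (h + k)).eqOn hA hst hι hd ((hE h).add (hE k))
            (by simp only [hcs]) ht
          map_smul' := fun a h => (hE (a • h)).eqOn hA hst hι hd ((hE h).const_smul a)
            (by simp only [hcs]) ht }
      refine ⟨S.mkContinuous (√(Real.exp (2 * κ * (τ - s)))) fun h => ?_, fun _ h => rfl⟩
      have := (hE h).norm_le hA hst hι hd ht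
      rwa [hcs] at this
    · exact ⟨0, fun h => absurd h ht⟩
  choose S hS using key
  refine ⟨S, ?_, fun h => ⟨u h, hu h, (hc h).congr_right fun t ht => hS t ht h⟩⟩
  ext1 h
  rw [hS s (left_mem_Icc.2 hst.le), hcs, ContinuousLinearMap.id_apply]

/-- The propagator of a nonautonomous evolution equation. -/
theorem IsQuasiCoerciveFamily.exists_propagator
    [TopologicalSpace.SeparableSpace V] (hA : IsQuasiCoerciveFamily ι s τ α κ M A)
    (hι : Function.Injective ι) (hd : DenseRange ι) :
    ∃ P : ℝ → ℝ → H →L[ℝ] H,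
      (∀ t, P t t = ContinuousLinearMap.id ℝ H) ∧
      (∀ a b, s ≤ a → a < b → b ≤ τ → ∀ h, ∃ u, IsEvolution ι A a b u (fun t => P t a h)) ∧
      (∀ a b, s ≤ a → a < b → b ≤ τ → ∀ h u c, IsEvolution ι A a b u c → c a = h →
        EqOn c (fun t => P t a h) (Icc a b)) ∧
      (∀ r a t, s ≤ r → r ≤ a → a ≤ t → t ≤ τ → P t r = (P t a).comp (P a r)) := by
  have hex : ∀ a, ∃ S : ℝ → H →L[ℝ] H, S a = ContinuousLinearMap.id ℝ H ∧
      (s ≤ a → a < τ → ∀ h, ∃ u, IsEvolution ι A a τ u (fun t => S t h)) := fun a => by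
    by_cases ha : s ≤ a ∧ a < τ
    · obtain ⟨S, h1, h2⟩ := (hA.mono (Ioo_subset_Ioo_left ha.1)).exists_evolution_clm ha.2 hι hd
      exact ⟨S, h1, fun _ _ => h2⟩
    -- The default is the identity because `S a a` has to be the identity also for `a = τ`, where no
    -- evolution starts.
    · exact ⟨fun _ => ContinuousLinearMap.id ℝ H, rfl, fun h1 h2 => absurd ⟨h1, h2⟩ ha⟩
  choose S hS hE using hex
  have hex' : ∀ a b, s ≤ a → a < b → b ≤ τ → ∀ h,
      ∃ u, IsEvolution ι A a b u (fun t => S a t h) := fun a b ha hab hb h => by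
    obtain ⟨u, hu⟩ := hE a ha (hab.trans_le hb) h
    exact ⟨u, hu.mono le_rfl hb⟩
  have huniq : ∀ a b, s ≤ a → a < b → b ≤ τ → ∀ h u c, IsEvolution ι A a b u c → c a = h →
      EqOn c (fun t => S a t h) (Icc a b) := fun a b ha hab hb h u c hu hc => by
    obtain ⟨u', hu'⟩ := hex' a b ha hab hb h
    refine hu.eqOn (hA.mono (Ioo_subset_Ioo ha hb)) hab hι hd hu' ?_
    rw [hc, hS, ContinuousLinearMap.id_apply]
  refine ⟨fun t a => S a t, hS, hex', huniq, fun r a t hr hra hat ht => ?_⟩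
  rcases hra.eq_or_lt with rfl | hra'
  · simp only [hS, ContinuousLinearMap.comp_id]
  rcases hat.eq_or_lt with rfl | hat'
  · simp only [hS, ContinuousLinearMap.id_comp]
  -- On `[a, t]` the solution started at `r` is the one started at `a` from its own value there.
  ext1 h
  obtain ⟨u, hu⟩ := hE r hr (by linarith) h
  exact huniq a t (hr.trans hra) hat' ht (S r a h) u _ (hu.mono hra ht) rfl
    (right_mem_Icc.2 hat)

theorem measurePreserving_neg_restrict_Ioo (s τ : ℝ) :
    MeasurePreserving Neg.neg (volume.restrict (Ioo (-τ) (-s))) (volume.restrict (Ioo s τ)) := by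
  rw [← neg_preimage_Ioo]
  exact (Measure.measurePreserving_neg (volume : Measure ℝ)).restrict_preimage measurableSet_Ioo

theorem IsTestFun.comp_neg {φ : ℝ → ℝ} (hφ : IsTestFun (-τ) (-s) φ) :
    IsTestFun s τ (fun t => φ (-t)) where
  contDiff := hφ.contDiff.comp contDiff_neg
  hasCompactSupport := hφ.hasCompactSupport.comp_homeomorph (Homeomorph.neg ℝ)
  tsupport_subset := by
    have : tsupport (fun t => φ (-t)) = (Homeomorph.neg ℝ) ⁻¹' tsupport φ :=
      tsupport_comp_eq_preimage φ (Homeomorph.neg ℝ)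
    rw [this]
    intro t ht
    have := hφ.tsupport_subset ht
    simp only [Homeomorph.coe_neg, mem_Ioo] at this
    exact ⟨by linarith [this.2], by linarith [this.1]⟩

theorem IsWeakCurve.comp_neg (hu : IsWeakCurve ι s τ u g) :
    IsWeakCurve ι (-τ) (-s) (fun t => u (-t)) (fun t => - g (-t)) where
  memLp := hu.memLp.comp_measurePreserving (measurePreserving_neg_restrict_Ioo s τ)
  memLp_deriv := (hu.memLp_deriv.comp_measurePreserving (measurePreserving_neg_restrict_Ioo s τ)).neg
  weak_deriv φ hφ := by
    have hψ := hφ.comp_neg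
    have h1 := hu.weak_deriv _ hψ
    rw [hψ.deriv.setIntegral_smul, hψ.setIntegral_smul] at h1
    rw [hφ.deriv.setIntegral_smul, hφ.setIntegral_smul,
      ← integral_neg_eq_self (fun t => deriv φ t • gramOp ι (u (-t))),
      ← integral_neg_eq_self (fun t => φ t • - g (-t))]
    have h2 : ∀ t, deriv (fun t => φ (-t)) t = - deriv φ (-t) := fun t => deriv_comp_neg φ t
    simp only [h2, neg_smul, integral_neg, neg_inj] at h1
    simp only [neg_neg, smul_neg, integral_neg]
    exact h1

theorem IsContRepOn.comp_neg (hc : IsContRepOn ι s τ u c) :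
    IsContRepOn ι (-τ) (-s) (fun t => u (-t)) (fun t => c (-t)) where
  continuousOn := hc.continuousOn.comp continuousOn_neg fun t ht =>
    ⟨by linarith [ht.2], by linarith [ht.1]⟩
  ae_eq := (measurePreserving_neg_restrict_Ioo s τ).quasiMeasurePreserving.ae hc.ae_eq

theorem IsQuasiCoerciveFamily.comp_neg (hA : IsQuasiCoerciveFamily ι s τ α κ M A) :
    IsQuasiCoerciveFamily ι (-τ) (-s) α κ M (fun t => A (-t)) where
  aemeasurable v w := (hA.aemeasurable v w).comp_quasiMeasurePreserving
    (measurePreserving_neg_restrict_Ioo s τ).quasiMeasurePreserving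
  bound t ht := hA.bound _ ⟨by linarith [ht.2], by linarith [ht.1]⟩
  pos := hA.pos
  nonneg := hA.nonneg
  coercive t ht := hA.coercive _ ⟨by linarith [ht.2], by linarith [ht.1]⟩

/-- `u`, with continuous representative `c`, solves `u' = A u` on `(s, τ)`. -/
structure IsBackwardEvolution (ι : V →L[ℝ] H) (A : ℝ → V →L[ℝ] V) (s τ : ℝ) (u : ℝ → V)
    (c : ℝ → H) : Prop where
  isWeakCurve : IsWeakCurve ι s τ u (fun t => A t (u t))
  isContRepOn : IsContRepOn ι s τ u c

theorem IsBackwardEvolution.comp_neg (hu : IsBackwardEvolution ι A s τ u c) :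
    IsEvolution ι (fun t => A (-t)) (-τ) (-s) (fun t => u (-t)) (fun t => c (-t)) :=
  ⟨hu.1.comp_neg, hu.2.comp_neg⟩

theorem IsEvolution.comp_neg (hu : IsEvolution ι A s τ u c) :
    IsBackwardEvolution ι (fun t => A (-t)) (-τ) (-s) (fun t => u (-t)) (fun t => c (-t)) :=
  ⟨by simpa only [neg_neg] using hu.1.comp_neg, hu.2.comp_neg⟩

theorem IsBackwardEvolution.ae_eq (hA : IsQuasiCoerciveFamily ι s τ α κ M A) (hst : s < τ)
    (hι : Function.Injective ι) (hd : DenseRange ι) (hu : IsBackwardEvolution ι A s τ u c)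
    (hv : IsBackwardEvolution ι A s τ v d) (h : c τ = d τ) :
    u =ᵐ[volume.restrict (Ioo s τ)] v := by
  have h1 := hu.comp_neg.ae_eq hA.comp_neg (neg_lt_neg hst) hι hd hv.comp_neg (by simp [h])
  have h2 := measurePreserving_neg_restrict_Ioo (-τ) (-s)
  rw [neg_neg, neg_neg] at h2
  filter_upwards [h2.quasiMeasurePreserving.ae h1] with t ht
  simpa only [neg_neg] using ht

/-- The propagator of a backward nonautonomous evolution equation. -/
theorem IsQuasiCoerciveFamily.exists_backward_propagator
    [TopologicalSpace.SeparableSpace V] (hA : IsQuasiCoerciveFamily ι s τ α κ M A)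
    (hι : Function.Injective ι) (hd : DenseRange ι) :
    ∃ P : ℝ → ℝ → H →L[ℝ] H,
      (∀ t, P t t = ContinuousLinearMap.id ℝ H) ∧
      (∀ a b, s ≤ a → a < b → b ≤ τ → ∀ h,
        ∃ u, IsBackwardEvolution ι A a b u (fun t => P b t h)) ∧
      (∀ a b, s ≤ a → a < b → b ≤ τ → ∀ h u c, IsBackwardEvolution ι A a b u c → c b = h →
        EqOn c (fun t => P b t h) (Icc a b)) ∧
      (∀ r a t, s ≤ r → r ≤ a → a ≤ t → t ≤ τ → P t r = (P a r).comp (P t a)) := by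
  obtain ⟨Q, h1, h2, h3, h4⟩ := hA.comp_neg.exists_propagator hι hd
  -- Time reversal: the backward solution with final time `t` is a forward solution of the reversed
  -- family with initial time `-t`.
  refine ⟨fun t a => Q (-a) (-t), fun t => h1 _, fun a b ha hab hb h => ?_,
    fun a b ha hab hb h u c hu hc t ht => ?_, fun r a t hr hra hat ht => ?_⟩
  · obtain ⟨u, hu⟩ := h2 (-b) (-a) (by linarith) (by linarith) (by linarith) h
    have := hu.comp_neg
    simp only [neg_neg] at this
    exact ⟨_, this⟩
  · have := h3 (-b) (-a) (by linarith) (by linarith) (by linarith) h _ _ hu.comp_neg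
      (by simpa using hc) (show -t ∈ _ from ⟨by linarith [ht.2], by linarith [ht.1]⟩)
    simpa only [neg_neg] using this
  · exact h4 (-t) (-a) (-r) (by linarith) (by linarith) (by linarith) (by linarith)

end Propagators

/-! ### Strong convergence from weak convergence and a norm bound -/

section HilbertConvergence

variable {V : Type*} [NormedAddCommGroup V] [InnerProductSpace ℝ V]

local notation "⟪" x ", " y "⟫" => inner ℝ x y

/-- The norm bound extends weak convergence from the dense family to `u` itself, and then `‖w n -
u‖² ≤ 2 ‖u‖² - 2 ⟪w n, u⟫` tends to zero. -/
theorem tendsto_of_norm_le_of_tendsto_inner {w : ℕ → V} {u : V} {Y : Type*} {y : Y → V}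
    (hy : DenseRange y) (hn : ∀ n, ‖w n‖ ≤ ‖u‖)
    (hw : ∀ k, Tendsto (fun n => ⟪w n, y k⟫) atTop (𝓝 ⟪u, y k⟫)) :
    Tendsto w atTop (𝓝 u) := by
  have hinner : Tendsto (fun n => ⟪w n, u⟫) atTop (𝓝 ⟪u, u⟫) := by
    rw [Metric.tendsto_atTop]
    intro ε hε
    obtain ⟨k, hk⟩ := hy.exists_dist_lt u (show 0 < ε / (4 * (‖u‖ + 1)) by positivity)
    rw [dist_eq_norm] at hk
    obtain ⟨N, hN⟩ := Metric.tendsto_atTop.1 (hw k) (ε / 2) (by positivity)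
    refine ⟨N, fun n hn' => ?_⟩
    have h1 := hN n hn'
    rw [Real.dist_eq] at h1 ⊢
    have h2 : ⟪w n, u⟫ - ⟪u, u⟫ = (⟪w n, y k⟫ - ⟪u, y k⟫) +
        (⟪w n, u - y k⟫ - ⟪u, u - y k⟫) := by
      simp only [inner_sub_right]; ring
    have h3 : (‖u‖ + 1) * (ε / (4 * (‖u‖ + 1))) = ε / 4 := by field_simp
    have h4 : ∀ z : V, ‖z‖ ≤ ‖u‖ → |⟪z, u - y k⟫| ≤ ε / 4 := fun z hz => by
      rw [← h3]
      exact (abs_real_inner_le_norm _ _).trans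
        (mul_le_mul (by linarith) hk.le (norm_nonneg _) (by positivity))
    rw [h2]
    calc _ ≤ _ := abs_add_le _ _
      _ ≤ |⟪w n, y k⟫ - ⟪u, y k⟫| + (ε / 4 + ε / 4) :=
        add_le_add_right ((abs_sub _ _).trans (add_le_add (h4 _ (hn n)) (h4 _ le_rfl))) _
      _ < ε := by linarith
  have hsq : Tendsto (fun n => ‖w n - u‖ ^ 2) atTop (𝓝 0) := by
    have h1 : Tendsto (fun n => 2 * ‖u‖ ^ 2 - 2 * ⟪w n, u⟫) atTop
        (𝓝 (2 * ‖u‖ ^ 2 - 2 * ⟪u, u⟫)) := (hinner.const_mul 2).const_sub _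
    rw [real_inner_self_eq_norm_sq, sub_self] at h1
    refine squeeze_zero (fun n => by positivity) (fun n => ?_) h1
    rw [norm_sub_sq_real]
    have := pow_le_pow_left₀ (norm_nonneg _) (hn n) 2
    linarith
  have h3 := hsq.sqrt
  simp only [Real.sqrt_sq (norm_nonneg _), Real.sqrt_zero] at h3
  exact tendsto_iff_norm_sub_tendsto_zero.2 h3

end HilbertConvergence

/-! ### Multiplication operators on `L²` -/

section MulOperator

variable {X : Type*} [MeasurableSpace X] {m : Measure X}

/-- Multiplication by a bounded measurable function as an operator on `L²`. -/
theorem exists_mul_clm {b : X → ℝ} {B : ℝ} (hb : AEStronglyMeasurable b m)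
    (hB : ∀ᵐ x ∂m, |b x| ≤ B) :
    ∃ Q : Lp ℝ 2 m →L[ℝ] Lp ℝ 2 m, (∀ u, ∀ᵐ x ∂m, Q u x = b x * u x) ∧ ∀ u, ‖Q u‖ ≤ B * ‖u‖ := by
  have hbL : MemLp b ∞ m := memLp_top_of_bound hb B hB
  let β : Lp ℝ ∞ m := hbL.toLp b
  have hβ : ∀ u : Lp ℝ 2 m, ∀ᵐ x ∂m, (β • u : Lp ℝ 2 m) x = b x * u x := fun u => by
    filter_upwards [Lp.coeFn_lpSMul (r := 2) β u, hbL.coeFn_toLp] with x h1 h2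
    rw [h1, Pi.smul_apply', h2, smul_eq_mul]
  have hn : ∀ u : Lp ℝ 2 m, ‖(β • u : Lp ℝ 2 m)‖ ≤ B * ‖u‖ := fun u => by
    refine Lp.norm_le_mul_norm_of_ae_le_mul ?_
    filter_upwards [hβ u, hB] with x h1 h2
    rw [h1, Real.norm_eq_abs, abs_mul]
    exact mul_le_mul_of_nonneg_right h2 (abs_nonneg _)
  let Q : Lp ℝ 2 m →ₗ[ℝ] Lp ℝ 2 m :=
    { toFun := fun u => (β • u : Lp ℝ 2 m)
      map_add' := fun u v => Lp.add_smul _ _ _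
      map_smul' := fun a u => (Lp.smul_comm a β u).symm }
  exact ⟨Q.mkContinuous B hn, hβ, hn⟩

theorem inner_Lp_eq_integral (u v : Lp ℝ 2 m) : inner ℝ u v = ∫ x, u x * v x ∂m := by
  rw [L2.inner_def]
  exact integral_congr_ae (Filter.Eventually.of_forall fun x => mul_comm _ _)

theorem integrable_mul_Lp (u v : Lp ℝ 2 m) : Integrable (fun x => u x * v x) m :=
  (Lp.memLp u).integrable_mul (Lp.memLp v)

end MulOperator

/-! ### Truncation, products and exponentials in the form domain -/

namespace DirichletForm

variable {X : Type*} [MeasurableSpace X] {m : Measure X} {E : DirichletForm m}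

theorem toL2_injective : Function.Injective E.toL2 := Subtype.val_injective

theorem eq_of_ae_eq {u v : E.Dom} (h : ∀ᵐ x ∂m, E.toL2 u x = E.toL2 v x) : u = v :=
  toL2_injective (Lp.ext h)

theorem denseRange_toL2 : DenseRange E.toL2 := by
  have : range E.toL2 = (E.domain : Set (Lp ℝ 2 m)) := Subtype.range_coe
  rw [DenseRange, this]
  exact E.dense_domain

theorem norm_sq_eq (u : E.Dom) : ‖u‖ ^ 2 = E.energy u u + ‖E.toL2 u‖ ^ 2 := E.norm_sq_def u

theorem energy_self_nonneg (u : E.Dom) : 0 ≤ E.energy u u := E.nonneg u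

theorem energy_self_le (u : E.Dom) : E.energy u u ≤ ‖u‖ ^ 2 := by
  rw [norm_sq_eq]; linarith [sq_nonneg ‖E.toL2 u‖]

theorem norm_toL2_le (u : E.Dom) : ‖E.toL2 u‖ ≤ ‖u‖ :=
  le_of_sq_le_sq (by rw [norm_sq_eq]; linarith [energy_self_nonneg u]) (norm_nonneg _)

theorem toL2_sub_ae (u v : E.Dom) :
    ∀ᵐ x ∂m, E.toL2 (u - v) x = E.toL2 u x - E.toL2 v x := by
  rw [map_sub]; exact Lp.coeFn_sub _ _

theorem toL2_add_ae (u v : E.Dom) :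
    ∀ᵐ x ∂m, E.toL2 (u + v) x = E.toL2 u x + E.toL2 v x := by
  rw [map_add]; exact Lp.coeFn_add _ _

theorem toL2_smul_ae (a : ℝ) (u : E.Dom) :
    ∀ᵐ x ∂m, E.toL2 (a • u) x = a * E.toL2 u x := by
  rw [map_smul]; exact Lp.coeFn_smul _ _

theorem exists_normal_contraction {ξ : ℝ → ℝ} (hξ : LipschitzWith 1 ξ) (h0 : ξ 0 = 0)
    (u : E.Dom) : ∃ w : E.Dom, (∀ᵐ x ∂m, E.toL2 w x = ξ (E.toL2 u x)) ∧
      E.energy w w ≤ E.energy u u := by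
  obtain ⟨h, hle⟩ := E.markov ξ hξ h0 u
  exact ⟨⟨_, h⟩, hξ.coeFn_compLp h0 _, hle⟩

theorem exists_lipschitz_comp {ξ : ℝ → ℝ} {K : ℝ} (hξ : ∀ x y, |ξ x - ξ y| ≤ K * |x - y|)
    (hK : 0 < K) (h0 : ξ 0 = 0) (u : E.Dom) :
    ∃ w : E.Dom, ∀ᵐ x ∂m, E.toL2 w x = ξ (E.toL2 u x) := by
  have h1 : LipschitzWith 1 fun x => K⁻¹ * ξ x := by
    refine LipschitzWith.of_dist_le_mul fun x y => ?_
    rw [Real.dist_eq, Real.dist_eq, ← mul_sub, abs_mul, abs_of_pos (inv_pos.2 hK),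
      NNReal.coe_one, one_mul, inv_mul_le_iff₀ hK]
    exact hξ x y
  obtain ⟨w, hw, -⟩ := exists_normal_contraction h1 (by simp [h0]) u
  refine ⟨K • w, ?_⟩
  filter_upwards [toL2_smul_ae K w, hw] with x h2 h3
  rw [h2, h3, mul_inv_cancel_left₀ hK.ne']

theorem abs_clamp_le {M : ℝ} (hM : 0 ≤ M) (x : ℝ) : |max (-M) (min x M)| ≤ M :=
  abs_le.2 ⟨le_max_left _ _, max_le (by linarith) (min_le_right _ _)⟩

theorem clamp_of_abs_le {M x : ℝ} (h : |x| ≤ M) : max (-M) (min x M) = x := by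
  rw [min_eq_left (abs_le.1 h).2, max_eq_right (abs_le.1 h).1]

theorem abs_clamp_sub_clamp_le (M x y : ℝ) :
    |max (-M) (min x M) - max (-M) (min y M)| ≤ |x - y| := by
  refine (abs_max_sub_max_le_max _ _ _ _).trans ?_
  rw [sub_self, abs_zero, max_eq_right (abs_nonneg _)]
  refine (abs_min_sub_min_le_max _ _ _ _).trans ?_
  rw [sub_self, abs_zero, max_eq_left (abs_nonneg _)]

theorem abs_clamp_le_abs {M : ℝ} (hM : 0 ≤ M) (x : ℝ) : |max (-M) (min x M)| ≤ |x| := by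
  have h := abs_clamp_sub_clamp_le M x 0
  rwa [clamp_of_abs_le (x := 0) (by simpa using hM), sub_zero, sub_zero] at h

theorem tendsto_clamp (x : ℝ) :
    Tendsto (fun n : ℕ => max (-(n : ℝ)) (min x n)) atTop (𝓝 x) := by
  obtain ⟨N, hN⟩ := exists_nat_ge |x|
  refine tendsto_const_nhds.congr' ?_
  filter_upwards [eventually_ge_atTop N] with n hn
  exact (clamp_of_abs_le (hN.trans (by exact_mod_cast hn))).symm

/-- Truncations at level `n` have no larger form norm than `u`. Tested against the dense vectors
`ι†ι k`, they converge because that inner product only sees `L²`. Hence they converge strongly in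
the form domain. -/
theorem exists_bdd_seq_tendsto (u : E.Dom) :
    ∃ w : ℕ → E.Dom, (∀ n, E.IsBdd (w n)) ∧ Tendsto w atTop (𝓝 u) := by
  have hex := fun n : ℕ => exists_normal_contraction (E := E) (ξ := fun x => max (-(n : ℝ)) (min x n))
    (LipschitzWith.of_dist_le_mul fun x y => by
      rw [Real.dist_eq, Real.dist_eq, NNReal.coe_one, one_mul]
      exact abs_clamp_sub_clamp_le _ _ _) (clamp_of_abs_le (by simp)) u
  choose w hw hle using hex
  refine ⟨w, fun n => ⟨n, ?_⟩, ?_⟩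
  · filter_upwards [hw n] with x hx
    rw [hx]; exact abs_clamp_le n.cast_nonneg _
  refine tendsto_of_norm_le_of_tendsto_inner (denseRange_gramOp E.toL2 toL2_injective)
    (fun n => ?_) fun k => ?_
  · refine le_of_sq_le_sq ?_ (norm_nonneg _)
    rw [norm_sq_eq, norm_sq_eq]
    refine add_le_add (hle n) (pow_le_pow_left₀ (norm_nonneg _) (Lp.norm_le_norm_of_ae_le ?_) 2)
    filter_upwards [hw n] with x hx
    rw [hx]; exact abs_clamp_le_abs n.cast_nonneg _
  · simp only [inner_gramOp_right, inner_Lp_eq_integral]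
    refine tendsto_integral_of_dominated_convergence (fun x => |E.toL2 u x| * |E.toL2 k x|)
      (fun n => (integrable_mul_Lp _ _).1) ?_ (fun n => ?_) ?_
    · exact (integrable_mul_Lp _ _).abs.congr (Filter.Eventually.of_forall fun x => abs_mul _ _)
    · filter_upwards [hw n] with x hx
      rw [hx, Real.norm_eq_abs, abs_mul]
      exact mul_le_mul_of_nonneg_right (abs_clamp_le_abs n.cast_nonneg _) (abs_nonneg _)
    · filter_upwards [ae_all_iff.2 hw] with x hx
      simp only [hx]
      exact (tendsto_clamp _).mul_const _

theorem IsBdd.add {u v : E.Dom} (hu : E.IsBdd u) (hv : E.IsBdd v) : E.IsBdd (u + v) := by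
  obtain ⟨C, hC⟩ := hu
  obtain ⟨D, hD⟩ := hv
  refine ⟨C + D, ?_⟩
  filter_upwards [toL2_add_ae u v, hC, hD] with x h1 h2 h3
  rw [h1]; exact (abs_add_le _ _).trans (add_le_add h2 h3)

theorem IsBdd.sub {u v : E.Dom} (hu : E.IsBdd u) (hv : E.IsBdd v) : E.IsBdd (u - v) := by
  obtain ⟨C, hC⟩ := hu
  obtain ⟨D, hD⟩ := hv
  refine ⟨C + D, ?_⟩
  filter_upwards [toL2_sub_ae u v, hC, hD] with x h1 h2 h3
  rw [h1]; exact (abs_sub _ _).trans (add_le_add h2 h3)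

/-- Truncated beyond the bound of `u`, the square is Lipschitz and vanishes at zero, so a multiple
of it is a normal contraction. -/
theorem exists_sq {u : E.Dom} (hu : E.IsBdd u) :
    ∃ w : E.Dom, ∀ᵐ x ∂m, E.toL2 w x = E.toL2 u x ^ 2 := by
  obtain ⟨C, hC⟩ := hu
  set M := |C| + 1
  have hM : 0 < M := by positivity
  obtain ⟨w, hw⟩ := exists_lipschitz_comp (ξ := fun x => (max (-M) (min x M)) ^ 2) (K := 2 * M)
    (fun x y => by
      rw [sq_sub_sq, abs_mul]
      refine mul_le_mul ((abs_add_le _ _).trans ?_) (abs_clamp_sub_clamp_le _ _ _) (abs_nonneg _)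
        (by positivity)
      linarith [abs_clamp_le hM.le x, abs_clamp_le hM.le y]) (by positivity)
    (by simp [clamp_of_abs_le (M := M) (x := 0) (by simpa using hM.le)]) u
  refine ⟨w, ?_⟩
  filter_upwards [hw, hC] with x h1 h2
  rw [h1, clamp_of_abs_le (h2.trans ((le_abs_self C).trans (le_add_of_nonneg_right zero_le_one)))]

theorem exists_mul {u v : E.Dom} (hu : E.IsBdd u) (hv : E.IsBdd v) :
    ∃ w : E.Dom, ∀ᵐ x ∂m, E.toL2 w x = E.toL2 u x * E.toL2 v x := by
  obtain ⟨p, hp⟩ := exists_sq (hu.add hv)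
  obtain ⟨q, hq⟩ := exists_sq (hu.sub hv)
  refine ⟨(4⁻¹ : ℝ) • (p - q), ?_⟩
  filter_upwards [toL2_smul_ae 4⁻¹ (p - q), toL2_sub_ae p q, hp, hq, toL2_add_ae u v,
    toL2_sub_ae u v] with x h1 h2 h3 h4 h5 h6
  rw [h1, h2, h3, h4, h5, h6]; ring

/-- Since constants need not lie in the domain, neither need `e^{-w₀}`; but `e^{-w₀} - 1` does, as a
Lipschitz function of `w₀` vanishing at zero. Then `u e^{-w₀} = u + u (e^{-w₀} - 1)`. -/
theorem exists_mul_exp_neg {u w₀ : E.Dom} (hu : E.IsBdd u) (hw₀ : E.IsBdd w₀) :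
    ∃ w : E.Dom, ∀ᵐ x ∂m, E.toL2 w x = E.toL2 u x * Real.exp (-E.toL2 w₀ x) := by
  obtain ⟨C, hC⟩ := hw₀
  set M := |C| + 1
  have hM : 0 < M := by positivity
  have hexp : ∀ a b, |a| ≤ M → |b| ≤ M → |Real.exp (-a) - Real.exp (-b)| ≤ Real.exp M * |a - b| := by
    have key : ∀ a b, |b| ≤ M → a ≤ b → |Real.exp (-a) - Real.exp (-b)| ≤ Real.exp (-a) * |a - b| := by
      intro a b _ hab
      rw [abs_of_nonneg (sub_nonneg.2 (Real.exp_le_exp.2 (neg_le_neg hab))),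
        abs_of_nonpos (sub_nonpos.2 hab)]
      have h1 := Real.add_one_le_exp (a - b)
      have h2 : Real.exp (-b) = Real.exp (-a) * Real.exp (a - b) := by
        rw [← Real.exp_add]; congr 1; ring
      rw [h2]
      nlinarith [Real.exp_pos (-a)]
    have hle : ∀ a, |a| ≤ M → Real.exp (-a) ≤ Real.exp M := fun a ha =>
      Real.exp_le_exp.2 (by linarith [(abs_le.1 ha).1])
    intro a b ha hb
    rcases le_total a b with hab | hab
    · exact (key a b hb hab).trans (mul_le_mul_of_nonneg_right (hle a ha) (abs_nonneg _))
    · rw [abs_sub_comm, abs_sub_comm a b]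
      exact (key b a ha hab).trans (mul_le_mul_of_nonneg_right (hle b hb) (abs_nonneg _))
  obtain ⟨e, he⟩ := exists_lipschitz_comp (ξ := fun x => Real.exp (-(max (-M) (min x M))) - 1)
    (K := Real.exp M) (fun x y => by
      rw [sub_sub_sub_cancel_right]
      exact (hexp _ _ (abs_clamp_le hM.le _) (abs_clamp_le hM.le _)).trans
        (mul_le_mul_of_nonneg_left (abs_clamp_sub_clamp_le _ _ _) (Real.exp_pos _).le))
    (Real.exp_pos _) (by simp [clamp_of_abs_le (M := M) (x := 0) (by simpa using hM.le)]) w₀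
  have he' : ∀ᵐ x ∂m, E.toL2 e x = Real.exp (-E.toL2 w₀ x) - 1 := by
    filter_upwards [he, hC] with x h1 h2
    rw [h1, clamp_of_abs_le (h2.trans ((le_abs_self C).trans (le_add_of_nonneg_right zero_le_one)))]
  have heb : E.IsBdd e := by
    refine ⟨Real.exp M + 1, ?_⟩
    filter_upwards [he] with x h1
    rw [h1]
    refine (abs_sub _ _).trans ?_
    rw [abs_one, Real.abs_exp]
    have := Real.exp_le_exp.2 (neg_le_of_neg_le (abs_le.1 (abs_clamp_le hM.le (E.toL2 w₀ x))).1)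
    linarith
  obtain ⟨p, hp⟩ := exists_mul hu heb
  refine ⟨u + p, ?_⟩
  filter_upwards [toL2_add_ae u p, hp, he'] with x h1 h2 h3
  rw [h1, h2, h3]; ring

end DirichletForm

/-! ### Elliptic square fields with a weight: boundedness and coercivity -/

namespace DirichletForm

variable {X : Type*} [MeasurableSpace X] {m : Measure X} {E : DirichletForm m}

local notation "⟪" x ", " y "⟫" => inner ℝ x y

/-- A symmetric, positive semidefinite, uniformly elliptic square field with the diffusion
property. -/
structure IsEllipticField (E : DirichletForm m) (Γ₀ Γ : E.FieldForm) (C : ℝ) : Prop where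
  energy_eq : ∀ u v, E.energy u v = ∫ x, Γ₀ u v x ∂m
  symm : ∀ u v, Γ u v = Γ v u
  nonneg : ∀ u, ∀ᵐ x ∂m, 0 ≤ Γ u u x
  diffusion : E.HasDiffusionProperty Γ
  pos : 0 < C
  elliptic : ∀ u, ∀ᵐ x ∂m, 1 / C * Γ₀ u u x ≤ Γ u u x ∧ Γ u u x ≤ C * Γ₀ u u x

/-- A bounded weight `g` in the form domain, represented there by `w₀`, with bounded gradient. -/
structure IsWeight (E : DirichletForm m) (Γ₀ : E.FieldForm) (g : X → ℝ) (w₀ : E.Dom) (B D : ℝ) :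
    Prop where
  measurable : Measurable g
  ae_eq : ∀ᵐ x ∂m, E.toL2 w₀ x = g x
  bound : ∀ x, |g x| ≤ B
  grad : ∀ᵐ x ∂m, Γ₀ w₀ w₀ x ≤ D
  nonneg : 0 ≤ B
  grad_nonneg : 0 ≤ D

section FieldForms

variable {Γ : E.FieldForm}

theorem field_add_left_ae (u v w : E.Dom) :
    ∀ᵐ x ∂m, Γ (u + v) w x = Γ u w x + Γ v w x := by
  rw [map_add, LinearMap.add_apply]; exact Lp.coeFn_add _ _

theorem field_smul_left_ae (a : ℝ) (u w : E.Dom) : ∀ᵐ x ∂m, Γ (a • u) w x = a * Γ u w x := by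
  rw [map_smul, LinearMap.smul_apply]; exact Lp.coeFn_smul _ _

theorem field_add_right_ae (u v w : E.Dom) :
    ∀ᵐ x ∂m, Γ w (u + v) x = Γ w u x + Γ w v x := by
  rw [map_add]; exact Lp.coeFn_add _ _

theorem field_smul_right_ae (a : ℝ) (u w : E.Dom) : ∀ᵐ x ∂m, Γ w (a • u) x = a * Γ w u x := by
  rw [map_smul]; exact Lp.coeFn_smul _ _

theorem integrable_field (u v : E.Dom) : Integrable (Γ u v) m := L1.integrable_coeFn _

/-- Positivity of `Γ(u + c v)` holds off a null set that depends on `c`. Rational `c` and continuity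
in `c` give a single null set, so that `c` may afterwards depend on the point, as in `c = u(x)`. -/
theorem ae_forall_field_quadratic_nonneg (hs : ∀ u v, Γ u v = Γ v u)
    (hn : ∀ u, ∀ᵐ x ∂m, 0 ≤ Γ u u x) (u v : E.Dom) :
    ∀ᵐ x ∂m, ∀ c : ℝ, 0 ≤ Γ u u x + 2 * c * Γ u v x + c ^ 2 * Γ v v x := by
  have h1 : ∀ᵐ x ∂m, ∀ q : ℚ, 0 ≤ Γ u u x + 2 * (q : ℝ) * Γ u v x + (q : ℝ) ^ 2 * Γ v v x := by
    rw [ae_all_iff]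
    intro q
    filter_upwards [hn (u + (q : ℝ) • v), field_add_left_ae (Γ := Γ) u ((q : ℝ) • v) (u + (q : ℝ) • v),
      field_smul_left_ae (Γ := Γ) (q : ℝ) v (u + (q : ℝ) • v),
      field_add_right_ae (Γ := Γ) u ((q : ℝ) • v) u, field_smul_right_ae (Γ := Γ) (q : ℝ) v u,
      field_add_right_ae (Γ := Γ) u ((q : ℝ) • v) v, field_smul_right_ae (Γ := Γ) (q : ℝ) v v]
      with x h0 h1 h2 h3 h4 h5 h6
    rw [h1, h2, h3, h4, h5, h6, hs v u] at h0
    linarith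
  filter_upwards [h1] with x hx c
  have hcl : IsClosed {c : ℝ | 0 ≤ Γ u u x + 2 * c * Γ u v x + c ^ 2 * Γ v v x} :=
    isClosed_le continuous_const (by fun_prop)
  exact Rat.denseRange_cast.induction_on
    (p := fun c : ℝ => 0 ≤ Γ u u x + 2 * c * Γ u v x + c ^ 2 * Γ v v x) c hcl hx

end FieldForms

variable {Γ₀ Γ : E.FieldForm} {C B D : ℝ} {g : X → ℝ} {w₀ : E.Dom}

theorem IsWeight.isBdd (hg : IsWeight E Γ₀ g w₀ B D) : E.IsBdd w₀ :=
  ⟨B, by filter_upwards [hg.ae_eq] with x hx; rw [hx]; exact hg.bound x⟩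

theorem IsWeight.neg (hg : IsWeight E Γ₀ g w₀ B D) : IsWeight E Γ₀ (fun x => - g x) (-w₀) B D where
  measurable := hg.measurable.neg
  ae_eq := by
    have h : ∀ᵐ x ∂m, E.toL2 (-w₀) x = - E.toL2 w₀ x := by
      rw [map_neg]; exact Lp.coeFn_neg _
    filter_upwards [hg.ae_eq, h] with x h1 h2
    rw [h2, h1]
  bound x := by rw [abs_neg]; exact hg.bound x
  grad := by
    have : Γ₀ (-w₀) (-w₀) = Γ₀ w₀ w₀ := by simp
    rw [this]; exact hg.grad
  nonneg := hg.nonneg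
  grad_nonneg := hg.grad_nonneg

theorem IsWeight.exp_neg_le (hg : IsWeight E Γ₀ g w₀ B D) (x : X) :
    Real.exp (-g x) ≤ Real.exp B :=
  Real.exp_le_exp.2 (neg_le_of_neg_le (abs_le.1 (hg.bound x)).1)

/-- The chain rule for `Ψ(a, b) = a e^{-b}`, which vanishes at the origin. -/
theorem IsEllipticField.diffusion_mul_exp (hΓ : IsEllipticField E Γ₀ Γ C) {u w v : E.Dom}
    (hu : E.IsBdd u) (hw₀ : E.IsBdd w₀) (hv : E.IsBdd v)
    (hw : ∀ᵐ x ∂m, E.toL2 w x = E.toL2 u x * Real.exp (-E.toL2 w₀ x)) :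
    ∀ᵐ x ∂m, Γ w v x = Real.exp (-E.toL2 w₀ x) * (Γ u v x - E.toL2 u x * Γ w₀ v x) := by
  have hΨ : ∀ a : Fin 2 → ℝ, HasFDerivAt (fun a : Fin 2 → ℝ => a 0 * Real.exp (-a 1))
      (a 0 • (Real.exp (-a 1) • -(ContinuousLinearMap.proj 1 : (Fin 2 → ℝ) →L[ℝ] ℝ)) +
        Real.exp (-a 1) • (ContinuousLinearMap.proj 0 : (Fin 2 → ℝ) →L[ℝ] ℝ)) a := fun a =>
    (hasFDerivAt_apply 0 a).mul ((hasFDerivAt_apply 1 a).neg.exp)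
  have h := hΓ.diffusion 2 ![u, w₀] v (fun a => a 0 * Real.exp (-a 1)) w
    (fun i => by fin_cases i <;> assumption) hv (by fun_prop) (by simp) (by simpa using hw)
  filter_upwards [h] with x hx
  rw [hx, Fin.sum_univ_two, (hΨ _).fderiv]
  simp
  ring

theorem IsEllipticField.energy_le (hΓ : IsEllipticField E Γ₀ Γ C) (u : E.Dom) :
    E.energy u u ≤ C * ∫ x, Γ u u x ∂m := by
  rw [hΓ.energy_eq, ← integral_const_mul]
  refine integral_mono_ae (integrable_field _ _) ((integrable_field _ _).const_mul _) ?_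
  filter_upwards [hΓ.elliptic u] with x hx
  have := hx.1
  rwa [one_div, inv_mul_le_iff₀ hΓ.pos] at this

theorem IsEllipticField.integral_le (hΓ : IsEllipticField E Γ₀ Γ C) (u : E.Dom) :
    ∫ x, Γ u u x ∂m ≤ C * E.energy u u := by
  rw [hΓ.energy_eq, ← integral_const_mul]
  refine integral_mono_ae (integrable_field _ _) ((integrable_field _ _).const_mul _) ?_
  filter_upwards [hΓ.elliptic u] with x hx using hx.2

theorem IsEllipticField.grad_le (hΓ : IsEllipticField E Γ₀ Γ C) (hg : IsWeight E Γ₀ g w₀ B D) :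
    ∀ᵐ x ∂m, Γ w₀ w₀ x ≤ C * D := by
  filter_upwards [hΓ.elliptic w₀, hg.grad] with x h1 h2
  exact h1.2.trans (mul_le_mul_of_nonneg_left h2 hΓ.pos.le)

theorem integral_sq_toL2 (u : E.Dom) : ∫ x, E.toL2 u x ^ 2 ∂m = ‖E.toL2 u‖ ^ 2 := by
  rw [← real_inner_self_eq_norm_sq, inner_Lp_eq_integral]
  simp only [sq]

theorem integrable_sq_toL2 (u : E.Dom) : Integrable (fun x => E.toL2 u x ^ 2) m := by
  simpa only [sq] using integrable_mul_Lp (E.toL2 u) (E.toL2 u)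

/-- A bound for the norm of the multiplication by `e^{-g}` on the form domain. -/
noncomputable def weightBound (C B D : ℝ) : ℝ :=
  √(2 * C * Real.exp (2 * B) * (C + C * D) + Real.exp (2 * B))

/-- The chain rule in both slots gives `Γ(u e^{-g}) = e^{-2g} (Γ(u) - 2u Γ(u, g) + u² Γ(g))`.
Absorbing the mixed term and using `Γ(g) ≤ C D` bounds this by `2 e^{2B} (Γ(u) + C D u²)`.
Ellipticity converts the integral into the form norm. -/
theorem IsEllipticField.exists_mul_exp_neg_bdd (hΓ : IsEllipticField E Γ₀ Γ C)
    (hg : IsWeight E Γ₀ g w₀ B D) {u : E.Dom} (hu : E.IsBdd u) :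
    ∃ w : E.Dom, (∀ᵐ x ∂m, E.toL2 w x = E.toL2 u x * Real.exp (-g x)) ∧ E.IsBdd w ∧
      ‖w‖ ≤ weightBound C B D * ‖u‖ := by
  obtain ⟨w, hw⟩ := exists_mul_exp_neg hu hg.isBdd
  have hC := hΓ.pos
  have hD := hg.grad_nonneg
  have hwg : ∀ᵐ x ∂m, E.toL2 w x = E.toL2 u x * Real.exp (-g x) := by
    filter_upwards [hw, hg.ae_eq] with x h1 h2
    rw [h1, h2]
  have hwle : ∀ᵐ x ∂m, ‖E.toL2 w x‖ ≤ Real.exp B * ‖E.toL2 u x‖ := by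
    filter_upwards [hwg] with x h1
    rw [h1, norm_mul, mul_comm, Real.norm_eq_abs (Real.exp _), Real.abs_exp]
    exact mul_le_mul_of_nonneg_right (hg.exp_neg_le x) (norm_nonneg _)
  have hwb : E.IsBdd w := by
    obtain ⟨M, hM⟩ := hu
    refine ⟨Real.exp B * M, ?_⟩
    filter_upwards [hM, hwle] with x h1 h2
    exact h2.trans (mul_le_mul_of_nonneg_left h1 (Real.exp_pos _).le)
  refine ⟨w, hwg, hwb, ?_⟩
  have hpt : ∀ᵐ x ∂m, Γ w w x ≤ 2 * Real.exp (2 * B) * (Γ u u x + C * D * E.toL2 u x ^ 2) := by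
    -- Testing with `w`, `u` and `w₀` in turn, together with symmetry, expands both slots of `Γ w
    -- w`.
    filter_upwards [hΓ.diffusion_mul_exp hu hg.isBdd hwb hw, hΓ.diffusion_mul_exp hu hg.isBdd hu hw,
      hΓ.diffusion_mul_exp hu hg.isBdd hg.isBdd hw, hg.ae_eq, hΓ.grad_le hg, hΓ.nonneg u,
      ae_forall_field_quadratic_nonneg hΓ.symm hΓ.nonneg u w₀] with x h1 h2 h3 h4 h5 h6 h7
    have h8 := h7 (E.toL2 u x)
    rw [hΓ.symm u w, hΓ.symm w₀ w, h2, h3, hΓ.symm w₀ u] at h1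
    set e := Real.exp (-E.toL2 w₀ x) with he
    have he0 : 0 < e := Real.exp_pos _
    have heB : e ^ 2 ≤ Real.exp (2 * B) := by
      rw [he, h4, two_mul, Real.exp_add, sq]
      exact mul_le_mul (hg.exp_neg_le x) (hg.exp_neg_le x) (Real.exp_pos _).le (Real.exp_pos _).le
    have h9 : Γ w w x = e ^ 2 * (Γ u u x - 2 * E.toL2 u x * Γ u w₀ x +
        E.toL2 u x ^ 2 * Γ w₀ w₀ x) := by rw [h1]; ring
    have h10 : E.toL2 u x ^ 2 * Γ w₀ w₀ x ≤ E.toL2 u x ^ 2 * (C * D) :=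
      mul_le_mul_of_nonneg_left h5 (sq_nonneg _)
    have h11 : 0 ≤ Γ u u x + C * D * E.toL2 u x ^ 2 := by positivity
    rw [h9]
    calc _ ≤ e ^ 2 * (2 * (Γ u u x + C * D * E.toL2 u x ^ 2)) :=
          mul_le_mul_of_nonneg_left (by linarith) (sq_nonneg _)
      _ ≤ Real.exp (2 * B) * (2 * (Γ u u x + C * D * E.toL2 u x ^ 2)) :=
          mul_le_mul_of_nonneg_right heB (by positivity)
      _ = _ := by ring
  have hint : ∫ x, Γ w w x ∂m ≤ 2 * Real.exp (2 * B) * (C * E.energy u u + C * D * ‖E.toL2 u‖ ^ 2) := by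
    refine (integral_mono_ae (integrable_field _ _) (((integrable_field _ _).add
      ((integrable_sq_toL2 u).const_mul _)).const_mul _) hpt).trans ?_
    rw [integral_const_mul, integral_add' (integrable_field _ _)
      ((integrable_sq_toL2 u).const_mul _), integral_const_mul, integral_sq_toL2]
    refine mul_le_mul_of_nonneg_left (add_le_add_left (hΓ.integral_le u) _) (by positivity)
  have hL2 : ‖E.toL2 w‖ ^ 2 ≤ Real.exp (2 * B) * ‖E.toL2 u‖ ^ 2 := by
    have h1 := pow_le_pow_left₀ (norm_nonneg _) (Lp.norm_le_mul_norm_of_ae_le_mul hwle) 2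
    rwa [mul_pow, ← Real.exp_nat_mul, Nat.cast_two] at h1
  refine le_of_sq_le_sq ?_ (mul_nonneg (Real.sqrt_nonneg _) (norm_nonneg _))
  rw [mul_pow, weightBound, Real.sq_sqrt (by positivity)]
  have h1 : E.energy w w ≤ C * (2 * Real.exp (2 * B) *
      (C * E.energy u u + C * D * ‖E.toL2 u‖ ^ 2)) :=
    (hΓ.energy_le w).trans (mul_le_mul_of_nonneg_left hint hC.le)
  have h2 := energy_self_nonneg u
  have h3 : C * E.energy u u + C * D * ‖E.toL2 u‖ ^ 2 ≤ (C + C * D) * ‖u‖ ^ 2 := by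
    have h4 : C * E.energy u u ≤ C * ‖u‖ ^ 2 := mul_le_mul_of_nonneg_left (energy_self_le u) hC.le
    have h5 : C * D * ‖E.toL2 u‖ ^ 2 ≤ C * D * ‖u‖ ^ 2 :=
      mul_le_mul_of_nonneg_left (pow_le_pow_left₀ (norm_nonneg _) (norm_toL2_le u) 2) (by positivity)
    linarith
  have h6 : Real.exp (2 * B) * ‖E.toL2 u‖ ^ 2 ≤ Real.exp (2 * B) * ‖u‖ ^ 2 :=
    mul_le_mul_of_nonneg_left (pow_le_pow_left₀ (norm_nonneg _) (norm_toL2_le u) 2)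
      (Real.exp_pos _).le
  have h7 : C * (2 * Real.exp (2 * B) * (C * E.energy u u + C * D * ‖E.toL2 u‖ ^ 2)) ≤
      C * (2 * Real.exp (2 * B) * ((C + C * D) * ‖u‖ ^ 2)) :=
    mul_le_mul_of_nonneg_left (mul_le_mul_of_nonneg_left h3 (by positivity)) hC.le
  rw [norm_sq_eq w]
  nlinarith

/-- Multiplication by `e^{-g}` is a bounded operator on the form domain. -/
theorem IsEllipticField.exists_mulExpOp (hΓ : IsEllipticField E Γ₀ Γ C)
    (hg : IsWeight E Γ₀ g w₀ B D) : ∃ G : E.Dom →L[ℝ] E.Dom,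
      (∀ u, ∀ᵐ x ∂m, E.toL2 (G u) x = E.toL2 u x * Real.exp (-g x)) ∧
      (∀ u, ‖G u‖ ≤ weightBound C B D * ‖u‖) := by
  set K := weightBound C B D
  have hK : 0 ≤ K := Real.sqrt_nonneg _
  obtain ⟨Q, hQ, -⟩ := exists_mul_clm (m := m) (b := fun x => Real.exp (-g x))
    (B := Real.exp B) hg.measurable.neg.exp.aestronglyMeasurable
    (Filter.Eventually.of_forall fun x => by rw [Real.abs_exp]; exact hg.exp_neg_le x)
  have hex : ∀ u : E.Dom, ∃ w : E.Dom, E.toL2 w = Q (E.toL2 u) ∧ ‖w‖ ≤ K * ‖u‖ := fun u => by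
    -- Extension from bounded elements by density: the estimate for differences makes the images
    -- Cauchy in the form domain, and the limit is identified in `L²`, where multiplication is
    -- continuous.
    obtain ⟨v, hv, hlim⟩ := exists_bdd_seq_tendsto u
    have hex' : ∀ b, E.IsBdd b → ∃ w : E.Dom, E.toL2 w = Q (E.toL2 b) ∧ ‖w‖ ≤ K * ‖b‖ :=
      fun b hb => by
        obtain ⟨w, hw, -, hn⟩ := hΓ.exists_mul_exp_neg_bdd hg hb
        refine ⟨w, Lp.ext ?_, hn⟩
        filter_upwards [hw, hQ (E.toL2 b)] with x h1 h2
        rw [h1, h2, mul_comm]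
    choose w hw hn using fun n => hex' (v n) (hv n)
    have hdiff : ∀ n k, ‖w n - w k‖ ≤ K * ‖v n - v k‖ := fun n k => by
      obtain ⟨z, hz, hzn⟩ := hex' _ ((hv n).sub (hv k))
      have : w n - w k = z := toL2_injective (by
        rw [hz, map_sub, map_sub, map_sub, hw, hw])
      rwa [this]
    have hcau : CauchySeq w := by
      rw [Metric.cauchySeq_iff]
      intro ε hε
      obtain ⟨N, hN⟩ := Metric.cauchySeq_iff.1 hlim.cauchySeq (ε / (K + 1)) (by positivity)
      refine ⟨N, fun n hn k hk => ?_⟩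
      have h1 := hN n hn k hk
      rw [dist_eq_norm] at h1 ⊢
      rw [lt_div_iff₀ (by positivity)] at h1
      nlinarith [hdiff n k, norm_nonneg (v n - v k)]
    obtain ⟨z, hz⟩ := cauchySeq_tendsto_of_complete hcau
    refine ⟨z, ?_, le_of_tendsto_of_tendsto' hz.norm (hlim.norm.const_mul K) hn⟩
    refine tendsto_nhds_unique ((E.toL2.continuous.tendsto z).comp hz) ?_
    refine (((Q.comp E.toL2).continuous.tendsto u).comp hlim).congr fun n => ?_
    simp [hw]
  choose w hw hn using hex
  let G : E.Dom →ₗ[ℝ] E.Dom :=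
    { toFun := w
      map_add' := fun u v => toL2_injective (by simp only [map_add, hw])
      map_smul' := fun a u => toL2_injective (by simp only [map_smul, hw, RingHom.id_apply]) }
  refine ⟨G.mkContinuous K hn, fun u => ?_, hn⟩
  have : E.toL2 (G.mkContinuous K hn u) = Q (E.toL2 u) := hw u
  rw [this]
  filter_upwards [hQ (E.toL2 u)] with x hx
  rw [hx, mul_comm]

theorem IsWeight.integrable_exp_mul (hg : IsWeight E Γ₀ g w₀ B D) {φ : X → ℝ}
    (hφ : Integrable φ m) : Integrable (fun x => Real.exp (-g x) * φ x) m :=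
  hφ.bdd_mul hg.measurable.neg.exp.aestronglyMeasurable (c := Real.exp B)
    (Filter.Eventually.of_forall fun x => by
      rw [Real.norm_eq_abs, Real.abs_exp]; exact hg.exp_neg_le x)

/-- By homogeneity the hypothesis need only be applied to the unit vectors in the directions of `u`
and `v`. -/
theorem abs_bilin_le_of_add_sq {V : Type*} [NormedAddCommGroup V] [InnerProductSpace ℝ V]
    (b : V →ₗ[ℝ] V →ₗ[ℝ] ℝ) {K : ℝ} (h : ∀ u v, |b u v| ≤ K / 2 * (‖u‖ ^ 2 + ‖v‖ ^ 2)) (u v : V) :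
    |b u v| ≤ K * ‖u‖ * ‖v‖ := by
  rcases eq_or_ne u 0 with rfl | hu
  · simp
  rcases eq_or_ne v 0 with rfl | hv
  · simp
  have hu' : 0 < ‖u‖ := norm_pos_iff.2 hu
  have hv' : 0 < ‖v‖ := norm_pos_iff.2 hv
  have h1 := h (‖u‖⁻¹ • u) (‖v‖⁻¹ • v)
  rw [map_smul, map_smul, LinearMap.smul_apply, norm_smul, norm_smul, norm_inv, norm_norm, norm_inv,
    norm_norm, inv_mul_cancel₀ hu'.ne', inv_mul_cancel₀ hv'.ne', smul_eq_mul, smul_eq_mul, abs_mul,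
    abs_mul, abs_inv, abs_norm, abs_inv, abs_norm, inv_mul_le_iff₀ hv', inv_mul_le_iff₀ hu'] at h1
  linarith

/-- The form `∫ Γ(u, v) e^{-g} dm` is represented by a bounded operator on the form domain. -/
theorem IsEllipticField.exists_formOp (hΓ : IsEllipticField E Γ₀ Γ C)
    (hg : IsWeight E Γ₀ g w₀ B D) : ∃ A : E.Dom →L[ℝ] E.Dom,
      (∀ u v, ⟪A u, v⟫ = ∫ x, Real.exp (-g x) * Γ u v x ∂m) ∧
      (∀ u, ‖A u‖ ≤ Real.exp B * C * ‖u‖) := by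
  have hi : ∀ u v, Integrable (fun x => Real.exp (-g x) * Γ u v x) m := fun u v =>
    hg.integrable_exp_mul (integrable_field u v)
  let b : E.Dom →ₗ[ℝ] E.Dom →ₗ[ℝ] ℝ := LinearMap.mk₂ ℝ
    (fun u v => ∫ x, Real.exp (-g x) * Γ u v x ∂m)
    (fun u v w => by
      rw [← integral_add (hi _ _) (hi _ _)]
      refine integral_congr_ae ?_
      filter_upwards [field_add_left_ae (Γ := Γ) u v w] with x hx
      rw [hx]; ring)
    (fun a u w => by
      rw [smul_eq_mul, ← integral_const_mul]
      refine integral_congr_ae ?_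
      filter_upwards [field_smul_left_ae (Γ := Γ) a u w] with x hx
      rw [hx]; ring)
    (fun u v w => by
      rw [← integral_add (hi _ _) (hi _ _)]
      refine integral_congr_ae ?_
      filter_upwards [field_add_right_ae (Γ := Γ) v w u] with x hx
      rw [hx]; ring)
    (fun a u w => by
      rw [smul_eq_mul, ← integral_const_mul]
      refine integral_congr_ae ?_
      filter_upwards [field_smul_right_ae (Γ := Γ) a w u] with x hx
      rw [hx]; ring)
  have hC := hΓ.pos
  have hb : ∀ u v, |b u v| ≤ Real.exp B * C / 2 * (‖u‖ ^ 2 + ‖v‖ ^ 2) := fun u v => by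
    have h1 : |b u v| ≤ ∫ x, Real.exp B * (2⁻¹ * (Γ u u x + Γ v v x)) ∂m := by
      refine (abs_integral_le_integral_abs).trans (integral_mono_ae (hi u v).abs
        ((((integrable_field u u).add (integrable_field v v)).const_mul _).const_mul _) ?_)
      filter_upwards [ae_forall_field_quadratic_nonneg hΓ.symm hΓ.nonneg u v] with x hx
      -- The values `c = 1` and `c = -1` give `2 |Γ(u, v)| ≤ Γ(u) + Γ(v)` pointwise.
      have h2 := hx 1
      have h3 := hx (-1)
      rw [abs_mul, Real.abs_exp]
      have h4 : |Γ u v x| ≤ 2⁻¹ * (Γ u u x + Γ v v x) := abs_le.2 ⟨by linarith, by linarith⟩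
      exact mul_le_mul (hg.exp_neg_le x) h4 (abs_nonneg _) (Real.exp_pos _).le
    rw [integral_const_mul, integral_const_mul,
      integral_add (integrable_field u u) (integrable_field v v)] at h1
    refine h1.trans ?_
    have h5 : ∀ u, ∫ x, Γ u u x ∂m ≤ C * ‖u‖ ^ 2 := fun u => (hΓ.integral_le u).trans
      (mul_le_mul_of_nonneg_left (energy_self_le u) hC.le)
    calc _ ≤ Real.exp B * (2⁻¹ * (C * ‖u‖ ^ 2 + C * ‖v‖ ^ 2)) :=
          mul_le_mul_of_nonneg_left (mul_le_mul_of_nonneg_left (add_le_add (h5 u) (h5 v))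
            (by norm_num)) (Real.exp_pos _).le
      _ = _ := by ring
  have hb' := abs_bilin_le_of_add_sq b hb
  let β : E.Dom →L[ℝ] E.Dom →L[ℝ] ℝ := b.mkContinuous₂ (Real.exp B * C) hb'
  refine ⟨InnerProductSpace.continuousLinearMapOfBilin (𝕜 := ℝ) β, fun u v => ?_, fun u => ?_⟩
  · exact InnerProductSpace.continuousLinearMapOfBilin_apply β u v
  · set z := InnerProductSpace.continuousLinearMapOfBilin (𝕜 := ℝ) β u with hz
    have h1 : ⟪z, z⟫ = b u z := InnerProductSpace.continuousLinearMapOfBilin_apply β u z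
    have h2 := (le_abs_self _).trans (hb' u z)
    rw [← h1, real_inner_self_eq_norm_mul_norm] at h2
    rcases (norm_nonneg z).eq_or_lt with h3 | h3
    · rw [← h3]; positivity
    · exact le_of_mul_le_mul_right h2 h3

/-- The two exponentials cancel: `e^{-g} Γ(u, u e^g) = Γ(u) + u Γ(u, g) ≥ Γ(u)/2 - u² Γ(g)/2`.
Ellipticity turns the first term into `1/(2C)` times the energy; `C D / 2` comes from `Γ(g) ≤ C D`,
and the extra `1/(2C)` completes the energy to `‖u‖²`. The chain rule requires bounded `u`, so
density is used at the end. -/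
theorem IsEllipticField.coercive (hΓ : IsEllipticField E Γ₀ Γ C) (hg : IsWeight E Γ₀ g w₀ B D)
    {A G : E.Dom →L[ℝ] E.Dom} (hA : ∀ u v, ⟪A u, v⟫ = ∫ x, Real.exp (-g x) * Γ u v x ∂m)
    (hG : ∀ u, ∀ᵐ x ∂m, E.toL2 (G u) x = E.toL2 u x * Real.exp (g x)) (u : E.Dom) :
    1 / (2 * C) * ‖u‖ ^ 2 ≤ ⟪A u, G u⟫ + (C * D / 2 + 1 / (2 * C)) * ‖E.toL2 u‖ ^ 2 := by
  have hC := hΓ.pos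
  have key : ∀ u, E.IsBdd u → 1 / (2 * C) * ‖u‖ ^ 2 ≤
      ⟪A u, G u⟫ + (C * D / 2 + 1 / (2 * C)) * ‖E.toL2 u‖ ^ 2 := fun u hu => by
    have hneg : ∀ᵐ x ∂m, E.toL2 (-w₀) x = - g x := hg.neg.ae_eq
    have hGu : ∀ᵐ x ∂m, E.toL2 (G u) x = E.toL2 u x * Real.exp (-E.toL2 (-w₀) x) := by
      filter_upwards [hG u, hneg] with x h1 h2
      rw [h1, h2, neg_neg]
    have hpt : ∀ᵐ x ∂m, 1 / 2 * Γ u u x - C * D / 2 * E.toL2 u x ^ 2 ≤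
        Real.exp (-g x) * Γ u (G u) x := by
      have hnegΓ : ∀ᵐ x ∂m, Γ (-w₀) u x = - Γ w₀ u x := by
        rw [map_neg, LinearMap.neg_apply]; exact Lp.coeFn_neg _
      filter_upwards [hΓ.diffusion_mul_exp hu hg.neg.isBdd hu hGu, hneg, hΓ.grad_le hg, hnegΓ,
        ae_forall_field_quadratic_nonneg hΓ.symm hΓ.nonneg u w₀] with x h1 h2 h3 h4 h5
      rw [hΓ.symm u (G u), h1, h2, h4, neg_neg, ← mul_assoc, ← Real.exp_add, neg_add_cancel,
        Real.exp_zero, one_mul, hΓ.symm w₀ u]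
      have h6 := h5 (E.toL2 u x)
      have h7 := mul_le_mul_of_nonneg_left h3 (sq_nonneg (E.toL2 u x))
      linarith
    have h1 := integral_mono_ae (((integrable_field u u).const_mul _).sub
      ((integrable_sq_toL2 u).const_mul _)) (hg.integrable_exp_mul (integrable_field u (G u))) hpt
    rw [integral_sub' ((integrable_field u u).const_mul _) ((integrable_sq_toL2 u).const_mul _),
      integral_const_mul, integral_const_mul, integral_sq_toL2, ← hA] at h1
    have h2 : 1 / (2 * C) * E.energy u u ≤ 1 / 2 * ∫ x, Γ u u x ∂m := by
      have := hΓ.energy_le u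
      rw [one_div_mul_eq_div, div_le_iff₀ (by positivity)]
      linarith
    rw [norm_sq_eq u]
    linarith
  obtain ⟨w, hw, hlim⟩ := exists_bdd_seq_tendsto u
  have hc1 : Continuous fun u : E.Dom => 1 / (2 * C) * ‖u‖ ^ 2 := by fun_prop
  have hc2 : Continuous fun u : E.Dom =>
      ⟪A u, G u⟫ + (C * D / 2 + 1 / (2 * C)) * ‖E.toL2 u‖ ^ 2 := by fun_prop
  exact le_of_tendsto_of_tendsto' ((hc1.tendsto u).comp hlim) ((hc2.tendsto u).comp hlim)
    fun n => key _ (hw n)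

end DirichletForm

/-! ### The time-dependent operators and the generator -/

namespace DirichletForm

variable {X : Type*} [MeasurableSpace X] {m : Measure X} {E : DirichletForm m}

local notation "⟪" x ", " y "⟫" => inner ℝ x y

theorem ofFun_eq {g : X → ℝ} {w : E.Dom} (h : ∀ᵐ x ∂m, E.toL2 w x = g x) : E.ofFun g = w := by
  have hex : ∃ w : E.Dom, E.toL2 w =ᵐ[m] g := ⟨w, h⟩
  rw [ofFun, dif_pos hex]
  exact eq_of_ae_eq (hex.choose_spec.trans (Filter.EventuallyEq.symm h))

theorem integral_weighted {f : ℝ → X → ℝ} {t : ℝ} (hf : Measurable (f t)) (φ : X → ℝ) :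
    ∫ x, φ x ∂(weighted m f t) = ∫ x, Real.exp (-f t x) * φ x ∂m := by
  rw [weighted, integral_withDensity_eq_integral_toReal_smul (by fun_prop)
    (Filter.Eventually.of_forall fun x => ENNReal.ofReal_lt_top)]
  simp only [ENNReal.toReal_ofReal (Real.exp_pos _).le, smul_eq_mul]

/-- The assumptions on the time-dependent weights `f` and square fields `Γ`. -/
structure IsTimeDependentFamily (E : DirichletForm m) (Γ₀ : E.FieldForm) (T : ℝ)
    (f : ℝ → X → ℝ) (Γ : ℝ → E.FieldForm) (w₀ : ℝ → E.Dom) (C B D : ℝ) : Prop where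
  field : ∀ t ∈ Ioo (0 : ℝ) T, IsEllipticField E Γ₀ (Γ t) C
  weight : ∀ t ∈ Ioo (0 : ℝ) T, IsWeight E Γ₀ (f t) (w₀ t) B D
  measurable : Measurable (fun p : Ioo (0 : ℝ) T × X => f p.1 p.2)
  aemeasurable_energyAt : ∀ u v : E.Dom, AEMeasurable (fun t => energyAt Γ f t u v)
    (volume.restrict (Ioo (0 : ℝ) T))

/-- Multiplication by `e^{-f_t}` and `e^{f_t}` and the form `E_t`, as bounded operators on the
form domain. -/
structure IsOperatorFamily (E : DirichletForm m) (T : ℝ) (f : ℝ → X → ℝ) (Γ : ℝ → E.FieldForm)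
    (G Gi F : ℝ → E.Dom →L[ℝ] E.Dom) (K α κ : ℝ) : Prop where
  mul_exp_neg : ∀ t ∈ Ioo (0 : ℝ) T, ∀ u, ∀ᵐ x ∂m,
    E.toL2 (G t u) x = E.toL2 u x * Real.exp (-f t x)
  mul_exp : ∀ t ∈ Ioo (0 : ℝ) T, ∀ u, ∀ᵐ x ∂m,
    E.toL2 (Gi t u) x = E.toL2 u x * Real.exp (f t x)
  inner_form : ∀ t ∈ Ioo (0 : ℝ) T, ∀ u v, ⟪F t u, v⟫ = energyAt Γ f t u v
  symm : ∀ t ∈ Ioo (0 : ℝ) T, ∀ u v, ⟪F t u, v⟫ = ⟪F t v, u⟫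
  norm_mul_exp_neg_le : ∀ t ∈ Ioo (0 : ℝ) T, ∀ u, ‖G t u‖ ≤ K * ‖u‖
  norm_mul_exp_le : ∀ t ∈ Ioo (0 : ℝ) T, ∀ u, ‖Gi t u‖ ≤ K * ‖u‖
  norm_form_le : ∀ t ∈ Ioo (0 : ℝ) T, ∀ u, ‖F t u‖ ≤ K * ‖u‖
  nonneg : 0 ≤ K
  pos : 0 < α
  kappa_nonneg : 0 ≤ κ
  coercive : ∀ t ∈ Ioo (0 : ℝ) T, ∀ u, α * ‖u‖ ^ 2 ≤ ⟪F t u, Gi t u⟫ + κ * ‖E.toL2 u‖ ^ 2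
  aemeasurable_mul_exp_neg : ∀ u v, AEMeasurable (fun t => ⟪G t u, v⟫)
    (volume.restrict (Ioo (0 : ℝ) T))
  aemeasurable_mul_exp : ∀ u v, AEMeasurable (fun t => ⟪Gi t u, v⟫)
    (volume.restrict (Ioo (0 : ℝ) T))
  aemeasurable_form : ∀ u v, AEMeasurable (fun t => ⟪F t u, v⟫)
    (volume.restrict (Ioo (0 : ℝ) T))
  measurable : Measurable (fun p : Ioo (0 : ℝ) T × X => f p.1 p.2)

theorem aemeasurable_integral_of_measurable [SFinite m] {I : Set ℝ} (hI : MeasurableSet I)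
    {φ : ℝ → X → ℝ} (hφ : StronglyMeasurable (fun p : I × X => φ p.1 p.2)) :
    AEMeasurable (fun t => ∫ x, φ t x ∂m) (volume.restrict I) := by
  rw [aemeasurable_restrict_iff_comap_subtype hI]
  exact (hφ.integral_prod_right (ν := m)).measurable.aemeasurable

/-- The form product of `G t` with `v` is not an explicit integral of `b`. Against vectors `ι†ι d`
it becomes an `L²` product, measurable in `t` as a parameter integral, and such vectors with `d` in
a dense sequence separate the points of the form domain. -/
theorem aemeasurable_inner_of_mul [SFinite m] [TopologicalSpace.SeparableSpace E.Dom] {I : Set ℝ}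
    (hI : MeasurableSet I) {b : ℝ → X → ℝ} (hb : Measurable (fun p : I × X => b p.1 p.2))
    {G : ℝ → E.Dom} {u : E.Dom} (hG : ∀ t ∈ I, ∀ᵐ x ∂m, E.toL2 (G t) x = E.toL2 u x * b t x)
    (v : E.Dom) : AEMeasurable (fun t => ⟪G t, v⟫) (volume.restrict I) := by
  have h : AEStronglyMeasurable G (volume.restrict I) := by
    refine aestronglyMeasurable_of_separating
      (fun n => gramOp E.toL2 (TopologicalSpace.denseSeq E.Dom n)) (fun v hv => ?_) fun n => ?_
    · simp only [inner_gramOp_right] at hv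
      refine toL2_injective ?_
      rw [map_zero]
      have h1 : gramOp E.toL2 v = 0 := by
        refine (TopologicalSpace.denseRange_denseSeq E.Dom).eq_of_forall_inner_eq fun n => ?_
        rw [inner_gramOp_left, hv n, inner_zero_left]
      have h2 := inner_gramOp_left E.toL2 v v
      rw [h1, inner_zero_left] at h2
      exact inner_self_eq_zero.1 h2.symm
    · set d := TopologicalSpace.denseSeq E.Dom n
      have h1 : AEMeasurable (fun t => ∫ x, E.toL2 u x * b t x * E.toL2 d x ∂m)
          (volume.restrict I) := by
        refine aemeasurable_integral_of_measurable hI ?_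
        exact (((Lp.stronglyMeasurable (E.toL2 u)).comp_measurable measurable_snd).mul
          hb.stronglyMeasurable).mul ((Lp.stronglyMeasurable (E.toL2 d)).comp_measurable measurable_snd)
      refine h1.congr ?_
      filter_upwards [ae_restrict_mem hI] with t ht
      rw [inner_gramOp_right, inner_Lp_eq_integral]
      refine integral_congr_ae ?_
      filter_upwards [hG t ht] with x hx
      rw [hx]
  exact (h.inner aestronglyMeasurable_const).aemeasurable

variable {Γ₀ : E.FieldForm} {T : ℝ} {f : ℝ → X → ℝ} {Γ : ℝ → E.FieldForm} {w₀ : ℝ → E.Dom}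
  {C B D : ℝ}

theorem IsTimeDependentFamily.exists_operatorFamily [SFinite m]
    [TopologicalSpace.SeparableSpace E.Dom]
    (h : IsTimeDependentFamily E Γ₀ T f Γ w₀ C B D) (hT : 0 < T) :
    ∃ G Gi F : ℝ → E.Dom →L[ℝ] E.Dom, ∃ K α κ : ℝ, IsOperatorFamily E T f Γ G Gi F K α κ := by
  have hex : ∀ t, ∃ A : (E.Dom →L[ℝ] E.Dom) × (E.Dom →L[ℝ] E.Dom) × (E.Dom →L[ℝ] E.Dom),
      t ∈ Ioo (0 : ℝ) T →
      ((∀ u, ∀ᵐ x ∂m, E.toL2 (A.1 u) x = E.toL2 u x * Real.exp (-f t x)) ∧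
        (∀ u, ‖A.1 u‖ ≤ weightBound C B D * ‖u‖)) ∧
      ((∀ u, ∀ᵐ x ∂m, E.toL2 (A.2.1 u) x = E.toL2 u x * Real.exp (f t x)) ∧
        (∀ u, ‖A.2.1 u‖ ≤ weightBound C B D * ‖u‖)) ∧
      ((∀ u v, ⟪A.2.2 u, v⟫ = ∫ x, Real.exp (-f t x) * Γ t u v x ∂m) ∧
        (∀ u, ‖A.2.2 u‖ ≤ Real.exp B * C * ‖u‖)) := fun t => by
    by_cases ht : t ∈ Ioo (0 : ℝ) T
    · obtain ⟨G, hG⟩ := (h.field t ht).exists_mulExpOp (h.weight t ht)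
      obtain ⟨Gi, hGi⟩ := (h.field t ht).exists_mulExpOp (h.weight t ht).neg
      obtain ⟨F, hF⟩ := (h.field t ht).exists_formOp (h.weight t ht)
      simp only [neg_neg] at hGi
      exact ⟨(G, Gi, F), fun _ => ⟨hG, hGi, hF⟩⟩
    · exact ⟨(0, 0, 0), fun h => absurd h ht⟩
  choose A hA using hex
  obtain ⟨t₀, ht₀⟩ : (Ioo 0 T).Nonempty := nonempty_Ioo.2 hT
  have hC := (h.field t₀ ht₀).pos
  have hD := (h.weight t₀ ht₀).grad_nonneg
  have hform : ∀ t ∈ Ioo (0 : ℝ) T, ∀ u v, ⟪(A t).2.2 u, v⟫ = energyAt Γ f t u v :=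
    fun t ht u v => by
      rw [(hA t ht).2.2.1 u v, energyAt, integral_weighted (h.weight t ht).measurable]
  have hle1 : weightBound C B D ≤ max (weightBound C B D) (Real.exp B * C) := le_max_left _ _
  have hle2 : Real.exp B * C ≤ max (weightBound C B D) (Real.exp B * C) := le_max_right _ _
  refine ⟨fun t => (A t).1, fun t => (A t).2.1, fun t => (A t).2.2,
    max (weightBound C B D) (Real.exp B * C), 1 / (2 * C), C * D / 2 + 1 / (2 * C),
    fun t ht => (hA t ht).1.1, fun t ht => (hA t ht).2.1.1, hform, fun t ht u v => ?_,
    fun t ht u => ((hA t ht).1.2 u).trans (mul_le_mul_of_nonneg_right hle1 (norm_nonneg _)),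
    fun t ht u => ((hA t ht).2.1.2 u).trans (mul_le_mul_of_nonneg_right hle1 (norm_nonneg _)),
    fun t ht u => ((hA t ht).2.2.2 u).trans (mul_le_mul_of_nonneg_right hle2 (norm_nonneg _)),
    (by positivity : 0 ≤ Real.exp B * C).trans hle2, by positivity, by positivity,
    fun t ht u => (h.field t ht).coercive (h.weight t ht) (hA t ht).2.2.1 (hA t ht).2.1.1 u,
    fun u v => ?_, fun u v => ?_, fun u v => ?_, h.measurable⟩
  · rw [hform t ht, hform t ht, energyAt, energyAt, (h.field t ht).symm]
  · exact aemeasurable_inner_of_mul measurableSet_Ioo (b := fun t x => Real.exp (-f t x))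
      h.measurable.neg.exp (fun t ht => (hA t ht).1.1 u) v
  · exact aemeasurable_inner_of_mul measurableSet_Ioo (b := fun t x => Real.exp (f t x))
      h.measurable.exp (fun t ht => (hA t ht).2.1.1 u) v
  · refine (h.aemeasurable_energyAt u v).congr ?_
    filter_upwards [ae_restrict_mem measurableSet_Ioo] with t ht
    exact (hform t ht u v).symm

namespace IsOperatorFamily

variable {G Gi F : ℝ → E.Dom →L[ℝ] E.Dom} {K α κ : ℝ}

theorem mul_exp_neg_mul_exp (h : IsOperatorFamily E T f Γ G Gi F K α κ) {t : ℝ}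
    (ht : t ∈ Ioo (0 : ℝ) T) (u : E.Dom) : G t (Gi t u) = u := by
  refine eq_of_ae_eq ?_
  filter_upwards [h.mul_exp_neg t ht (Gi t u), h.mul_exp t ht u] with x h1 h2
  rw [h1, h2, mul_assoc, ← Real.exp_add, add_neg_cancel, Real.exp_zero, mul_one]

theorem mul_exp_mul_exp_neg (h : IsOperatorFamily E T f Γ G Gi F K α κ) {t : ℝ}
    (ht : t ∈ Ioo (0 : ℝ) T) (u : E.Dom) : Gi t (G t u) = u := by
  refine eq_of_ae_eq ?_
  filter_upwards [h.mul_exp t ht (G t u), h.mul_exp_neg t ht u] with x h1 h2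
  rw [h1, h2, mul_assoc, ← Real.exp_add, neg_add_cancel, Real.exp_zero, mul_one]

theorem inner_toL2_mul_exp_neg (h : IsOperatorFamily E T f Γ G Gi F K α κ) {t : ℝ}
    (ht : t ∈ Ioo (0 : ℝ) T) (u v : E.Dom) :
    ⟪E.toL2 u, E.toL2 (G t v)⟫ = ⟪E.toL2 (G t u), E.toL2 v⟫ := by
  rw [inner_Lp_eq_integral, inner_Lp_eq_integral]
  refine integral_congr_ae ?_
  filter_upwards [h.mul_exp_neg t ht u, h.mul_exp_neg t ht v] with x h1 h2
  rw [h1, h2]; ring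

end IsOperatorFamily

/-- The operator `(Gi t)† ∘ F t`; for the operators of an `IsOperatorFamily` it is the generator
`⟪A_t u, w⟫ = E_t(u, w e^{f_t})` of the heat equation on the form domain. -/
noncomputable def generatorOp {V : Type*} [NormedAddCommGroup V] [InnerProductSpace ℝ V]
    [CompleteSpace V] (Gi F : ℝ → V →L[ℝ] V) (t : ℝ) : V →L[ℝ] V :=
  (ContinuousLinearMap.adjoint (Gi t)).comp (F t)

theorem inner_generatorOp {V : Type*} [NormedAddCommGroup V] [InnerProductSpace ℝ V]
    [CompleteSpace V] (Gi F : ℝ → V →L[ℝ] V) (t : ℝ) (u v : V) :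
    ⟪generatorOp Gi F t u, v⟫ = ⟪F t u, Gi t v⟫ := by
  rw [generatorOp, ContinuousLinearMap.comp_apply, ContinuousLinearMap.adjoint_inner_left]

theorem norm_adjoint_apply_le {V H : Type*} [NormedAddCommGroup V] [InnerProductSpace ℝ V]
    [CompleteSpace V] [NormedAddCommGroup H] [InnerProductSpace ℝ H] [CompleteSpace H]
    {A : V →L[ℝ] H} {K : ℝ} (hK : 0 ≤ K) (hA : ∀ u, ‖A u‖ ≤ K * ‖u‖) (y : H) :
    ‖ContinuousLinearMap.adjoint A y‖ ≤ K * ‖y‖ := by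
  refine (ContinuousLinearMap.le_opNorm _ _).trans
    (mul_le_mul_of_nonneg_right ?_ (norm_nonneg _))
  rw [LinearIsometryEquiv.norm_map]
  exact ContinuousLinearMap.opNorm_le_bound _ hK hA

theorem IsOperatorFamily.isQuasiCoerciveFamily [TopologicalSpace.SeparableSpace E.Dom]
    {G Gi F : ℝ → E.Dom →L[ℝ] E.Dom} {K α κ : ℝ}
    (h : IsOperatorFamily E T f Γ G Gi F K α κ) :
    IsQuasiCoerciveFamily E.toL2 0 T α κ (K * K) (generatorOp Gi F) where
  aemeasurable v w := by
    simp only [inner_generatorOp]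
    exact ((aestronglyMeasurable_of_inner (h.aemeasurable_form v)).inner
      (aestronglyMeasurable_of_inner (h.aemeasurable_mul_exp w))).aemeasurable
  bound t ht v := by
    refine (norm_adjoint_apply_le h.nonneg (h.norm_mul_exp_le t ht) _).trans ?_
    rw [mul_assoc]
    exact mul_le_mul_of_nonneg_left (h.norm_form_le t ht v) h.nonneg
  pos := h.pos
  nonneg := h.kappa_nonneg
  coercive t ht v := by
    rw [inner_generatorOp]
    exact h.coercive t ht v

end DirichletForm

/-! ### Product test curves and the Riesz identification of `V*` -/

section TestCurves

variable {V H : Type*} [NormedAddCommGroup V] [InnerProductSpace ℝ V] [CompleteSpace V]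
  [NormedAddCommGroup H] [InnerProductSpace ℝ H] [CompleteSpace H]

local notation "⟪" x ", " y "⟫" => inner ℝ x y

variable {ι : V →L[ℝ] H} {s τ : ℝ} {u v g h : ℝ → V}

/-- These product curves are admissible in the weak equations, and there are enough of them to
localise an equation in time. -/
theorem IsTestFun.isWeakCurve {φ : ℝ → ℝ} (hφ : IsTestFun s τ φ) (hst : s ≤ τ) (ψ : V) :
    IsWeakCurve ι s τ (fun t => φ t • ψ) (fun t => _root_.deriv φ t • gramOp ι ψ) where
  memLp := (hφ.continuous.smul continuous_const).memLp_two_restrict_Ioo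
  memLp_deriv := (hφ.deriv.continuous.smul continuous_const).memLp_two_restrict_Ioo
  weak_deriv χ hχ := by
    have hg : IntegrableOn (fun t => _root_.deriv φ t • gramOp ι ψ) (Ioo s τ) :=
      ((hφ.deriv.continuous.smul continuous_const).memLp_two_restrict_Ioo).integrableOn_Ioo
    rw [← hχ.integral_deriv_smul_primitive hst hg]
    refine integral_congr_ae (Filter.Eventually.of_forall fun t => ?_)
    have h1 : ∫ x in s..t, _root_.deriv φ x = φ t := by
      rw [intervalIntegral.integral_eq_sub_of_hasDerivAt (fun x _ => hφ.hasDerivAt x)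
        (hφ.deriv.continuous.intervalIntegrable _ _), hφ.eq_zero (t := s) (by simp), sub_zero]
    simp only [intervalIntegral.integral_smul_const, h1, map_smul]

theorem ae_eq_of_forall_integral_inner_testFun (hu : IntegrableOn u (Ioo s τ))
    (hv : IntegrableOn v (Ioo s τ))
    (huv : ∀ φ, IsTestFun s τ φ → ∀ ψ : V,
      ∫ t in Ioo s τ, ⟪u t, φ t • ψ⟫ = ∫ t in Ioo s τ, ⟪v t, φ t • ψ⟫) :
    u =ᵐ[volume.restrict (Ioo s τ)] v := by
  have h1 := ae_eq_zero_of_forall_integral_testFun (f := fun t => u t - v t) (hu.sub hv)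
    fun φ hφ => by
      simp only [smul_sub]
      rw [integral_sub (hφ.integrableOn_smul hu) (hφ.integrableOn_smul hv), sub_eq_zero]
      refine ext_inner_left ℝ fun ψ => ?_
      rw [← integral_inner (hφ.integrableOn_smul hu),
        ← integral_inner (hφ.integrableOn_smul hv)]
      simpa only [inner_smul_right, real_inner_comm ψ] using huv φ hφ ψ
  filter_upwards [h1] with t ht
  exact sub_eq_zero.1 ht

theorem IsWeakCurve.deriv_ae_eq (hg : IsWeakCurve ι s τ u g) (hh : IsWeakCurve ι s τ u h) :
    g =ᵐ[volume.restrict (Ioo s τ)] h := by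
  have h1 := ae_eq_zero_of_forall_integral_testFun (f := fun t => g t - h t)
    (hg.integrableOn_deriv.sub hh.integrableOn_deriv) fun φ hφ => by
      simp only [smul_sub]
      rw [integral_sub (hφ.integrableOn_smul hg.integrableOn_deriv)
        (hφ.integrableOn_smul hh.integrableOn_deriv), sub_eq_zero]
      exact neg_injective (by rw [← hg.weak_deriv φ hφ, ← hh.weak_deriv φ hφ])
  filter_upwards [h1] with t ht
  exact sub_eq_zero.1 ht

theorem integrableOn_innerSL_comp (hu : IntegrableOn u (Ioo s τ)) :
    IntegrableOn (fun t => (innerSL ℝ (ι (u t))).comp ι) (Ioo s τ) :=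
  ((ContinuousLinearMap.compL ℝ V H ℝ).flip ι).integrable_comp
    ((innerSL ℝ).integrable_comp (ι.integrable_comp hu))

theorem isWeakCurve_toDual_symm {l : ℝ → StrongDual ℝ V}
    (hu : MemLp u 2 (volume.restrict (Ioo s τ))) (hl : MemLp l 2 (volume.restrict (Ioo s τ)))
    (hul : ∀ φ, IsTestFun s τ φ → ∫ t in Ioo s τ, deriv φ t • (innerSL ℝ (ι (u t))).comp ι =
      - ∫ t in Ioo s τ, φ t • l t) :
    IsWeakCurve ι s τ u (fun t => (InnerProductSpace.toDual ℝ V).symm (l t)) where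
  memLp := hu
  memLp_deriv := hl.of_le
    ((InnerProductSpace.toDual ℝ V).symm.continuous.comp_aestronglyMeasurable hl.1)
    (Filter.Eventually.of_forall fun t => by rw [LinearIsometryEquiv.norm_map])
  weak_deriv φ hφ := by
    have hm : MemLp (fun t => (InnerProductSpace.toDual ℝ V).symm (l t)) 2
        (volume.restrict (Ioo s τ)) := hl.of_le
      ((InnerProductSpace.toDual ℝ V).symm.continuous.comp_aestronglyMeasurable hl.1)
      (Filter.Eventually.of_forall fun t => by rw [LinearIsometryEquiv.norm_map])
    refine ext_inner_right ℝ fun v => ?_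
    have h2 := congrArg (fun L : StrongDual ℝ V => L v) (hul φ hφ)
    simp only [neg_apply] at h2
    rw [ContinuousLinearMap.integral_apply
        (hφ.deriv.integrableOn_smul (integrableOn_innerSL_comp hu.integrableOn_Ioo)),
      ContinuousLinearMap.integral_apply (hφ.integrableOn_smul hl.integrableOn_Ioo)] at h2
    rw [inner_neg_left, real_inner_comm, real_inner_comm v, ← integral_inner
        (hφ.deriv.integrableOn_smul ((gramOp ι).integrable_comp hu.integrableOn_Ioo)),
      ← integral_inner (hφ.integrableOn_smul hm.integrableOn_Ioo)]
    simpa only [real_inner_comm _ v, real_inner_smul_left, InnerProductSpace.toDual_symm_apply,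
      inner_gramOp_left, ContinuousLinearMap.comp_apply, innerSL_apply_apply,
      smul_apply, smul_eq_mul] using h2

theorem MeasureTheory.MemLp.toDual {Ω : Type*} [MeasurableSpace Ω] {μ : Measure Ω} {g : Ω → V}
    {p : ℝ≥0∞} (hg : MemLp g p μ) : MemLp (fun t => InnerProductSpace.toDual ℝ V (g t)) p μ :=
  hg.of_le ((InnerProductSpace.toDual ℝ V).continuous.comp_aestronglyMeasurable hg.1)
    (Filter.Eventually.of_forall fun t => by rw [LinearIsometryEquiv.norm_map])

theorem IsWeakCurve.integral_innerSL_comp {u' : ℝ → V} {l : ℝ → StrongDual ℝ V}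
    (hu : IsWeakCurve ι s τ u g) (hu' : u' =ᵐ[volume.restrict (Ioo s τ)] u)
    (hl : l =ᵐ[volume.restrict (Ioo s τ)] fun t => InnerProductSpace.toDual ℝ V (g t))
    {φ : ℝ → ℝ} (hφ : IsTestFun s τ φ) :
    ∫ t in Ioo s τ, deriv φ t • (innerSL ℝ (ι (u' t))).comp ι =
      - ∫ t in Ioo s τ, φ t • l t := by
  have hui := (gramOp ι).integrable_comp hu.integrableOn
  have e1 : ∫ t in Ioo s τ, deriv φ t • (innerSL ℝ (ι (u' t))).comp ι =
      ∫ t in Ioo s τ, deriv φ t • (innerSL ℝ (ι (u t))).comp ι := by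
    refine integral_congr_ae ?_
    filter_upwards [hu'] with t ht
    rw [ht]
  have e2 : ∫ t in Ioo s τ, φ t • l t =
      ∫ t in Ioo s τ, φ t • InnerProductSpace.toDual ℝ V (g t) := by
    refine integral_congr_ae ?_
    filter_upwards [hl] with t ht
    rw [ht]
  rw [e1, e2]
  ext v
  have h4 := congrArg (fun w => ⟪v, w⟫) (hu.weak_deriv φ hφ)
  simp only [inner_neg_right] at h4
  rw [← integral_inner (hφ.deriv.integrableOn_smul hui),
    ← integral_inner (hφ.integrableOn_smul hu.integrableOn_deriv)] at h4
  rw [neg_apply, ContinuousLinearMap.integral_apply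
      (hφ.deriv.integrableOn_smul (integrableOn_innerSL_comp hu.integrableOn)),
    ContinuousLinearMap.integral_apply
      (hφ.integrableOn_smul hu.memLp_deriv.toDual.integrableOn_Ioo)]
  simpa only [real_inner_comm _ v, real_inner_smul_left, InnerProductSpace.toDual_apply_apply,
    inner_gramOp_left, ContinuousLinearMap.comp_apply, innerSL_apply_apply,
    smul_apply, smul_eq_mul] using h4

end TestCurves

/-! ### The heat equation as an abstract evolution equation -/

namespace DirichletForm

variable {X : Type*} [MeasurableSpace X] {m : Measure X} {E : DirichletForm m} {s τ : ℝ}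

local notation "⟪" x ", " y "⟫" => inner ℝ x y

theorem separableSpace_dom [MeasurableSpace.CountablyGenerated X] [SFinite m] :
    TopologicalSpace.SeparableSpace E.Dom :=
  have : Fact ((2 : ℝ≥0∞) ≠ ⊤) := ⟨by simp⟩
  separableSpace_of_injective E.toL2 toL2_injective

namespace CurveSpace

/-- The time derivative, as a curve in the form domain by the theorem of Riesz. -/
noncomputable def rieszDt (u : E.CurveSpace s τ) (t : ℝ) : E.Dom :=
  (InnerProductSpace.toDual ℝ E.Dom).symm (u.dt t)

theorem inner_rieszDt (u : E.CurveSpace s τ) (t : ℝ) (v : E.Dom) :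
    ⟪u.rieszDt t, v⟫ = u.dt t v :=
  InnerProductSpace.toDual_symm_apply

theorem isWeakCurve (u : E.CurveSpace s τ) : IsWeakCurve E.toL2 s τ u.curve u.rieszDt :=
  isWeakCurve_toDual_symm (Lp.memLp u.curve) (Lp.memLp u.dt) fun φ hφ =>
    u.weak_deriv φ hφ.contDiff hφ.hasCompactSupport hφ.tsupport_subset

theorem exists_of_isWeakCurve {u g : ℝ → E.Dom} (hu : IsWeakCurve E.toL2 s τ u g) :
    ∃ U : E.CurveSpace s τ, U.curve =ᵐ[volume.restrict (Ioo s τ)] u ∧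
      U.rieszDt =ᵐ[volume.restrict (Ioo s τ)] g := by
  have hg := hu.memLp_deriv.toDual
  refine ⟨⟨hu.memLp.toLp u, hg.toLp _, fun φ h1 h2 h3 => ?_⟩, hu.memLp.coeFn_toLp, ?_⟩
  · exact hu.integral_innerSL_comp hu.memLp.coeFn_toLp hg.coeFn_toLp ⟨h1, h2, h3⟩
  · have h1 := hg.coeFn_toLp
    filter_upwards [h1] with t ht
    exact (congrArg _ ht).trans (LinearIsometryEquiv.symm_apply_apply _ _)

theorem eq_of_curve_ae_eq {u v : E.CurveSpace s τ}
    (h : u.curve =ᵐ[volume.restrict (Ioo s τ)] v.curve) : u = v := by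
  have h1 := u.isWeakCurve.deriv_ae_eq (v.isWeakCurve.congr h.symm (ae_eq_refl _))
  refine CurveSpace.ext (Lp.ext h) (Lp.ext ?_)
  filter_upwards [h1] with t ht
  exact (InnerProductSpace.toDual ℝ E.Dom).symm.injective ht

theorem isContRep_iff {u : E.CurveSpace s τ} {c : ℝ → Lp ℝ 2 m} :
    u.IsContRep c ↔ IsContRepOn E.toL2 s τ u.curve c :=
  ⟨fun h => ⟨h.1, h.2⟩, fun h => ⟨h.1, h.2⟩⟩

theorem exists_isContRep (u : E.CurveSpace s τ) (hst : s < τ) : ∃ c, u.IsContRep c :=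
  let ⟨c, hc⟩ := u.isWeakCurve.exists_contRep hst toL2_injective denseRange_toL2
  ⟨c, isContRep_iff.2 hc⟩

/-- Two representatives that are continuous on the open interval coincide there, so either one
determines the limit at `s`. -/
theorem hasValueAt_iff_hasInitialLimit (u : E.CurveSpace s τ) (hst : s < τ) (h : Lp ℝ 2 m) :
    u.HasValueAt s h ↔ u.HasInitialLimit h := by
  have key : ∀ c, u.IsContRep c → Tendsto c (𝓝[>] s) (𝓝 (c s)) := fun c hc =>
    ((hc.1 s (left_mem_Icc.2 hst.le)).mono Ioo_subset_Icc_self).tendsto.mono_left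
      (nhdsWithin_Ioo_eq_nhdsGT hst).ge
  constructor
  · rintro ⟨c, hc, rfl⟩
    exact ⟨c, hc.1.mono Ioo_subset_Icc_self, hc.2, key c hc⟩
  · rintro ⟨d, hd, hde, hlim⟩
    obtain ⟨c, hc⟩ := u.exists_isContRep hst
    refine ⟨c, hc, tendsto_nhds_unique (key c hc) (hlim.congr' ?_)⟩
    have h1 : EqOn d c (Ioo s τ) := hd.eqOn_Ioo_of_ae_eq (hc.1.mono Ioo_subset_Icc_self) (by
      filter_upwards [hde, hc.2] with t h1 h2
      rw [h1, h2])
    exact h1.eventuallyEq_of_mem (Ioo_mem_nhdsGT hst)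

end CurveSpace

variable {T : ℝ} {f : ℝ → X → ℝ} {Γ : ℝ → E.FieldForm} {G Gi F : ℝ → E.Dom →L[ℝ] E.Dom}
  {K α κ : ℝ}

namespace IsOperatorFamily

theorem pairing_eq (h : IsOperatorFamily E T f Γ G Gi F K α κ) (u w : E.CurveSpace s τ) {t : ℝ}
    (ht : t ∈ Ioo (0 : ℝ) T) : u.pairing f w t = ⟪u.rieszDt t, G t (w.curve t)⟫ := by
  rw [CurveSpace.inner_rieszDt, CurveSpace.pairing, ofFun_eq (h.mul_exp_neg t ht (w.curve t))]

theorem adjoint_mul_exp_adjoint_mul_exp_neg (h : IsOperatorFamily E T f Γ G Gi F K α κ) {t : ℝ}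
    (ht : t ∈ Ioo (0 : ℝ) T) (y : E.Dom) :
    ContinuousLinearMap.adjoint (Gi t) (ContinuousLinearMap.adjoint (G t) y) = y :=
  ext_inner_right ℝ fun v => by
    rw [ContinuousLinearMap.adjoint_inner_left, ContinuousLinearMap.adjoint_inner_left,
      h.mul_exp_neg_mul_exp ht]

theorem adjoint_mul_exp_neg_adjoint_mul_exp (h : IsOperatorFamily E T f Γ G Gi F K α κ) {t : ℝ}
    (ht : t ∈ Ioo (0 : ℝ) T) (y : E.Dom) :
    ContinuousLinearMap.adjoint (G t) (ContinuousLinearMap.adjoint (Gi t) y) = y :=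
  ext_inner_right ℝ fun v => by
    rw [ContinuousLinearMap.adjoint_inner_left, ContinuousLinearMap.adjoint_inner_left,
      h.mul_exp_mul_exp_neg ht]

theorem memLp_adjoint_mul_exp_neg [TopologicalSpace.SeparableSpace E.Dom]
    (h : IsOperatorFamily E T f Γ G Gi F K α κ) (hs : 0 ≤ s) (hτ : τ ≤ T) {y : ℝ → E.Dom}
    (hy : MemLp y 2 (volume.restrict (Ioo s τ))) :
    MemLp (fun t => ContinuousLinearMap.adjoint (G t) (y t)) 2 (volume.restrict (Ioo s τ)) := by
  refine memLp_clm_apply (fun v w => ?_)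
    (fun t ht => norm_adjoint_apply_le h.nonneg
      (h.norm_mul_exp_neg_le t (Ioo_subset_Ioo hs hτ ht))) hy
  simp only [ContinuousLinearMap.adjoint_inner_left]
  refine ((h.aemeasurable_mul_exp_neg w v).mono_measure
    (Measure.restrict_mono (Ioo_subset_Ioo hs hτ) le_rfl)).congr
    (Filter.Eventually.of_forall fun t => ?_)
  exact real_inner_comm (F := E.Dom) _ _

/-- The pairing is the form product of `G†` applied to the derivative with `w`. Product test curves
therefore give `G† u' = R` almost everywhere, and `Gi†` inverts `G†` because multiplications by
`e^{f_t}` and `e^{-f_t}` are inverse to each other. This step removes the weight from both the heat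
equation and its adjoint. -/
theorem forall_integral_eq_integral_pairing_iff [TopologicalSpace.SeparableSpace E.Dom]
    (h : IsOperatorFamily E T f Γ G Gi F K α κ) (hs : 0 ≤ s) (hst : s < τ) (hτ : τ ≤ T)
    (u : E.CurveSpace s τ) {R : ℝ → E.Dom} (hR : MemLp R 2 (volume.restrict (Ioo s τ))) :
    (∀ w : E.CurveSpace s τ,
      ∫ t in Ioo s τ, ⟪R t, w.curve t⟫ = ∫ t in Ioo s τ, u.pairing f w t) ↔
    ∀ᵐ t ∂(volume.restrict (Ioo s τ)), u.rieszDt t = ContinuousLinearMap.adjoint (Gi t) (R t) := by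
  have hsub := Ioo_subset_Ioo hs hτ
  have hp : ∀ w : E.CurveSpace s τ, ∫ t in Ioo s τ, u.pairing f w t =
      ∫ t in Ioo s τ, ⟪ContinuousLinearMap.adjoint (G t) (u.rieszDt t), w.curve t⟫ := fun w =>
    setIntegral_congr_fun measurableSet_Ioo fun t ht => by
      rw [h.pairing_eq u w (hsub ht), ContinuousLinearMap.adjoint_inner_left]
  simp only [hp]
  constructor
  · intro hw
    have h1 := ae_eq_of_forall_integral_inner_testFun hR.integrableOn_Ioo
      (h.memLp_adjoint_mul_exp_neg hs hτ u.isWeakCurve.memLp_deriv).integrableOn_Ioo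
      fun φ hφ ψ => by
        obtain ⟨w, hw1, -⟩ := CurveSpace.exists_of_isWeakCurve
          (hφ.isWeakCurve (ι := E.toL2) hst.le ψ)
        have h2 := hw w
        have h3 : ∀ S : ℝ → E.Dom, ∫ t in Ioo s τ, ⟪S t, w.curve t⟫ =
            ∫ t in Ioo s τ, ⟪S t, φ t • ψ⟫ := fun S => integral_congr_ae (by
          filter_upwards [hw1] with t ht
          rw [ht])
        rwa [h3, h3] at h2
    filter_upwards [h1, ae_restrict_mem measurableSet_Ioo] with t ht htm
    rw [ht, h.adjoint_mul_exp_adjoint_mul_exp_neg (hsub htm)]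
  · intro hu w
    refine integral_congr_ae ?_
    filter_upwards [hu, ae_restrict_mem measurableSet_Ioo] with t ht htm
    rw [ht, h.adjoint_mul_exp_neg_adjoint_mul_exp (hsub htm)]

theorem isHeatSolution_iff [TopologicalSpace.SeparableSpace E.Dom]
    (h : IsOperatorFamily E T f Γ G Gi F K α κ) (hs : 0 ≤ s) (hst : s < τ) (hτ : τ ≤ T)
    (u : E.CurveSpace s τ) :
    u.IsHeatSolution Γ f ↔ ∀ᵐ t ∂(volume.restrict (Ioo s τ)),
      u.rieszDt t = - generatorOp Gi F t (u.curve t) := by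
  have hsub := Ioo_subset_Ioo hs hτ
  have hR : MemLp (fun t => - F t (u.curve t)) 2 (volume.restrict (Ioo s τ)) :=
    (memLp_clm_apply (fun v w => (h.aemeasurable_form v w).mono_measure
      (Measure.restrict_mono hsub le_rfl)) (fun t ht => h.norm_form_le t (hsub ht))
      u.isWeakCurve.memLp).neg
  have h1 := h.forall_integral_eq_integral_pairing_iff hs hst hτ u hR
  simp only [map_neg] at h1
  refine Iff.trans (forall_congr' fun w => ?_) h1
  have h2 : ∫ t in Ioo s τ, ⟪- F t (u.curve t), w.curve t⟫ =
      - ∫ t in Ioo s τ, energyAt Γ f t (u.curve t) (w.curve t) := by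
    rw [← integral_neg]
    refine setIntegral_congr_fun measurableSet_Ioo fun t ht => ?_
    simp only [inner_neg_left, h.inner_form t (hsub ht)]
  rw [h2]

end IsOperatorFamily

end DirichletForm

/-! ### Measurability of the time derivative of a Lipschitz weight -/

section LipschitzParameter

open scoped NNReal

/-- Continuity at rational times and a uniform Lipschitz bound in `t` make `g` jointly continuous,
and the derivative in a variable of a jointly continuous function is measurable. -/
theorem measurable_deriv_of_continuous_of_lipschitzWith {X : Type*} [TopologicalSpace X]
    [MeasurableSpace X] [OpensMeasurableSpace X] {g : ℝ → X → ℝ} {L : ℝ≥0}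
    (hg : ∀ q : ℚ, Continuous (g q)) (hL : ∀ x, LipschitzWith L (fun t => g t x)) :
    Measurable (fun p : X × ℝ => deriv (fun q => g q p.1) p.2) := by
  refine measurable_deriv_with_param (f := fun x q => g q x) ?_
  refine continuous_prod_of_dense_continuous_lipschitzWith' _ L Rat.denseRange_cast hL ?_
  rintro _ ⟨q, rfl⟩
  exact hg q

/-- The topology of `X` can be refined to a Polish one in which the countably many functions `g q`,
`q` rational, are continuous. Comparable Polish topologies have the same Borel sets, so
measurability is unaffected. -/
theorem measurable_deriv_of_lipschitzWith {X : Type*} [TopologicalSpace X] [PolishSpace X]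
    [hX : MeasurableSpace X] [hB : BorelSpace X] {g : ℝ → X → ℝ} {L : ℝ≥0}
    (hg : ∀ t, Measurable (g t)) (hL : ∀ x, LipschitzWith L (fun t => g t x)) :
    Measurable (fun p : X × ℝ => deriv (fun q => g q p.1) p.2) := by
  obtain ⟨t', hle, hc, hpol⟩ := Measurable.exists_continuous
    (f := fun (x : X) (q : ℚ) => g q x) (measurable_pi_iff.2 fun q => hg q)
  have hborel : hX = @borel X t' := by
    rw [hB.measurable_eq, borel_eq_borel_of_le hpol ‹_› hle]
  exact @measurable_deriv_of_continuous_of_lipschitzWith X t' hX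
    (@BorelSpace.opensMeasurable X t' hX (@BorelSpace.mk X t' hX hborel)) g L
    (fun q => (continuous_apply q).comp hc) hL

/-- Freezing `f` outside `[a + δ n, b - δ n]` makes it Lipschitz on all of `ℝ`. Near a given time in
`(a, b)` the frozen function agrees with `f` for large `n`, so the derivatives are eventually equal.
-/
theorem measurable_deriv_of_lipschitzOnWith {X : Type*} [TopologicalSpace X] [PolishSpace X]
    [MeasurableSpace X] [BorelSpace X] {f : ℝ → X → ℝ} {a b : ℝ} {L : ℝ≥0}
    (hf : Measurable (fun p : Ioo a b × X => f p.1 p.2))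
    (hL : ∀ x, LipschitzOnWith L (fun t => f t x) (Ioo a b)) :
    Measurable (fun p : Ioo a b × X => deriv (fun q => f q p.2) p.1) := by
  rcases le_or_gt b a with hab | hab
  · have : IsEmpty (Ioo a b × X) := by
      rw [Ioo_eq_empty (not_lt.2 hab)]
      infer_instance
    exact measurable_of_empty _
  let δ : ℕ → ℝ := fun n => (b - a) / 2 / (n + 1)
  have hδ : Tendsto δ atTop (𝓝 0) := by
    simpa [δ, Function.comp_def] using
      (tendsto_const_div_atTop_nhds_zero_nat ((b - a) / 2)).comp (tendsto_add_atTop_nat 1)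
  have hδ0 : ∀ n, 0 < δ n := fun n => by have := sub_pos.2 hab; positivity
  have hδ1 : ∀ n, δ n ≤ (b - a) / 2 := fun n =>
    div_le_self (by linarith) (by linarith [(Nat.cast_nonneg n : (0 : ℝ) ≤ n)])
  have hle : ∀ n, a + δ n ≤ b - δ n := fun n => by linarith [hδ1 n]
  have hmem : ∀ n t, (projIcc _ _ (hle n) t : ℝ) ∈ Ioo a b := fun n t =>
    ⟨lt_of_lt_of_le (by linarith [hδ0 n]) (projIcc _ _ (hle n) t).2.1,
      lt_of_le_of_lt (projIcc _ _ (hle n) t).2.2 (by linarith [hδ0 n])⟩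
  have hmeas : ∀ n, Measurable (fun p : X × ℝ =>
      deriv (fun q => f (projIcc _ _ (hle n) q) p.1) p.2) := fun n => by
    refine measurable_deriv_of_lipschitzWith (g := fun t x => f (projIcc _ _ (hle n) t) x)
      (L := L) (fun t => ?_) fun x => ?_
    · exact hf.comp (measurable_const (a := (⟨_, hmem n t⟩ : Ioo a b)) |>.prodMk measurable_id)
    · refine LipschitzWith.of_dist_le_mul fun t t' => ?_
      refine ((hL x).dist_le_mul _ (hmem n t) _ (hmem n t')).trans
        (mul_le_mul_of_nonneg_left ?_ L.2)
      simpa [Subtype.dist_eq] using (LipschitzWith.projIcc (hle n)).dist_le_mul t t'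
  refine measurable_of_tendsto_metrizable
    (f := fun n (p : Ioo a b × X) => deriv (fun q => f (projIcc _ _ (hle n) q) p.2) p.1)
    (fun n => (hmeas n).comp (measurable_snd.prodMk (measurable_subtype_coe.comp measurable_fst)))
    (tendsto_pi_nhds.2 fun p => tendsto_const_nhds.congr' ?_)
  have h1 : ∀ᶠ n in atTop, δ n < p.1 - a := hδ.eventually_lt_const (sub_pos.2 p.1.2.1)
  have h2 : ∀ᶠ n in atTop, δ n < b - p.1 := hδ.eventually_lt_const (sub_pos.2 p.1.2.2)
  filter_upwards [h1, h2] with n h1 h2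
  refine Filter.EventuallyEq.deriv_eq ?_
  filter_upwards [Icc_mem_nhds (show a + δ n < p.1 by linarith)
    (show (p.1 : ℝ) < b - δ n by linarith)] with q hq
  rw [projIcc_of_mem (hle n) hq]

theorem abs_exp_sub_exp_le {a b B : ℝ} (ha : a ≤ B) (hb : b ≤ B) :
    |Real.exp a - Real.exp b| ≤ Real.exp B * |a - b| := by
  have key : ∀ {a b : ℝ}, a ≤ B → Real.exp a - Real.exp b ≤ Real.exp B * |a - b| :=
    fun {a b} ha => by
      have h1 := Real.add_one_le_exp (b - a)
      have h2 : Real.exp b = Real.exp a * Real.exp (b - a) := by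
        rw [← Real.exp_add, add_sub_cancel]
      calc Real.exp a - Real.exp b = Real.exp a * (1 - Real.exp (b - a)) := by rw [h2]; ring
        _ ≤ Real.exp a * |a - b| :=
          mul_le_mul_of_nonneg_left (by linarith [le_abs_self (a - b)]) (Real.exp_pos _).le
        _ ≤ _ := mul_le_mul_of_nonneg_right (Real.exp_le_exp.2 ha) (abs_nonneg _)
  exact abs_sub_le_iff.2 ⟨key ha, abs_sub_comm a b ▸ key hb⟩

theorem integral_deriv_testFun_mul_exp_neg {s τ B : ℝ} {L : ℝ≥0} {φ y : ℝ → ℝ}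
    (hφ : IsTestFun s τ φ) (hst : s ≤ τ) (hy : LipschitzOnWith L y (Icc s τ))
    (hB : ∀ t ∈ Icc s τ, |y t| ≤ B) :
    ∫ t in Ioo s τ, deriv φ t * Real.exp (-y t) =
      ∫ t in Ioo s τ, φ t * (deriv y t * Real.exp (-y t)) := by
  have hyac : AbsolutelyContinuousOnInterval y s τ :=
    LipschitzOnWith.absolutelyContinuousOnInterval (K := L) (by rwa [uIcc_of_le hst])
  have heac : AbsolutelyContinuousOnInterval (fun t => Real.exp (-y t)) s τ := by
    refine hyac.of_dist_le (Real.exp B) fun t ht t' ht' => ?_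
    rw [uIcc_of_le hst] at ht ht'
    have := abs_exp_sub_exp_le ((neg_le_abs _).trans (hB t ht)) ((neg_le_abs _).trans (hB t' ht'))
    rwa [neg_sub_neg, abs_sub_comm (y t')] at this
  have hi1 : IntervalIntegrable (fun t => deriv φ t * Real.exp (-y t)) volume s τ :=
    (hφ.deriv.continuous.continuousOn.mul heac.continuousOn).intervalIntegrable
  have hbdd : ∀ t ∈ Ioo s τ, ‖deriv y t‖ ≤ L := fun t ht =>
    norm_deriv_le_of_lipschitzOn (Icc_mem_nhds ht.1 ht.2) hy
  have hdy : IntegrableOn (fun t => deriv y t) (Ioo s τ) := by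
    refine Measure.integrableOn_of_bounded (M := L) (by simp)
      (measurable_deriv y).aestronglyMeasurable
      ((ae_restrict_iff' measurableSet_Ioo).2 (Filter.Eventually.of_forall hbdd))
  have hdy' : IntervalIntegrable (deriv y) volume s τ :=
    (intervalIntegrable_iff_integrableOn_Ioo_of_le hst).2 hdy
  have hi2 : IntervalIntegrable (fun t => φ t * (deriv y t * Real.exp (-y t))) volume s τ :=
    (hdy'.mul_continuousOn heac.continuousOn).continuousOn_mul hφ.continuous.continuousOn
  have h := ((AbsolutelyContinuousOnInterval.of_contDiff (hφ.contDiff.of_le (by simp)) s τ).mul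
    heac).integral_eq_sub_of_ae_hasDerivAt
    (f' := fun t => deriv φ t * Real.exp (-y t) - φ t * (deriv y t * Real.exp (-y t)))
    (hi1.sub hi2) (by
      filter_upwards [hyac.ae_differentiableAt] with t ht htm
      refine ((hφ.hasDerivAt t).mul (ht htm).hasDerivAt.neg.exp).congr_deriv ?_
      simp only [Pi.neg_apply]
      ring)
  rw [intervalIntegral.integral_sub hi1 hi2] at h
  rw [IntegrableOn.integral_Ioo_eq hst, IntegrableOn.integral_Ioo_eq hst, ← sub_eq_zero, h]
  simp [hφ.eq_zero (t := s) (by simp), hφ.eq_zero (t := τ) (by simp)]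

end LipschitzParameter

/-! ### The potential `∂ₜf` and the adjoint equation -/

namespace DirichletForm

open scoped NNReal

variable {X : Type*} [MeasurableSpace X] {m : Measure X} {E : DirichletForm m}

local notation "⟪" x ", " y "⟫" => inner ℝ x y

/-- Multiplication by `∂_t f`, tested against `m_t`, as bounded operators on the form domain. -/
structure IsPotentialFamily (E : DirichletForm m) (T : ℝ) (f : ℝ → X → ℝ)
    (W : ℝ → E.Dom →L[ℝ] E.Dom) (L K : ℝ) : Prop where
  inner_eq : ∀ t ∈ Ioo (0 : ℝ) T, ∀ u v, ⟪W t u, v⟫ =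
    ∫ x, E.toL2 u x * E.toL2 v x * (deriv (fun q => f q x) t * Real.exp (-f t x)) ∂m
  abs_deriv_le : ∀ t ∈ Ioo (0 : ℝ) T, ∀ x, |deriv (fun q => f q x) t| ≤ L
  measurable_deriv : Measurable (fun p : Ioo (0 : ℝ) T × X => deriv (fun q => f q p.2) p.1)
  norm_le : ∀ t ∈ Ioo (0 : ℝ) T, ∀ u, ‖W t u‖ ≤ K * ‖u‖
  lipschitz_nonneg : 0 ≤ L
  aemeasurable : ∀ u v, AEMeasurable (fun t => ⟪W t u, v⟫) (volume.restrict (Ioo (0 : ℝ) T))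

variable {T B : ℝ} {f : ℝ → X → ℝ}

/-- Multiplication by `∂ₜf e^{-f}` is bounded on `L²` by `L e^B`. Placing it between `ι` and `ι†`
gives an operator on the form domain without asking that `∂ₜf` preserve this domain. -/
theorem exists_potentialFamily [TopologicalSpace X] [PolishSpace X] [BorelSpace X] [SFinite m]
    {L : ℝ≥0} (hf : Measurable (fun p : Ioo (0 : ℝ) T × X => f p.1 p.2))
    (hB : ∀ t ∈ Ioo (0 : ℝ) T, ∀ x, |f t x| ≤ B)
    (hL : ∀ x, LipschitzOnWith L (fun t => f t x) (Ioo 0 T)) :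
    ∃ W : ℝ → E.Dom →L[ℝ] E.Dom, IsPotentialFamily E T f W L (L * Real.exp B) := by
  have hmd := measurable_deriv_of_lipschitzOnWith hf hL
  have hd : ∀ t ∈ Ioo (0 : ℝ) T, ∀ x, |deriv (fun q => f q x) t| ≤ L := fun t ht x =>
    norm_deriv_le_of_lipschitzOn (Ioo_mem_nhds ht.1 ht.2) (hL x)
  have hm : Measurable (fun p : Ioo (0 : ℝ) T × X =>
      deriv (fun q => f q p.2) p.1 * Real.exp (-f p.1 p.2)) := hmd.mul hf.neg.exp
  have hK : 0 ≤ L * Real.exp B := by positivity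
  have hbound : ∀ t ∈ Ioo (0 : ℝ) T, ∀ x,
      |deriv (fun q => f q x) t * Real.exp (-f t x)| ≤ L * Real.exp B := fun t ht x => by
    rw [abs_mul, abs_of_pos (Real.exp_pos _)]
    exact mul_le_mul (hd t ht x) (Real.exp_le_exp.2 ((neg_le_abs _).trans (hB t ht x)))
      (Real.exp_pos _).le L.2
  have hex : ∀ t, ∃ Q : Lp ℝ 2 m →L[ℝ] Lp ℝ 2 m, t ∈ Ioo (0 : ℝ) T →
      (∀ u, ∀ᵐ x ∂m, Q u x = deriv (fun q => f q x) t * Real.exp (-f t x) * u x) ∧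
      ∀ u, ‖Q u‖ ≤ L * Real.exp B * ‖u‖ := fun t => by
    by_cases ht : t ∈ Ioo (0 : ℝ) T
    · obtain ⟨Q, hQ⟩ := exists_mul_clm (m := m)
        (b := fun x => deriv (fun q => f q x) t * Real.exp (-f t x))
        (hm.comp (measurable_prodMk_left (x := (⟨t, ht⟩ : Ioo (0 : ℝ) T)))).aestronglyMeasurable
        (Filter.Eventually.of_forall (hbound t ht))
      exact ⟨Q, fun _ => hQ⟩
    · exact ⟨0, fun h => absurd h ht⟩
  choose Q hQ using hex
  have hinner : ∀ t ∈ Ioo (0 : ℝ) T, ∀ u v : E.Dom, ⟪Q t (E.toL2 u), E.toL2 v⟫ =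
      ∫ x, E.toL2 u x * E.toL2 v x * (deriv (fun q => f q x) t * Real.exp (-f t x)) ∂m :=
    fun t ht u v => by
      rw [inner_Lp_eq_integral]
      refine integral_congr_ae ?_
      filter_upwards [(hQ t ht).1 (E.toL2 u)] with x hx
      rw [hx]; ring
  have hW : ∀ t u v, ⟪((ContinuousLinearMap.adjoint E.toL2).comp ((Q t).comp E.toL2)) u, v⟫ =
      ⟪Q t (E.toL2 u), E.toL2 v⟫ := fun t u v => by
    rw [ContinuousLinearMap.comp_apply, ContinuousLinearMap.adjoint_inner_left,
      ContinuousLinearMap.comp_apply]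
  refine ⟨fun t => (ContinuousLinearMap.adjoint E.toL2).comp ((Q t).comp E.toL2),
    fun t ht u v => (hW t u v).trans (hinner t ht u v), hd, hmd, fun t ht u => ?_, L.2,
    fun u v => ?_⟩
  · have h1 := norm_adjoint_apply_le (A := E.toL2) zero_le_one
      (fun u => (norm_toL2_le u).trans_eq (one_mul _).symm) (Q t (E.toL2 u))
    rw [one_mul] at h1
    exact h1.trans (((hQ t ht).2 _).trans (mul_le_mul_of_nonneg_left (norm_toL2_le u) hK))
  · refine (aemeasurable_integral_of_measurable (m := m) measurableSet_Ioo
      (φ := fun t x => E.toL2 u x * E.toL2 v x * (deriv (fun q => f q x) t * Real.exp (-f t x)))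
      ?_).congr ?_
    · exact (((Lp.stronglyMeasurable (E.toL2 u)).comp_measurable measurable_snd).mul
        ((Lp.stronglyMeasurable (E.toL2 v)).comp_measurable measurable_snd)).mul
        hm.stronglyMeasurable
    · filter_upwards [ae_restrict_mem measurableSet_Ioo] with t ht
      rw [hW, hinner t ht]

variable {Γ : ℝ → E.FieldForm} {G Gi F W : ℝ → E.Dom →L[ℝ] E.Dom} {K K' L α κ s τ : ℝ}

namespace IsPotentialFamily

theorem symm (h : IsPotentialFamily E T f W L K') {t : ℝ} (ht : t ∈ Ioo (0 : ℝ) T)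
    (u v : E.Dom) : ⟪W t u, v⟫ = ⟪W t v, u⟫ := by
  rw [h.inner_eq t ht, h.inner_eq t ht]
  exact integral_congr_ae (Filter.Eventually.of_forall fun x => by ring)

theorem inner_eq_weighted (h : IsPotentialFamily E T f W L K')
    (hF : IsOperatorFamily E T f Γ G Gi F K α κ) {t : ℝ} (ht : t ∈ Ioo (0 : ℝ) T) (u v : E.Dom) :
    ∫ x, E.toL2 u x * E.toL2 v x * deriv (fun q => f q x) t ∂(weighted m f t) = ⟪W t u, v⟫ := by
  have hft : Measurable (f t) :=
    hF.measurable.comp (measurable_prodMk_left (x := (⟨t, ht⟩ : Ioo (0 : ℝ) T)))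
  rw [h.inner_eq t ht, integral_weighted hft]
  exact integral_congr_ae (Filter.Eventually.of_forall fun x => by ring)

/-- The weights cancel and leave `∫ ∂ₜf u² dm`. The potential thus only raises the constant `κ` by
`L`. -/
theorem neg_le_inner (h : IsPotentialFamily E T f W L K')
    (hF : IsOperatorFamily E T f Γ G Gi F K α κ) {t : ℝ} (ht : t ∈ Ioo (0 : ℝ) T) (u : E.Dom) :
    -(L * ‖E.toL2 u‖ ^ 2) ≤ ⟪W t u, Gi t u⟫ := by
  have hmd : Measurable (fun x => deriv (fun q => f q x) t) :=
    h.measurable_deriv.comp (measurable_prodMk_left (x := (⟨t, ht⟩ : Ioo (0 : ℝ) T)))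
  have h1 : ⟪W t u, Gi t u⟫ = ∫ x, deriv (fun q => f q x) t * (E.toL2 u x * E.toL2 u x) ∂m := by
    rw [h.inner_eq t ht]
    refine integral_congr_ae ?_
    filter_upwards [hF.mul_exp t ht u] with x hx
    have h2 : Real.exp (f t x) * Real.exp (-f t x) = 1 := by
      rw [← Real.exp_add, add_neg_cancel, Real.exp_zero]
    rw [hx]
    linear_combination (E.toL2 u x * E.toL2 u x * deriv (fun q => f q x) t) * h2
  have hi := integrable_mul_Lp (E.toL2 u) (E.toL2 u)
  rw [h1, ← real_inner_self_eq_norm_sq, inner_Lp_eq_integral, ← integral_const_mul,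
    ← integral_neg]
  refine integral_mono (hi.const_mul L).neg (hi.bdd_mul hmd.aestronglyMeasurable
    (Filter.Eventually.of_forall (h.abs_deriv_le t ht))) fun x => ?_
  have h2 := (abs_le.1 (h.abs_deriv_le t ht x)).1
  have h3 := mul_le_mul_of_nonneg_right h2 (mul_self_nonneg (E.toL2 u x))
  simpa only [neg_mul] using h3

theorem isQuasiCoerciveFamily [TopologicalSpace.SeparableSpace E.Dom]
    (h : IsPotentialFamily E T f W L K') (hF : IsOperatorFamily E T f Γ G Gi F K α κ) :
    IsQuasiCoerciveFamily E.toL2 0 T α (κ + L) (K * (K + K'))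
      (generatorOp Gi (fun t => F t + W t)) where
  aemeasurable v w := by
    simp only [inner_generatorOp, add_apply]
    exact (((aestronglyMeasurable_of_inner (hF.aemeasurable_form v)).add
      (aestronglyMeasurable_of_inner (h.aemeasurable v))).inner
      (aestronglyMeasurable_of_inner (hF.aemeasurable_mul_exp w))).aemeasurable
  bound t ht v := by
    refine (norm_adjoint_apply_le hF.nonneg (hF.norm_mul_exp_le t ht) _).trans ?_
    rw [mul_assoc, add_mul]
    exact mul_le_mul_of_nonneg_left ((norm_add_le _ _).trans
      (add_le_add (hF.norm_form_le t ht v) (h.norm_le t ht v))) hF.nonneg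
  pos := hF.pos
  nonneg := add_nonneg hF.kappa_nonneg h.lipschitz_nonneg
  coercive t ht v := by
    rw [inner_generatorOp, add_apply, inner_add_left]
    have h1 := hF.coercive t ht v
    have h2 := h.neg_le_inner hF ht v
    linarith

theorem isAdjointHeatSolution_iff [TopologicalSpace.SeparableSpace E.Dom]
    (h : IsPotentialFamily E T f W L K') (hF : IsOperatorFamily E T f Γ G Gi F K α κ)
    (hs : 0 ≤ s) (hst : s < τ) (hτ : τ ≤ T) (v : E.CurveSpace s τ) :
    v.IsAdjointHeatSolution Γ f ↔ ∀ᵐ t ∂(volume.restrict (Ioo s τ)),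
      v.rieszDt t = generatorOp Gi (fun t => F t + W t) t (v.curve t) := by
  have hsub := Ioo_subset_Ioo hs hτ
  have hR1 : MemLp (fun t => F t (v.curve t)) 2 (volume.restrict (Ioo s τ)) :=
    memLp_clm_apply (fun v w => (hF.aemeasurable_form v w).mono_measure
      (Measure.restrict_mono hsub le_rfl)) (fun t ht => hF.norm_form_le t (hsub ht))
      v.isWeakCurve.memLp
  have hR2 : MemLp (fun t => W t (v.curve t)) 2 (volume.restrict (Ioo s τ)) :=
    memLp_clm_apply (fun v w => (h.aemeasurable v w).mono_measure
      (Measure.restrict_mono hsub le_rfl)) (fun t ht => h.norm_le t (hsub ht))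
      v.isWeakCurve.memLp
  have key := hF.forall_integral_eq_integral_pairing_iff hs hst hτ v (hR1.add hR2)
  refine Iff.trans (forall_congr' fun w => ?_) (key.trans Iff.rfl)
  have hi : ∀ {R : ℝ → E.Dom}, MemLp R 2 (volume.restrict (Ioo s τ)) →
      IntegrableOn (fun t => ⟪R t, w.curve t⟫) (Ioo s τ) := fun hR =>
    memLp_one_iff_integrable.1 ((innerSL ℝ).memLp_of_bilin 1 hR (Lp.memLp w.curve))
  have h1 : ∫ r in Ioo s τ, energyAt Γ f r (v.curve r) (w.curve r) =
      ∫ r in Ioo s τ, ⟪F r (v.curve r), w.curve r⟫ :=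
    setIntegral_congr_fun measurableSet_Ioo fun t ht => (hF.inner_form t (hsub ht) _ _).symm
  have h2 : ∫ r in Ioo s τ, ∫ x, E.toL2 (v.curve r) x * E.toL2 (w.curve r) x *
      deriv (fun q => f q x) r ∂(weighted m f r) = ∫ r in Ioo s τ, ⟪W r (v.curve r), w.curve r⟫ :=
    setIntegral_congr_fun measurableSet_Ioo fun t ht => h.inner_eq_weighted hF (hsub ht) _ _
  rw [h1, h2, ← integral_add (hi hR1) (hi hR2)]
  simp only [Pi.add_apply, inner_add_left]

end IsPotentialFamily

end DirichletForm

theorem IsTestFun.integral_deriv_smul_add_primitive {F : Type*} [NormedAddCommGroup F]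
    [NormedSpace ℝ F] [CompleteSpace F] {s τ : ℝ} {φ : ℝ → ℝ} (hφ : IsTestFun s τ φ) (hst : s ≤ τ)
    {g : ℝ → F} (hg : IntegrableOn g (Ioo s τ)) (c : F) :
    ∫ t in Ioo s τ, _root_.deriv φ t • (c + ∫ x in s..t, g x) = - ∫ t in Ioo s τ, φ t • g t := by
  have h1 : ∫ t in Ioo s τ, _root_.deriv φ t • c = 0 := by
    rw [integral_smul_const, IntegrableOn.integral_Ioo_eq hst,
      intervalIntegral.integral_eq_sub_of_hasDerivAt (fun x _ => hφ.hasDerivAt x)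
        (hφ.deriv.continuous.intervalIntegrable _ _), hφ.eq_zero (t := s) (by simp),
      hφ.eq_zero (t := τ) (by simp), sub_zero, zero_smul]
  have hG := (IntegrableOn.intervalIntegrable_of_mem_Icc hg (left_mem_Icc.2 hst)
    (right_mem_Icc.2 hst)).absolutelyContinuousOnInterval_primitive left_mem_uIcc
  have h2 : IntegrableOn (fun t => ∫ x in s..t, g x) (Ioo s τ) :=
    (intervalIntegrable_iff_integrableOn_Ioo_of_le hst).1 hG.continuousOn.intervalIntegrable
  simp only [smul_add]
  rw [integral_add (hφ.deriv.integrableOn_smul (integrableOn_const (by simp)))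
    (hφ.deriv.integrableOn_smul h2), h1, zero_add, hφ.integral_deriv_smul_primitive hst hg]

theorem integral_mul_integral_mul_swap {X : Type*} [MeasurableSpace X] {m : Measure X} [SFinite m]
    {I : Set ℝ} (hI : MeasurableSet I) {s τ M : ℝ} (hsub : Ioo s τ ⊆ I) {b : ℝ → X → ℝ}
    (hb : Measurable (fun p : I × X => b p.1 p.2)) (hM : ∀ t ∈ I, ∀ x, |b t x| ≤ M)
    {k : X → ℝ} (hk : Integrable k m) {φ : ℝ → ℝ} (hφ : IntegrableOn φ (Ioo s τ)) :
    ∫ t in Ioo s τ, φ t * ∫ x, k x * b t x ∂m = ∫ x, k x * (∫ t in Ioo s τ, φ t * b t x) ∂m := by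
  -- Measurability of `b` is known only over `I`; Fubini is applied to a measurable extension,
  -- truncated at `|M|` to keep it bounded.
  obtain ⟨g₀, hg₀, hgb⟩ := ((MeasurableEmbedding.subtype_coe hI).prodMap
    (MeasurableEmbedding.id (α := X))).exists_measurable_extend hb fun _ => ⟨0⟩
  obtain ⟨g, hg, hgM, hgb⟩ : ∃ g : ℝ × X → ℝ, Measurable g ∧ (∀ p, |g p| ≤ |M|) ∧
      ∀ t ∈ I, ∀ x, g (t, x) = b t x := by
    refine ⟨fun p => max (-|M|) (min |M| (g₀ p)), measurable_const.max (measurable_const.min hg₀),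
      fun p => abs_le.2 ⟨le_max_left _ _, max_le (by linarith [abs_nonneg M]) (min_le_left _ _)⟩,
      fun t ht x => ?_⟩
    have h1 : g₀ (t, x) = b t x := congrFun hgb (⟨t, ht⟩, x)
    have h2 := abs_le.1 ((hM t ht x).trans (le_abs_self M))
    simp only [h1, min_eq_right h2.2, max_eq_right h2.1]
  have hint : Integrable (Function.uncurry fun t x => φ t * (k x * g (t, x)))
      ((volume.restrict (Ioo s τ)).prod m) := by
    have h1 : Integrable (fun p : ℝ × X => φ p.1 * k p.2) ((volume.restrict (Ioo s τ)).prod m) :=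
      hφ.mul_prod hk
    refine (h1.bdd_mul hg.aestronglyMeasurable (Filter.Eventually.of_forall hgM)).congr
      (Filter.Eventually.of_forall fun p => ?_)
    simp only [Function.uncurry]
    ring
  have hswap := integral_integral_swap hint
  simp only [integral_const_mul] at hswap
  have e1 : ∫ t in Ioo s τ, φ t * ∫ x, k x * b t x ∂m =
      ∫ t in Ioo s τ, φ t * ∫ x, k x * g (t, x) ∂m :=
    setIntegral_congr_fun measurableSet_Ioo fun t ht => by
      simp only [hgb t (hsub ht)]
  rw [e1, hswap]
  refine integral_congr_ae (Filter.Eventually.of_forall fun x => ?_)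
  simp only [← integral_const_mul]
  refine setIntegral_congr_fun measurableSet_Ioo fun t ht => ?_
  simp only [hgb t (hsub ht)]
  ring

/-! ### Weighted curves and duality -/

namespace DirichletForm

open scoped NNReal

variable {X : Type*} [MeasurableSpace X] {m : Measure X} {E : DirichletForm m}

local notation "⟪" x ", " y "⟫" => inner ℝ x y

variable {T B K K' α κ s τ : ℝ} {L : ℝ≥0} {f : ℝ → X → ℝ} {Γ : ℝ → E.FieldForm}
  {G Gi F W : ℝ → E.Dom →L[ℝ] E.Dom} {u v g : ℝ → E.Dom} {c d : ℝ → Lp ℝ 2 m}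

/-- On the form domain multiplication by `e^{-f_t}` is only measurable in `t`. On `L²` the Lipschitz
bound makes it Lipschitz in operator norm, so it carries continuous representatives to continuous
representatives. -/
theorem exists_expNegOp (hf : Measurable (fun p : Ioo (0 : ℝ) T × X => f p.1 p.2))
    (hB : ∀ t ∈ Ioo (0 : ℝ) T, ∀ x, |f t x| ≤ B)
    (hL : ∀ x, LipschitzOnWith L (fun t => f t x) (Ioo 0 T)) :
    ∃ M : ℝ → Lp ℝ 2 m →L[ℝ] Lp ℝ 2 m,
      (∀ t ∈ Ioo (0 : ℝ) T, ∀ u, ∀ᵐ x ∂m, M t u x = Real.exp (-f t x) * u x) ∧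
      ContinuousOn M (Ioo 0 T) := by
  have hmeas : ∀ t ∈ Ioo (0 : ℝ) T, Measurable (fun x => Real.exp (-f t x)) := fun t ht =>
    hf.neg.exp.comp (measurable_prodMk_left (x := (⟨t, ht⟩ : Ioo (0 : ℝ) T)))
  have hneg : ∀ t ∈ Ioo (0 : ℝ) T, ∀ x, -f t x ≤ B := fun t ht x =>
    (neg_le_abs _).trans (hB t ht x)
  have hex : ∀ t, ∃ Q : Lp ℝ 2 m →L[ℝ] Lp ℝ 2 m, t ∈ Ioo (0 : ℝ) T →
      ∀ u, ∀ᵐ x ∂m, Q u x = Real.exp (-f t x) * u x := fun t => by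
    by_cases ht : t ∈ Ioo (0 : ℝ) T
    · obtain ⟨Q, hQ, -⟩ := exists_mul_clm (m := m) (hmeas t ht).aestronglyMeasurable
        (B := Real.exp B) (Filter.Eventually.of_forall fun x => by
          rw [abs_of_pos (Real.exp_pos _)]
          exact Real.exp_le_exp.2 (hneg t ht x))
      exact ⟨Q, fun _ => hQ⟩
    · exact ⟨0, fun h => absurd h ht⟩
  choose M hM using hex
  refine ⟨M, hM, LipschitzOnWith.continuousOn (K := (Real.exp B).toNNReal * L)
    (LipschitzOnWith.of_dist_le_mul fun t ht t' ht' => ?_)⟩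
  have hb : ∀ x, |Real.exp (-f t x) - Real.exp (-f t' x)| ≤ Real.exp B * (L * dist t t') :=
    fun x => (abs_exp_sub_exp_le (hneg t ht x) (hneg t' ht' x)).trans
      (mul_le_mul_of_nonneg_left (by
        rw [neg_sub_neg, abs_sub_comm]
        exact (hL x).dist_le_mul t ht t' ht') (Real.exp_pos _).le)
  obtain ⟨Q, hQ, hQn⟩ := exists_mul_clm (m := m)
    ((hmeas t ht).sub (hmeas t' ht')).aestronglyMeasurable (Filter.Eventually.of_forall hb)
  rw [dist_eq_norm, NNReal.coe_mul, Real.coe_toNNReal _ (Real.exp_pos _).le, mul_assoc]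
  refine ContinuousLinearMap.opNorm_le_bound _ (by positivity) fun u => ?_
  have h1 : (M t - M t') u = Q u := by
    rw [sub_apply]
    refine Lp.ext ?_
    filter_upwards [Lp.coeFn_sub (M t u) (M t' u), hM t ht u, hM t' ht' u, hQ u]
      with x h1 h2 h3 h4
    rw [h1, Pi.sub_apply, h2, h3, h4, Pi.sub_apply, sub_mul]
  rw [h1]
  exact hQn u

variable [TopologicalSpace.SeparableSpace E.Dom]

namespace IsPotentialFamily

theorem memLp_apply (h : IsPotentialFamily E T f W L K') (hs : 0 ≤ s) (hτ : τ ≤ T)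
    (hv : MemLp v 2 (volume.restrict (Ioo s τ))) :
    MemLp (fun t => W t (v t)) 2 (volume.restrict (Ioo s τ)) :=
  memLp_clm_apply (fun v w => (h.aemeasurable v w).mono_measure
    (Measure.restrict_mono (Ioo_subset_Ioo hs hτ) le_rfl))
    (fun t ht => h.norm_le t (Ioo_subset_Ioo hs hτ ht)) hv

variable [SFinite m]

/-- After pairing with a fixed `w`, Fubini reduces the weak derivative to integration by parts in
`t` for each `x`, where `t ↦ e^{-f_t(x)}` is absolutely continuous. The strict inequalities keep
`[s, τ]` inside `(0, T)`, where `f` is controlled. -/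
theorem isWeakCurve_mul_exp_neg (h : IsPotentialFamily E T f W L K')
    (hF : IsOperatorFamily E T f Γ G Gi F K α κ)
    (hB : ∀ t ∈ Ioo (0 : ℝ) T, ∀ x, |f t x| ≤ B)
    (hL : ∀ x, LipschitzOnWith L (fun t => f t x) (Ioo 0 T))
    (hs : 0 < s) (hst : s ≤ τ) (hτ : τ < T) (ψ : E.Dom) :
    IsWeakCurve E.toL2 s τ (fun t => G t ψ) (fun t => - W t ψ) := by
  have hsub := Ioo_subset_Ioo hs.le hτ.le
  have hsub' : Icc s τ ⊆ Ioo 0 T := Icc_subset_Ioo hs hτ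
  have hGm : MemLp (fun t => G t ψ) 2 (volume.restrict (Ioo s τ)) :=
    memLp_clm_apply (fun v w => (hF.aemeasurable_mul_exp_neg v w).mono_measure
      (Measure.restrict_mono hsub le_rfl)) (fun t ht => hF.norm_mul_exp_neg_le t (hsub ht))
      (continuous_const.memLp_two_restrict_Ioo (f := fun _ => ψ))
  have hWm : MemLp (fun t => W t ψ) 2 (volume.restrict (Ioo s τ)) :=
    h.memLp_apply hs.le hτ.le (continuous_const.memLp_two_restrict_Ioo (f := fun _ => ψ))
  refine ⟨hGm, hWm.neg, fun φ hφ => ext_inner_left ℝ fun w => ?_⟩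
  have hi1 : IntegrableOn (fun t => gramOp E.toL2 (G t ψ)) (Ioo s τ) :=
    (gramOp E.toL2).integrable_comp hGm.integrableOn_Ioo
  simp only [smul_neg, integral_neg, neg_neg]
  rw [← integral_inner (hφ.deriv.integrableOn_smul hi1),
    ← integral_inner (hφ.integrableOn_smul hWm.integrableOn_Ioo)]
  have hk := integrable_mul_Lp (E.toL2 ψ) (E.toL2 w)
  have e1 : ∫ t in Ioo s τ, ⟪w, deriv φ t • gramOp E.toL2 (G t ψ)⟫ = ∫ t in Ioo s τ, deriv φ t *
      ∫ x, E.toL2 ψ x * E.toL2 w x * Real.exp (-f t x) ∂m :=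
    setIntegral_congr_fun measurableSet_Ioo fun t ht => by
      simp only [real_inner_smul_right, inner_gramOp_right, inner_Lp_eq_integral]
      congr 1
      refine integral_congr_ae ?_
      filter_upwards [hF.mul_exp_neg t (hsub ht) ψ] with x hx
      rw [hx]; ring
  have e2 : ∫ t in Ioo s τ, ⟪w, φ t • W t ψ⟫ = ∫ t in Ioo s τ, φ t *
      ∫ x, E.toL2 ψ x * E.toL2 w x * (deriv (fun q => f q x) t * Real.exp (-f t x)) ∂m :=
    setIntegral_congr_fun measurableSet_Ioo fun t ht => by
      rw [real_inner_smul_right, real_inner_comm, h.inner_eq t (hsub ht)]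
  have hexp : ∀ t ∈ Ioo (0 : ℝ) T, ∀ x, |Real.exp (-f t x)| ≤ Real.exp B := fun t ht x => by
    rw [abs_of_pos (Real.exp_pos _)]
    exact Real.exp_le_exp.2 ((neg_le_abs _).trans (hB t ht x))
  rw [e1, e2, integral_mul_integral_mul_swap measurableSet_Ioo hsub (M := Real.exp B)
      hF.measurable.neg.exp hexp hk hφ.deriv.continuous.memLp_two_restrict_Ioo.integrableOn_Ioo,
    integral_mul_integral_mul_swap measurableSet_Ioo hsub (M := L * Real.exp B)
      (b := fun t x => deriv (fun q => f q x) t * Real.exp (-f t x))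
      (h.measurable_deriv.mul hF.measurable.neg.exp) (fun t ht x => by
        rw [abs_mul]
        exact mul_le_mul (h.abs_deriv_le t ht x) (hexp t ht x) (abs_nonneg _) L.2) hk
      hφ.continuous.memLp_two_restrict_Ioo.integrableOn_Ioo]
  refine integral_congr_ae (Filter.Eventually.of_forall fun x => ?_)
  simp only
  rw [integral_deriv_testFun_mul_exp_neg hφ hst ((hL x).mono hsub')
    fun t ht => hB t (hsub' ht) x]

/-- The weight is moved to the test vector: in `L²` the product of `e^{-f} v` and `ψ` equals that of
`v` and `e^{-f} ψ`. The product rule for the weak curves `v` and `G ψ` then gives the derivative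
`⟪g, G ψ⟫ - ⟪W ψ, v⟫`. -/
theorem isWeakCurve_mul_exp_neg_apply (h : IsPotentialFamily E T f W L K')
    (hF : IsOperatorFamily E T f Γ G Gi F K α κ)
    (hB : ∀ t ∈ Ioo (0 : ℝ) T, ∀ x, |f t x| ≤ B)
    (hL : ∀ x, LipschitzOnWith L (fun t => f t x) (Ioo 0 T))
    (hs : 0 < s) (hst : s < τ) (hτ : τ < T) (hv : IsWeakCurve E.toL2 s τ v g) :
    IsWeakCurve E.toL2 s τ (fun t => G t (v t))
      (fun t => ContinuousLinearMap.adjoint (G t) (g t) - W t (v t)) := by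
  have hsub := Ioo_subset_Ioo hs.le hτ.le
  have hGm : MemLp (fun t => G t (v t)) 2 (volume.restrict (Ioo s τ)) :=
    memLp_clm_apply (fun v w => (hF.aemeasurable_mul_exp_neg v w).mono_measure
      (Measure.restrict_mono hsub le_rfl)) (fun t ht => hF.norm_mul_exp_neg_le t (hsub ht)) hv.memLp
  have hdm : MemLp (fun t => ContinuousLinearMap.adjoint (G t) (g t) - W t (v t)) 2
      (volume.restrict (Ioo s τ)) := (hF.memLp_adjoint_mul_exp_neg hs.le hτ.le hv.memLp_deriv).sub
    (h.memLp_apply hs.le hτ.le hv.memLp)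
  refine ⟨hGm, hdm, fun φ hφ => ext_inner_left ℝ fun ψ => ?_⟩
  have hi1 : IntegrableOn (fun t => gramOp E.toL2 (G t (v t))) (Ioo s τ) :=
    (gramOp E.toL2).integrable_comp hGm.integrableOn_Ioo
  rw [inner_neg_right, ← integral_inner (hφ.deriv.integrableOn_smul hi1),
    ← integral_inner (hφ.integrableOn_smul hdm.integrableOn_Ioo)]
  have hz := h.isWeakCurve_mul_exp_neg hF hB hL hs hst.le hτ ψ
  obtain ⟨c, hc⟩ := hv.exists_contRep hst toL2_injective denseRange_toL2
  obtain ⟨d, hd⟩ := hz.exists_contRep hst toL2_injective denseRange_toL2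
  have hk := (hv.integrableOn_inner hz).add (hz.integrableOn_inner hv)
  have hprod := hφ.integral_deriv_smul_add_primitive hst.le hk ⟪c s, d s⟫
  have e1 : ∫ t in Ioo s τ, ⟪ψ, deriv φ t • gramOp E.toL2 (G t (v t))⟫ =
      ∫ t in Ioo s τ, deriv φ t • (⟪c s, d s⟫ + ∫ x in s..t,
        ((fun t => ⟪g t, G t ψ⟫) + fun t => ⟪- W t ψ, v t⟫) x) := by
    refine integral_congr_ae ?_
    filter_upwards [hc.ae_eq, hd.ae_eq, ae_restrict_mem measurableSet_Ioo] with t h1 h2 ht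
    have h3 := hv.inner_sub_inner_eq_integral hz hst toL2_injective denseRange_toL2 hc hd
      (left_mem_Icc.2 hst.le) (Ioo_subset_Icc_self ht)
    simp only [Pi.add_apply]
    rw [← h3, add_sub_cancel, h1, h2, real_inner_smul_right, inner_gramOp_right, smul_eq_mul,
      hF.inner_toL2_mul_exp_neg (hsub ht) (v t) ψ, real_inner_comm]
  rw [e1, hprod]
  congr 1
  refine setIntegral_congr_fun measurableSet_Ioo fun t ht => ?_
  simp only [Pi.add_apply, smul_eq_mul, real_inner_smul_right, inner_sub_right,
    inner_neg_left, ContinuousLinearMap.adjoint_inner_right]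
  rw [h.symm (hsub ht) ψ, real_inner_comm (g t), real_inner_comm ψ]
  ring

end IsPotentialFamily

/-- The product rule applies to `u` and `e^{-f} v`. The heat equation contributes `-E_t(u, v)`, the
adjoint equation contributes `E_t(v, u)` plus the potential, and the derivative of the weight
removes the potential. By symmetry of `E_t` nothing is left. -/
theorem IsPotentialFamily.integral_mul_weighted_eq [SFinite m]
    (h : IsPotentialFamily E T f W L K')
    (hF : IsOperatorFamily E T f Γ G Gi F K α κ)
    (hB : ∀ t ∈ Ioo (0 : ℝ) T, ∀ x, |f t x| ≤ B)
    (hL : ∀ x, LipschitzOnWith L (fun t => f t x) (Ioo 0 T))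
    (hs : 0 < s) (hst : s < τ) (hτ : τ < T)
    (hu : IsEvolution E.toL2 (generatorOp Gi F) s τ u c)
    (hv : IsBackwardEvolution E.toL2 (generatorOp Gi (fun t => F t + W t)) s τ v d) :
    ∫ x, c τ x * d τ x ∂(weighted m f τ) = ∫ x, c s x * d s x ∂(weighted m f s) := by
  have hsub := Ioo_subset_Ioo hs.le hτ.le
  have hsub' : Icc s τ ⊆ Ioo 0 T := Icc_subset_Ioo hs hτ
  obtain ⟨M, hM, hMc⟩ := exists_expNegOp (m := m) hF.measurable hB hL
  have hw := h.isWeakCurve_mul_exp_neg_apply hF hB hL hs hst hτ hv.isWeakCurve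
  have hrep : IsContRepOn E.toL2 s τ (fun t => G t (v t)) (fun t => M t (d t)) := by
    refine ⟨(hMc.mono hsub').clm_apply hv.isContRepOn.continuousOn, ?_⟩
    filter_upwards [hv.isContRepOn.ae_eq, ae_restrict_mem measurableSet_Ioo] with t h1 ht
    refine Lp.ext ?_
    filter_upwards [hM t (hsub ht) (d t), hF.mul_exp_neg t (hsub ht) (v t)] with x h2 h3
    rw [h2, h3, h1, mul_comm]
  have hconst := hu.isWeakCurve.inner_sub_inner_eq_integral hw hst toL2_injective denseRange_toL2
    hu.isContRepOn hrep (left_mem_Icc.2 hst.le) (right_mem_Icc.2 hst.le)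
  have hzero : ∫ t in s..τ, (⟪- generatorOp Gi F t (u t), G t (v t)⟫ +
      ⟪ContinuousLinearMap.adjoint (G t) (generatorOp Gi (fun t => F t + W t) t (v t)) -
        W t (v t), u t⟫) = 0 := by
    rw [← IntegrableOn.integral_Ioo_eq hst.le]
    refine setIntegral_eq_zero_of_forall_eq_zero fun t ht => ?_
    have h1 : ContinuousLinearMap.adjoint (G t)
        (generatorOp Gi (fun t => F t + W t) t (v t)) = F t (v t) + W t (v t) :=
      hF.adjoint_mul_exp_neg_adjoint_mul_exp (hsub ht) _
    rw [h1, add_sub_cancel_right, inner_neg_left, inner_generatorOp,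
      hF.mul_exp_mul_exp_neg (hsub ht), hF.symm t (hsub ht)]
    ring
  rw [hzero, sub_eq_zero] at hconst
  have key : ∀ t ∈ Ioo (0 : ℝ) T,
      ∫ x, c t x * d t x ∂(weighted m f t) = ⟪c t, M t (d t)⟫ := fun t ht => by
    rw [integral_weighted (hF.measurable.comp
      (measurable_prodMk_left (x := (⟨t, ht⟩ : Ioo (0 : ℝ) T)))), inner_Lp_eq_integral]
    refine integral_congr_ae ?_
    filter_upwards [hM t ht (d t)] with x hx
    rw [hx]; ring
  rw [key τ (hsub' (right_mem_Icc.2 hst.le)), key s (hsub' (left_mem_Icc.2 hst.le)), hconst]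

end DirichletForm

/-! ### Well-posedness in the space of curves -/

namespace DirichletForm

variable {X : Type*} [MeasurableSpace X] {m : Measure X} {E : DirichletForm m}
  {s τ T α κ K : ℝ} {A : ℝ → E.Dom →L[ℝ] E.Dom}

namespace CurveSpace

theorem isEvolution {u : E.CurveSpace s τ} {c : ℝ → Lp ℝ 2 m}
    (hu : ∀ᵐ t ∂(volume.restrict (Ioo s τ)), u.rieszDt t = - A t (u.curve t))
    (hc : u.IsContRep c) : IsEvolution E.toL2 A s τ u.curve c :=
  ⟨u.isWeakCurve.congr (ae_eq_refl _) hu, isContRep_iff.1 hc⟩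

theorem isBackwardEvolution {u : E.CurveSpace s τ} {c : ℝ → Lp ℝ 2 m}
    (hu : ∀ᵐ t ∂(volume.restrict (Ioo s τ)), u.rieszDt t = A t (u.curve t))
    (hc : u.IsContRep c) : IsBackwardEvolution E.toL2 A s τ u.curve c :=
  ⟨u.isWeakCurve.congr (ae_eq_refl _) hu, isContRep_iff.1 hc⟩

theorem existsUnique_of_isEvolution (hA : IsQuasiCoerciveFamily E.toL2 s τ α κ K A) (hst : s < τ)
    {w : ℝ → E.Dom} {c : ℝ → Lp ℝ 2 m} (hw : IsEvolution E.toL2 A s τ w c) :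
    ∃! u : E.CurveSpace s τ, (∀ᵐ t ∂(volume.restrict (Ioo s τ)),
      u.rieszDt t = - A t (u.curve t)) ∧ u.HasValueAt s (c s) := by
  obtain ⟨u, hu1, hu2⟩ := exists_of_isWeakCurve hw.isWeakCurve
  have hu : ∀ᵐ t ∂(volume.restrict (Ioo s τ)), u.rieszDt t = - A t (u.curve t) := by
    filter_upwards [hu1, hu2] with t h1 h2
    rw [h1, h2]
  have hc : u.IsContRep c := isContRep_iff.2 (hw.isContRepOn.congr_left hu1.symm)
  refine ⟨u, ⟨hu, c, hc, rfl⟩, ?_⟩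
  rintro v ⟨hv, d, hd, hds⟩
  exact eq_of_curve_ae_eq ((isEvolution hv hd).ae_eq hA hst toL2_injective denseRange_toL2
    (isEvolution hu hc) hds)

theorem existsUnique_of_isBackwardEvolution (hA : IsQuasiCoerciveFamily E.toL2 s τ α κ K A)
    (hst : s < τ) {w : ℝ → E.Dom} {c : ℝ → Lp ℝ 2 m} (hw : IsBackwardEvolution E.toL2 A s τ w c) :
    ∃! u : E.CurveSpace s τ, (∀ᵐ t ∂(volume.restrict (Ioo s τ)),
      u.rieszDt t = A t (u.curve t)) ∧ u.HasValueAt τ (c τ) := by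
  obtain ⟨u, hu1, hu2⟩ := exists_of_isWeakCurve hw.isWeakCurve
  have hu : ∀ᵐ t ∂(volume.restrict (Ioo s τ)), u.rieszDt t = A t (u.curve t) := by
    filter_upwards [hu1, hu2] with t h1 h2
    rw [h1, h2]
  have hc : u.IsContRep c := isContRep_iff.2 (hw.isContRepOn.congr_left hu1.symm)
  refine ⟨u, ⟨hu, c, hc, rfl⟩, ?_⟩
  rintro v ⟨hv, d, hd, hds⟩
  exact eq_of_curve_ae_eq ((isBackwardEvolution hv hd).ae_eq hA hst toL2_injective denseRange_toL2
    (isBackwardEvolution hu hc) hds)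

end CurveSpace

end DirichletForm

/-! ### The main theorem -/

theorem mainTheorem12 {X : Type*} [TopologicalSpace X] [PolishSpace X] [MeasurableSpace X]
    [BorelSpace X] (m : Measure X) [SigmaFinite m] [m.IsOpenPosMeasure]
    (E : DirichletForm m) (hE : E.IsStronglyLocal)
    (Γ₀ : E.FieldForm) (hΓ₀ : E.IsSquareField Γ₀)
    (T : ℝ) (hT : 0 < T)
    (f : ℝ → X → ℝ)
    (hf_meas : Measurable (fun p : Ioo (0 : ℝ) T × X => f p.1 p.2))
    (hf_bdd : ∃ C : ℝ, ∀ t ∈ Ioo (0 : ℝ) T, ∀ x, |f t x| ≤ C)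
    (hf_dom : ∀ t ∈ Ioo (0 : ℝ) T, ∃ w : E.Dom, E.toL2 w =ᵐ[m] f t)
    (hf_grad : ∃ C : ℝ, ∀ t ∈ Ioo (0 : ℝ) T,
      ∀ᵐ x ∂m, Γ₀ (E.ofFun (f t)) (E.ofFun (f t)) x ≤ C)
    (Γ : ℝ → E.FieldForm)
    (hΓ_symm : ∀ t ∈ Ioo (0 : ℝ) T, ∀ u v, Γ t u v = Γ t v u)
    (hΓ_nonneg : ∀ t ∈ Ioo (0 : ℝ) T, ∀ u, ∀ᵐ x ∂m, 0 ≤ Γ t u u x)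
    (hΓ_diff : ∀ t ∈ Ioo (0 : ℝ) T, E.HasDiffusionProperty (Γ t))
    (hΓ_ell : ∃ C : ℝ, 0 < C ∧ ∀ t ∈ Ioo (0 : ℝ) T, ∀ u, ∀ᵐ x ∂m,
      1 / C * Γ₀ u u x ≤ Γ t u u x ∧ Γ t u u x ≤ C * Γ₀ u u x)
    (hΓ_meas : ∀ u v : E.Dom, AEMeasurable (fun t => DirichletForm.energyAt Γ f t u v)
      (volume.restrict (Ioo (0 : ℝ) T))) :
    -- the heat equation
    (∀ s τ : ℝ, 0 ≤ s → s < τ → τ ≤ T → ∀ h : Lp ℝ 2 m,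
      (∃! u : E.CurveSpace s τ, u.IsHeatSolution Γ f ∧ u.HasValueAt s h) ∧
      (∀ u : E.CurveSpace s τ, u.HasValueAt s h ↔ u.HasInitialLimit h)) ∧
    -- the heat propagator
    ∃ P : ℝ → ℝ → (Lp ℝ 2 m →L[ℝ] Lp ℝ 2 m),
      (∀ t, 0 ≤ t → t ≤ T → P t t = ContinuousLinearMap.id ℝ (Lp ℝ 2 m)) ∧
      (∀ s τ : ℝ, 0 ≤ s → s < τ → τ ≤ T → ∀ (h : Lp ℝ 2 m) (u : E.CurveSpace s τ),
        u.IsHeatSolution Γ f → u.HasValueAt s h → u.IsContRep (fun t => P t s h)) ∧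
      (∀ r s t : ℝ, 0 ≤ r → r ≤ s → s ≤ t → t ≤ T → P t r = (P t s).comp (P s r)) ∧
      -- the adjoint heat equation, for `f` Lipschitz in time
      ((∃ L : ℝ, ∀ s ∈ Ioo (0 : ℝ) T, ∀ t ∈ Ioo (0 : ℝ) T, ∀ x,
          |f t x - f s x| ≤ L * |t - s|) →
        (∀ σ t : ℝ, 0 ≤ σ → σ < t → t ≤ T → ∀ g : Lp ℝ 2 m,
          ∃! v : E.CurveSpace σ t, v.IsAdjointHeatSolution Γ f ∧ v.HasValueAt t g) ∧
        ∃ Pstar : ℝ → ℝ → (Lp ℝ 2 m →L[ℝ] Lp ℝ 2 m),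
          (∀ t, 0 ≤ t → t ≤ T → Pstar t t = ContinuousLinearMap.id ℝ (Lp ℝ 2 m)) ∧
          (∀ σ t : ℝ, 0 ≤ σ → σ < t → t ≤ T → ∀ (g : Lp ℝ 2 m) (v : E.CurveSpace σ t),
            v.IsAdjointHeatSolution Γ f → v.HasValueAt t g →
              v.IsContRep (fun s => Pstar t s g)) ∧
          (∀ r s t : ℝ, 0 ≤ r → r ≤ s → s ≤ t → t ≤ T → Pstar t r = (Pstar s r).comp (Pstar t s)) ∧
          -- duality
          (∀ s t : ℝ, 0 < s → s ≤ t → t < T → ∀ g h : Lp ℝ 2 m,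
            ∫ x, P t s h x * g x ∂(DirichletForm.weighted m f t) =
              ∫ x, h x * Pstar t s g x ∂(DirichletForm.weighted m f s))) := by
  obtain ⟨B, hB⟩ := hf_bdd
  obtain ⟨D, hD⟩ := hf_grad
  obtain ⟨C, hC, hell⟩ := hΓ_ell
  have hsep : TopologicalSpace.SeparableSpace E.Dom := DirichletForm.separableSpace_dom
  -- The constants `B` and `D` may be negative when the bounds are vacuous, hence the maxima with
  -- zero.
  have hfam : DirichletForm.IsTimeDependentFamily E Γ₀ T f Γ (fun t => E.ofFun (f t)) C
      (max B 0) (max D 0) := by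
    refine ⟨fun t ht => ⟨hΓ₀.energy_eq, hΓ_symm t ht, hΓ_nonneg t ht, hΓ_diff t ht, hC,
      hell t ht⟩, fun t ht => ⟨?_, ?_, fun x => (hB t ht x).trans (le_max_left _ _), ?_,
      le_max_right _ _, le_max_right _ _⟩, hf_meas, hΓ_meas⟩
    · exact hf_meas.comp (measurable_prodMk_left (x := (⟨t, ht⟩ : Ioo (0 : ℝ) T)))
    · obtain ⟨w, hw⟩ := hf_dom t ht
      rw [DirichletForm.ofFun_eq hw]
      exact hw
    · filter_upwards [hD t ht] with x hx
      exact hx.trans (le_max_left _ _)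
  obtain ⟨G, Gi, F, K, α, κ, hF⟩ := hfam.exists_operatorFamily hT
  have hA := hF.isQuasiCoerciveFamily
  obtain ⟨P, hP_id, hP_ex, hP_uniq, hP_comp⟩ := hA.exists_propagator
    DirichletForm.toL2_injective DirichletForm.denseRange_toL2
  refine ⟨fun s τ hs hst hτ h => ⟨?_, fun u => u.hasValueAt_iff_hasInitialLimit hst h⟩,
    P, fun t _ _ => hP_id t, fun s τ hs hst hτ h u hu hval => ?_, hP_comp, fun ⟨L, hL⟩ => ?_⟩
  · obtain ⟨w, hw⟩ := hP_ex s τ hs hst hτ h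
    have hex := DirichletForm.CurveSpace.existsUnique_of_isEvolution
      (hA.mono (Ioo_subset_Ioo hs hτ)) hst hw
    simpa only [hF.isHeatSolution_iff hs hst hτ, hP_id, ContinuousLinearMap.id_apply] using hex
  · obtain ⟨c, hc, hcs⟩ := hval
    have hev := DirichletForm.CurveSpace.isEvolution ((hF.isHeatSolution_iff hs hst hτ u).1 hu) hc
    exact DirichletForm.CurveSpace.isContRep_iff.2
      (hev.isContRepOn.congr_right (hP_uniq s τ hs hst hτ h _ _ hev hcs).symm)
  have hlip : ∀ x, LipschitzOnWith (max L 0).toNNReal (fun t => f t x) (Ioo 0 T) := fun x =>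
    LipschitzOnWith.of_dist_le_mul fun t ht s hs => by
      rw [Real.coe_toNNReal _ (le_max_right _ _)]
      exact (hL s hs t ht x).trans (mul_le_mul_of_nonneg_right (le_max_left _ _) (abs_nonneg _))
  obtain ⟨W, hW⟩ := DirichletForm.exists_potentialFamily (E := E) hf_meas hB hlip
  have hA' := hW.isQuasiCoerciveFamily hF
  obtain ⟨Q, hQ_id, hQ_ex, hQ_uniq, hQ_comp⟩ := hA'.exists_backward_propagator
    DirichletForm.toL2_injective DirichletForm.denseRange_toL2
  refine ⟨fun σ t hσ hσt ht g => ?_, Q, fun t _ _ => hQ_id t,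
    fun σ t hσ hσt ht g v hv hval => ?_, hQ_comp, fun s t hs hst ht g h => ?_⟩
  · obtain ⟨w, hw⟩ := hQ_ex σ t hσ hσt ht g
    have hex := DirichletForm.CurveSpace.existsUnique_of_isBackwardEvolution
      (hA'.mono (Ioo_subset_Ioo hσ ht)) hσt hw
    simpa only [hW.isAdjointHeatSolution_iff hF hσ hσt ht, hQ_id, ContinuousLinearMap.id_apply]
      using hex
  · obtain ⟨c, hc, hct⟩ := hval
    have hev := DirichletForm.CurveSpace.isBackwardEvolution
      ((hW.isAdjointHeatSolution_iff hF hσ hσt ht v).1 hv) hc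
    exact DirichletForm.CurveSpace.isContRep_iff.2
      (hev.isContRepOn.congr_right (hQ_uniq σ t hσ hσt ht g _ _ hev hct).symm)
  -- For `s = t` both propagators are the identity; otherwise both evolutions live on `[s, t]`,
  -- inside the open interval `(0, T)`.
  · rcases hst.eq_or_lt with rfl | hst
    · simp only [hP_id, hQ_id, ContinuousLinearMap.id_apply]
    · obtain ⟨u, hu⟩ := hP_ex s t hs.le hst ht.le h
      obtain ⟨v, hv⟩ := hQ_ex s t hs.le hst ht.le g
      have hdual := hW.integral_mul_weighted_eq hF hB hlip hs hst ht hu hv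
      simpa only [hP_id, hQ_id, ContinuousLinearMap.id_apply] using hdual
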